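/- \textbf{Setting.} Let $X,Y$ be nonempty compact convex subsets of Euclidean spaces, with $\operatorname{diam}X\le D_X$, $\operatorname{diam}Y\le D_Y$, $D_X,D_Y>0$, and $D=\sqrt{D_X^2+D_Y^2}$. Let $L>0$, $\delta,\mu,\nu\in[0,L]$. In a two-person game, Player 1 maximizes $u_1(x,y)$ over $x\in X$ and Player 2 maximizes $u_2(x,y)$ over $y\in Y$. Put $g=-\frac12(u_1+u_2)$ and $h=\frac12(-u_1+u_2)$. The game is a \emph{monotone $\delta$-near-zero-sum game with moduli $\mu,\nu$} if $u_1,u_2$ are $L$-smooth on $X\times Y$ (their gradients are $L$-Lipschitz), $h(\cdot,y)-\frac\mu2\|\cdot\|^2$ is convex for each $y\in Y$, $h(x,\cdot)+\frac\nu2\|\cdot\|^2$ is concave for each $x\in X$, and $g$ is jointly convex and $\delta$-smooth. A point $(\hat x,\hat y)\in X\times Y$ is an \emph{$\epsilon$-approximate Nash equilibrium} if $u_1(\hat x,\hat y)\ge u_1(x,\hat y)-\epsilon$ for all $x\in X$ and $u_2(\hat x,\hat y)\ge u_2(\hat x,y)-\epsilon$ for all $y\in Y$. A gradient query at $z\in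 X\times Y$ returns $\nabla u_1(z)$ and $\nabla u_2(z)$; methods are deterministic and adaptive. \textbf{Method.} Let $\epsilon>0$, $z_0=(x_0,y_0)\in X\times Y$, and \[\bar\mu=\mu+\min\{\tfrac{\epsilon}{2D_X^2},L\},\quad \bar\nu=\nu+\min\{\tfrac{\epsilon}{2D_Y^2},L\},\quad m=\min\{\bar\mu,\bar\nu\},\] \[\eta=\frac1{\max\{\delta,m\}},\quad \theta=\frac{m}{\eta^{-1}+m},\quad \epsilon'=\frac{\epsilon^2}{128L^2D^2}.\] The regularized game has the utilities $\hat u_1=u_1-a\|x-x_0\|^2+b\|y-y_0\|^2$ and $\hat u_2=u_2+a\|x-x_0\|^2-b\|y-y_0\|^2$, where $a=\min\{\frac{\epsilon}{4D_X^2},\frac L2\}$ and $b=\min\{\frac{\epsilon}{4D_Y^2},\frac L2\}$; its coupling part is $g$, and $\hat h=\frac12(-\hat u_1+\hat u_2)$. \emph{Iterative coupling linearization (ICL)} on the regularized game, started at $z_0$, computes in iteration $t$ a point $z_{t+1}=(x_{t+1},y_{t+1})\in X\times Y$ with \[\langle\nabla_x\phi_t(z_{t+1}),x_{t+1}-x\rangle-\langle\nabla_y\phi_t(z_{t+1}),y_{t+1}-y\rangle\le\frac{\theta\epsilon'}{4\eta}\quad\text{for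 all }x\in X,\ y\in Y,\] where $\phi_t(x,y)=\langle\nabla_xg(z_t),x\rangle+\frac1{2\eta}\|x-x_t\|^2+\hat h(x,y)-\langle\nabla_yg(z_t),y\rangle-\frac1{2\eta}\|y-y_t\|^2$. The extragradient step from $z=(x,y)$ is $\bigl(\Pi_X(x+\gamma\nabla_x\hat u_1(z)),\,\Pi_Y(y+\gamma\nabla_y\hat u_2(z))\bigr)$ with $\gamma=\frac1{2\sqrt2L}$ and $\Pi$ the Euclidean projection. \textbf{Statement.} Write $\overline{\log}\,s=\max\{1,\log s\}$. There is an absolute constant $C$ such that the following holds for all such $X,Y,D_X,D_Y,L,\delta,\mu,\nu,\epsilon,z_0$ with $\mu=0$ or $\nu=0$. (i) For every monotone $\delta$-near-zero-sum game with moduli $\mu,\nu$, every run of ICL on the regularized game and every $T\ge\frac1\theta\log\frac{2D^2}{\epsilon'}$, the extragradient step from $z_T$ gives an $\epsilon$-approximate Nash equilibrium of the original game. (ii) There is a gradient method for the subproblems of ICL (not depending on the game) that finds, for every such game and every $z_t\in X\times Y$, a point $z_{t+1}$ as required, and with which ICL with $T=\lceil\frac1\theta\log\frac{2D^2}{\epsilon'}\rceil$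 iterations (none if this is negative), followed by one extragradient step, finds an $\epsilon$-approximate Nash equilibrium of the original game with at most \[C\left(\frac{L}{\sqrt{\bar\mu\bar\nu}}+\frac{L}{\min\{\bar\mu,\bar\nu\}}\min\Bigl\{1,\sqrt{\tfrac{\delta}{\bar\mu+\bar\nu}}\Bigr\}\right)\overline{\log}\Bigl(\frac{L^2D^2}{\min\{\bar\mu,\bar\nu\}\,\epsilon}\Bigr)\overline{\log}\Bigl(\frac{LD^2}{\epsilon}\Bigr)\] gradient queries in total. This number is moreover at most (a) if $\mu>0$, $\nu=0$, $\epsilon\le2LD_Y^2$ and $\bar\nu\le\bar\mu$ (both inequalities hold if $\epsilon\le2\mu D_Y^2$): $\displaystyle C\left(\frac{LD_Y}{\sqrt{\mu\epsilon}}+\frac{LD_Y^2}{\epsilon}\min\Bigl\{1,\sqrt{\tfrac\delta\mu}\Bigr\}\right)\overline{\log}^2\Bigl(\frac{LD^2}{\epsilon}\Bigr)$; (b) if $\mu=0$, $\nu>0$, $\epsilon\le2LD_X^2$ and $\bar\mu\le\bar\nu$ (both inequalities hold if $\epsilon\le2\nu D_X^2$): $\displaystyle C\left(\frac{LD_X}{\sqrt{\nu\epsilon}}+\frac{LD_X^2}{\epsilon}\min\Bigl\{1,\sqrt{\tfrac\delta\nu}\Bigr\}\right)\overline{\log}^2\Bigl(\frac{LD^2}{\epsilon}\Bigr)$;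 (c) if $\mu=\nu=0$ and $\epsilon\le2L\min\{D_X^2,D_Y^2\}$: $\displaystyle C\left(\frac{LD_XD_Y}{\epsilon}+\frac{LD^2}{\epsilon}\min\Bigl\{1,\sqrt{\tfrac{\delta}{\epsilon/D_X^2+\epsilon/D_Y^2}}\Bigr\}\right)\overline{\log}^2\Bigl(\frac{LD^2}{\epsilon}\Bigr)$. -/

import Mathlib

open scoped RealInnerProductSpace

noncomputable section

/-! ### Gradient methods and their query count -/

/-- A deterministic method that adaptively queries an oracle (queries in `Q`, answers in `A`) and
finally returns an element of `O`: it either stops with an output, or it makes a query and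
continues in a way that depends on the answer. Everything except the queries is free. -/
inductive QueryMethod (Q A O : Type*) where
  | output (o : O) : QueryMethod Q A O
  | query (q : Q) (next : A → QueryMethod Q A O) : QueryMethod Q A O

namespace QueryMethod

variable {Q A O O' : Type*}

/-- What the method returns when the oracle is `f`. -/
def run (f : Q → A) : QueryMethod Q A O → O
  | output o => o
  | query q next => run f (next (f q))

/-- The number of queries that the method makes when the oracle is `f`. -/
def numQueries (f : Q → A) : QueryMethod Q A O → ℕ
  | output _ => 0
  | query q next => numQueries f (next (f q)) + 1

/-- Run a method, then continue with a method that depends on its output. -/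
def bind : QueryMethod Q A O → (O → QueryMethod Q A O') → QueryMethod Q A O'
  | output o, k => k o
  | query q next, k => query q fun a => bind (next a) k

end QueryMethod

/-! ### Two-person games -/

/-- The product of two Euclidean spaces, with `⟪z', z⟫ = ⟪x', x⟫ + ⟪y', y⟫`. -/
abbrev PairSpace (E F : Type*) := WithLp 2 (E × F)

/-- A two-person game: the two utility functions together with their gradient fields. That the
latter are the gradients on the strategy sets is part of `IsSmoothOn` below; the values
outside the strategy sets play no role. -/
structure Game (E F : Type*) where
  u₁ : PairSpace E F → ℝ
  u₂ : PairSpace E F → ℝ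
  grad₁ : PairSpace E F → PairSpace E F
  grad₂ : PairSpace E F → PairSpace E F

section Games

variable {E F : Type*} [NormedAddCommGroup E] [InnerProductSpace ℝ E]
  [NormedAddCommGroup F] [InnerProductSpace ℝ F]

/-- The pair `(x, y)`. -/
abbrev pair (x : E) (y : F) : PairSpace E F := WithLp.toLp 2 (x, y)

/-- The set `X × Y`. -/
def strategies (X : Set E) (Y : Set F) : Set (PairSpace E F) := {z | z.fst ∈ X ∧ z.snd ∈ Y}

/-- On `S`, the field `G` is the gradient of `f`, and it is `K`-Lipschitz continuous. -/
def IsSmoothOn (S : Set (PairSpace E F)) (f : PairSpace E F → ℝ)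
    (G : PairSpace E F → PairSpace E F) (K : ℝ) : Prop :=
  (∀ z ∈ S, HasFDerivWithinAt f (innerSL ℝ (G z)) S z) ∧
    ∀ z ∈ S, ∀ z' ∈ S, ‖G z' - G z‖ ≤ K * ‖z' - z‖

/-- `z` is an `ε`-approximate Nash equilibrium of the game on `X × Y`. -/
def IsApproxNash (X : Set E) (Y : Set F) (Γ : Game E F) (ε : ℝ) (z : PairSpace E F) : Prop :=
  z ∈ strategies X Y ∧
    (∀ x ∈ X, Γ.u₁ (pair x z.snd) - ε ≤ Γ.u₁ z) ∧
    (∀ y ∈ Y, Γ.u₂ (pair z.fst y) - ε ≤ Γ.u₂ z)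

namespace Game

/-- The coupling part `g = -(u₁ + u₂) / 2`. -/
def g (Γ : Game E F) (z : PairSpace E F) : ℝ := -(1 / 2) * (Γ.u₁ z + Γ.u₂ z)

/-- The zero-sum part `h = (-u₁ + u₂) / 2`. -/
def h (Γ : Game E F) (z : PairSpace E F) : ℝ := (1 / 2) * (-Γ.u₁ z + Γ.u₂ z)

/-- The gradient of `g`. -/
def gradg (Γ : Game E F) (z : PairSpace E F) : PairSpace E F :=
  (-(1 / 2) : ℝ) • (Γ.grad₁ z + Γ.grad₂ z)

/-- The gradient of `h`. -/
def gradh (Γ : Game E F) (z : PairSpace E F) : PairSpace E F :=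
  (1 / 2 : ℝ) • (-Γ.grad₁ z + Γ.grad₂ z)

/-- The gradient oracle: one query returns the gradients of both utilities at a point. -/
def oracle (Γ : Game E F) (z : PairSpace E F) : PairSpace E F × PairSpace E F :=
  (Γ.grad₁ z, Γ.grad₂ z)

end Game

/-- A deterministic method that queries the gradients of the two utilities and returns a point. -/
abbrev GradientMethod (E F : Type*) :=
  QueryMethod (PairSpace E F) (PairSpace E F × PairSpace E F) (PairSpace E F)

/-- Monotone `δ`-near-zero-sum games with moduli `μ`, `ν` and `L`-smooth utilities. -/
structure IsMonotoneNearZeroSum (X : Set E) (Y : Set F) (L δ μ ν : ℝ) (Γ : Game E F) : Prop where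
  smooth₁ : IsSmoothOn (strategies X Y) Γ.u₁ Γ.grad₁ L
  smooth₂ : IsSmoothOn (strategies X Y) Γ.u₂ Γ.grad₂ L
  convex_h : ∀ y ∈ Y, ConvexOn ℝ X fun x => Γ.h (pair x y) - μ / 2 * ‖x‖ ^ 2
  concave_h : ∀ x ∈ X, ConcaveOn ℝ Y fun y => Γ.h (pair x y) + ν / 2 * ‖y‖ ^ 2
  convex_g : ConvexOn ℝ (strategies X Y) Γ.g
  smooth_g : IsSmoothOn (strategies X Y) Γ.g Γ.gradg δ

/-! ### Regularization -/

/-- The gradient of `(x, y) ↦ -a ‖x - x₀‖² + b ‖y - y₀‖²`. -/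
def regGrad (a b : ℝ) (z₀ z : PairSpace E F) : PairSpace E F :=
  pair (-(2 * a) • (z.fst - z₀.fst)) ((2 * b) • (z.snd - z₀.snd))

/-- The regularized game with utilities `u₁ - a ‖x - x₀‖² + b ‖y - y₀‖²` and
`u₂ + a ‖x - x₀‖² - b ‖y - y₀‖²`. -/
def Game.regularize (Γ : Game E F) (a b : ℝ) (z₀ : PairSpace E F) : Game E F where
  u₁ z := Γ.u₁ z - a * ‖z.fst - z₀.fst‖ ^ 2 + b * ‖z.snd - z₀.snd‖ ^ 2
  u₂ z := Γ.u₂ z + a * ‖z.fst - z₀.fst‖ ^ 2 - b * ‖z.snd - z₀.snd‖ ^ 2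
  grad₁ z := Γ.grad₁ z + regGrad a b z₀ z
  grad₂ z := Γ.grad₂ z - regGrad a b z₀ z

/-! ### Iterative coupling linearization (ICL) -/

/-- The saddle function of the ICL subproblem at `w = z_t` with step size `η`:
`φ(x, y) = ⟪∇ₓ g(w), x⟫ + ‖x - w_x‖² / (2η) + h(x, y) - ⟪∇_y g(w), y⟫ - ‖y - w_y‖² / (2η)`. -/
def subproblem (Γ : Game E F) (η : ℝ) (w z : PairSpace E F) : ℝ :=
  ⟪(Γ.gradg w).fst, z.fst⟫ + 1 / (2 * η) * ‖z.fst - w.fst‖ ^ 2 + Γ.h z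
    - ⟪(Γ.gradg w).snd, z.snd⟫ - 1 / (2 * η) * ‖z.snd - w.snd‖ ^ 2

/-- The gradient `(∇ₓ φ, ∇_y φ)` of the saddle function `subproblem Γ η w`. -/
def subproblemGrad (Γ : Game E F) (η : ℝ) (w z : PairSpace E F) : PairSpace E F :=
  pair ((Γ.gradg w).fst + (1 / η) • (z.fst - w.fst) + (Γ.gradh z).fst)
    ((Γ.gradh z).snd - (Γ.gradg w).snd - (1 / η) • (z.snd - w.snd))

/-- `z'` solves `min_{x ∈ X} max_{y ∈ Y} φ(x, y)` with inexactness `e`. -/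
def IsInexactSolution (X : Set E) (Y : Set F) (Γ : Game E F) (η e : ℝ)
    (w z' : PairSpace E F) : Prop :=
  z' ∈ strategies X Y ∧ ∀ x ∈ X, ∀ y ∈ Y,
    ⟪(subproblemGrad Γ η w z').fst, z'.fst - x⟫
      - ⟪(subproblemGrad Γ η w z').snd, z'.snd - y⟫ ≤ e

/-- The first `T` iterations of ICL produce `z 0, …, z T`. -/
def IsICLRun (X : Set E) (Y : Set F) (Γ : Game E F) (η e : ℝ) (T : ℕ)
    (z : ℕ → PairSpace E F) : Prop :=
  ∀ t < T, IsInexactSolution X Y Γ η e (z t) (z (t + 1))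

/-- ICL as a gradient method, with the subproblems left to the method `solver`: in each iteration
one query at the current point `z` gives `∇g(z)`, and then `solver z (∇g(z))` finds the next
point, using further gradient queries. -/
def iclMethod (solver : PairSpace E F → PairSpace E F → GradientMethod E F) :
    ℕ → PairSpace E F → GradientMethod E F
  | 0, z => .output z
  | T + 1, z => .query z fun a =>
      (solver z ((-(1 / 2) : ℝ) • (a.1 + a.2))).bind fun z' => iclMethod solver T z'

/-- The Euclidean projection onto `X`: a point of `X` at minimal distance from `u` (it exists and
is unique if `X` is nonempty, compact and convex). -/
def proj {H : Type*} [NormedAddCommGroup H] (X : Set H) (u : H) : H :=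
  Classical.epsilon fun v => v ∈ X ∧ ∀ w ∈ X, ‖u - v‖ ≤ ‖u - w‖

theorem proj_spec {H : Type*} [NormedAddCommGroup H] {X : Set H} (hX : IsCompact X)
    (hne : X.Nonempty) (u : H) : proj X u ∈ X ∧ ∀ w ∈ X, ‖u - proj X u‖ ≤ ‖u - w‖ := by
  apply Classical.epsilon_spec (p := fun v => v ∈ X ∧ ∀ w ∈ X, ‖u - v‖ ≤ ‖u - w‖)
  obtain ⟨v, hv, h⟩ := hX.exists_isMinOn hne (f := fun v => ‖u - v‖) (by fun_prop)
  exact ⟨v, hv, fun w hw => h hw⟩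

/-- The extragradient step `(Π_X(x + γ v₁), Π_Y(y + γ v₂))` from `z = (x, y)`, where `v₁` and `v₂`
are the first component of `∇u₁(z)` and the second component of `∇u₂(z)`. -/
def extragradientStep (X : Set E) (Y : Set F) (γ : ℝ) (z d₁ d₂ : PairSpace E F) :
    PairSpace E F :=
  pair (proj X (z.fst + γ • d₁.fst)) (proj Y (z.snd + γ • d₂.snd))

end Games

/-! ### Parameters and rates -/

/-- Smoothness `L`, near-zero-sum parameter `δ`, moduli `μ` and `ν`, bounds `DX` and `DY` on the
diameters of the strategy sets, and the target accuracy `ε`. -/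
structure Params where
  L : ℝ
  δ : ℝ
  μ : ℝ
  ν : ℝ
  DX : ℝ
  DY : ℝ
  ε : ℝ

namespace Params

variable (P : Params)

/-- `D = √(D_X² + D_Y²)`. -/
def D : ℝ := √(P.DX ^ 2 + P.DY ^ 2)

/-- The weight of the regularization `‖x - x₀‖²`. -/
def a : ℝ := min (P.ε / (4 * P.DX ^ 2)) (P.L / 2)

/-- The weight of the regularization `‖y - y₀‖²`. -/
def b : ℝ := min (P.ε / (4 * P.DY ^ 2)) (P.L / 2)

def μbar : ℝ := P.μ + min (P.ε / (2 * P.DX ^ 2)) P.L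

def νbar : ℝ := P.ν + min (P.ε / (2 * P.DY ^ 2)) P.L

/-- The step size of ICL for the regularized game, `η = min {1/δ, 1/min {μbar, νbar}}`, where
`1/0` stands for `+∞`. -/
def η : ℝ := 1 / max P.δ (min P.μbar P.νbar)

def θ : ℝ := min P.μbar P.νbar / (P.η⁻¹ + min P.μbar P.νbar)

/-- The squared distance to the Nash equilibrium of the regularized game that ICL has to reach. -/
def accuracy : ℝ := P.ε ^ 2 / (128 * P.L ^ 2 * P.D ^ 2)

/-- The inexactness `θ ε' / (4 η)` of the subproblems, where `ε'` is the accuracy above. -/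
def innerAccuracy : ℝ := P.θ * P.accuracy / (4 * P.η)

/-- The bound `(1/θ) log (2 D² / ε')` that the number of iterations of ICL has to reach. -/
def iterationBound : ℝ := 1 / P.θ * Real.log (2 * P.D ^ 2 / P.accuracy)

/-- The step size of the final extragradient step; the regularized utilities are
`2 L`-smooth. -/
def γ : ℝ := 1 / (√2 * (2 * P.L))

/-- `max {1, log s}`: a logarithm as it is meant inside of `O(·)`. -/
def tlog (s : ℝ) : ℝ := max 1 (Real.log s)

/-- The bound on the number of gradient queries in terms of `μbar` and `νbar`. -/
def rate : ℝ :=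
  (P.L / √(P.μbar * P.νbar)
      + P.L / min P.μbar P.νbar * min 1 √(P.δ / (P.μbar + P.νbar)))
    * tlog (P.L ^ 2 * P.D ^ 2 / (min P.μbar P.νbar * P.ε)) * tlog (P.L * P.D ^ 2 / P.ε)

/-- The explicit rate for `μ > 0` and `ν = 0`. -/
def rateA : ℝ :=
  (P.L * P.DY / √(P.μ * P.ε) + P.L * P.DY ^ 2 / P.ε * min 1 √(P.δ / P.μ))
    * tlog (P.L * P.D ^ 2 / P.ε) ^ 2

/-- The explicit rate for `μ = 0` and `ν > 0`. -/
def rateB : ℝ :=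
  (P.L * P.DX / √(P.ν * P.ε) + P.L * P.DX ^ 2 / P.ε * min 1 √(P.δ / P.ν))
    * tlog (P.L * P.D ^ 2 / P.ε) ^ 2

/-- The explicit rate for `μ = 0` and `ν = 0`. -/
def rateC : ℝ :=
  (P.L * P.DX * P.DY / P.ε
      + P.L * P.D ^ 2 / P.ε * min 1 √(P.δ / (P.ε / P.DX ^ 2 + P.ε / P.DY ^ 2)))
    * tlog (P.L * P.D ^ 2 / P.ε) ^ 2

end Params

section Method

variable {E F : Type*} [NormedAddCommGroup E] [InnerProductSpace ℝ E]
  [NormedAddCommGroup F] [InnerProductSpace ℝ F]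

/-- The game `Γ`, regularized around `z₀` with the weights that the parameters prescribe. -/
def Game.reduced (Γ : Game E F) (P : Params) (z₀ : PairSpace E F) : Game E F :=
  Γ.regularize P.a P.b z₀

/-- The whole method: `T = ⌈(1/θ) log (2 D² / ε')⌉` iterations of ICL from `z₀` on the regularized
game (its coupling part, hence `∇g`, is that of the original game), then one more query and an
extragradient step on the regularized game. -/
def reducedMethod (P : Params) (X : Set E) (Y : Set F)
    (solver : PairSpace E F → PairSpace E F → GradientMethod E F) (z₀ : PairSpace E F) :
    GradientMethod E F :=
  (iclMethod solver ⌈P.iterationBound⌉₊ z₀).bind fun z =>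
    .query z fun d => .output (extragradientStep X Y P.γ z
      (d.1 + regGrad P.a P.b z₀ z) (d.2 - regGrad P.a P.b z₀ z))

end Method

end

noncomputable section

/-! ### Projections and variational inequalities -/

section Projection

variable {H : Type*} [NormedAddCommGroup H] [InnerProductSpace ℝ H] {S : Set H}

/-! The first-order conditions of both players form one variational inequality, for the operator ∇g
+ (∇ₓh, -∇_y h), which is `nashField`. The regularization is zero-sum, so it leaves g untouched; as
∇g is monotone, the moduli of h make the operator strongly monotone with modulus m = min {μbar,
νbar}.

ICL is a proximal point iteration in which ∇g is frozen at z_t. By convexity and δ-smoothness of g,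
freezing costs at most (δ/2)‖z_{t+1} - z_t‖², and the proximal term absorbs this because δ ≤ 1/η
(`icl_step`). Hence the squared distance to the regularized equilibrium contracts by 1 - θ up to the
inexactness (`icl_convergence`). One projected step then turns a small distance into a small gain
from any deviation, and dropping the regularization adds at most ε/4 (`inner_le_of_projected_step`).

For the query count, a subproblem is a saddle problem with moduli m, n and Lipschitz constant K that
must be solved with K/√(m n) queries up to a logarithm (`hasSaddleSolver`). Scaling, and exchanging
the players if needed, gives moduli 1 and σ ≤ 1 and Lipschitz constant κ. Then f(z, y) = sup_x (‖x +
z‖²/2 - Φ(x, y)), which is `dualFun`, is a supremum of functions that are jointly σ-strongly convex,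
and its minimizer is (-x*, y*) for the saddle point (x*, y*). The accelerated proximal point method
on f needs O(1/√σ) steps up to a logarithm, and tolerates a constant relative error in each
(`IsRelativeProx.accelerated_step`). Eliminating z from a proximal step leaves a saddle problem with
moduli at least 1/2, so O(κ) forward-backward-forward steps reach that error
(`IsSaddleField.isRelativeProx`). The product κ/√σ is K/√(m n).

It remains to multiply by the number of iterations, of order 1/θ. If δ ≤ m this factor is 2;
otherwise it is at most 2δ/m, and the larger moduli of the subproblems pay for δ (`inv_θ_mul_le`).
-/

theorem inner_sub_proj_nonpos (hS : IsCompact S) (hc : Convex ℝ S) (hne : S.Nonempty) (u : H)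
    {s : H} (hs : s ∈ S) : ⟪u - proj S u, s - proj S u⟫ ≤ 0 := by
  obtain ⟨h1, h2⟩ := proj_spec hS hne u
  have : Nonempty S := hne.to_subtype
  have h3 : ‖u - proj S u‖ = ⨅ w : S, ‖u - w‖ := by
    apply le_antisymm
    · exact le_ciInf fun w => h2 w w.2
    · exact ciInf_le ⟨0, by rintro _ ⟨w, rfl⟩; exact norm_nonneg _⟩ (⟨proj S u, h1⟩ : S)
  exact (norm_eq_iInf_iff_real_inner_le_zero hc h1).1 h3 s hs

theorem norm_proj_sub_proj_sq_le (hS : IsCompact S) (hc : Convex ℝ S) (hne : S.Nonempty)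
    (u v : H) : ‖proj S u - proj S v‖ ^ 2 ≤ ⟪u - v, proj S u - proj S v⟫ := by
  have h1 := inner_sub_proj_nonpos hS hc hne u (proj_spec hS hne v).1
  have h2 := inner_sub_proj_nonpos hS hc hne v (proj_spec hS hne u).1
  rw [← real_inner_self_eq_norm_sq]
  have e : ⟪u - v, proj S u - proj S v⟫ = ⟪proj S u - proj S v, proj S u - proj S v⟫
      - ⟪u - proj S u, proj S v - proj S u⟫ - ⟪v - proj S v, proj S u - proj S v⟫ := by
    rw [show proj S v - proj S u = -(proj S u - proj S v) by abel, inner_neg_right,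
      sub_neg_eq_add, ← inner_add_left, ← inner_sub_left]
    congr 1
    abel
  linarith

theorem norm_proj_sub_proj_le (hS : IsCompact S) (hc : Convex ℝ S) (hne : S.Nonempty)
    (u v : H) : ‖proj S u - proj S v‖ ≤ ‖u - v‖ := by
  have h1 := norm_proj_sub_proj_sq_le hS hc hne u v
  have h2 := real_inner_le_norm (u - v) (proj S u - proj S v)
  by_contra! h3
  nlinarith [norm_nonneg (u - v), norm_nonneg (proj S u - proj S v)]

omit [InnerProductSpace ℝ H] in
theorem proj_eq_self (hS : IsCompact S) {v : H} (hv : v ∈ S) : proj S v = v := by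
  have h := (proj_spec hS ⟨v, hv⟩ v).2 v hv
  rw [sub_self, norm_zero] at h
  exact (sub_eq_zero.1 (norm_le_zero_iff.1 h)).symm

theorem norm_proj_sub_le (hS : IsCompact S) (hc : Convex ℝ S) (u : H) {s : H} (hs : s ∈ S) :
    ‖proj S u - s‖ ≤ ‖u - s‖ := by
  have h := norm_proj_sub_proj_le hS hc ⟨s, hs⟩ u s
  rwa [proj_eq_self hS hs] at h

/-- A strongly monotone Lipschitz variational inequality on a compact convex set is solvable. -/
theorem exists_variational_solution (hS : IsCompact S) (hc : Convex ℝ S) (hne : S.Nonempty)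
    {A : H → H} {m K : ℝ} (hm : 0 < m) (hK : 0 < K)
    (hmono : ∀ u ∈ S, ∀ v ∈ S, m * ‖u - v‖ ^ 2 ≤ ⟪A u - A v, u - v⟫)
    (hlip : ∀ u ∈ S, ∀ v ∈ S, ‖A u - A v‖ ≤ K * ‖u - v‖) :
    ∃ w ∈ S, ∀ s ∈ S, 0 ≤ ⟪A w, s - w⟫ := by
  -- This τ minimizes the squared contraction factor 1 - 2τm + τ²K².
  set τ : ℝ := m / K ^ 2 with hτ
  have hτ0 : 0 < τ := by positivity
  set T : H → H := fun z => proj S (z - τ • A z) with hT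
  have hTS : ∀ z, T z ∈ S := fun z => (proj_spec hS hne _).1
  have hcontr : ∀ u ∈ S, ∀ v ∈ S, ‖T u - T v‖ ^ 2 ≤ (1 - m ^ 2 / K ^ 2) * ‖u - v‖ ^ 2 := by
    intro u hu v hv
    have h1 := norm_proj_sub_proj_le hS hc hne (u - τ • A u) (v - τ • A v)
    have h2 : ‖(u - τ • A u) - (v - τ • A v)‖ ^ 2
        = ‖u - v‖ ^ 2 - 2 * τ * ⟪A u - A v, u - v⟫ + τ ^ 2 * ‖A u - A v‖ ^ 2 := by
      rw [show (u - τ • A u) - (v - τ • A v) = (u - v) - τ • (A u - A v) by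
        rw [smul_sub]; abel, norm_sub_sq_real, real_inner_smul_right, norm_smul, mul_pow,
        real_inner_comm, Real.norm_eq_abs, sq_abs]
      ring
    have h3 := hmono u hu v hv
    have h4 : ‖A u - A v‖ ^ 2 ≤ K ^ 2 * ‖u - v‖ ^ 2 := by
      rw [← mul_pow]
      exact pow_le_pow_left₀ (norm_nonneg _) (hlip u hu v hv) 2
    have h5 : τ ^ 2 * (K ^ 2 * ‖u - v‖ ^ 2) = m ^ 2 / K ^ 2 * ‖u - v‖ ^ 2 := by
      rw [hτ]; field_simp
    have h6 : 2 * τ * (m * ‖u - v‖ ^ 2) = 2 * (m ^ 2 / K ^ 2 * ‖u - v‖ ^ 2) := by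
      rw [hτ]; field_simp
    calc ‖T u - T v‖ ^ 2 ≤ ‖(u - τ • A u) - (v - τ • A v)‖ ^ 2 :=
          pow_le_pow_left₀ (norm_nonneg _) h1 2
      _ ≤ _ := by
          have h7 := mul_le_mul_of_nonneg_left h3 (by positivity : 0 ≤ 2 * τ)
          have h8 := mul_le_mul_of_nonneg_left h4 (by positivity : 0 ≤ τ ^ 2)
          linarith
  have hle : ∀ u ∈ S, ∀ v ∈ S, ‖T u - T v‖ ≤ ‖u - v‖ := by
    intro u hu v hv
    have h1 := hcontr u hu v hv
    have h2 : 0 ≤ m ^ 2 / K ^ 2 * ‖u - v‖ ^ 2 := by positivity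
    exact (sq_le_sq₀ (norm_nonneg _) (norm_nonneg _)).1 (by linarith)
  have hcont : ContinuousOn (fun z => ‖z - T z‖) S := by
    have : ContinuousOn T S := by
      have : LipschitzOnWith 1 T S := LipschitzOnWith.of_dist_le_mul fun u hu v hv => by
        simpa [dist_eq_norm] using hle u hu v hv
      exact this.continuousOn
    fun_prop
  -- The fixed point is a minimizer of the displacement ‖z - T z‖: applying T there would shrink a
  -- nonzero displacement strictly.
  obtain ⟨w, hw, hmin⟩ := hS.exists_isMinOn hne hcont
  refine ⟨w, hw, fun s hs => ?_⟩
  have hfix : T w = w := by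
    have h1 : ‖w - T w‖ ≤ ‖T w - T (T w)‖ := hmin (hTS w)
    have h2 := hcontr w hw _ (hTS w)
    have h3 : ‖w - T w‖ ^ 2 ≤ ‖T w - T (T w)‖ ^ 2 := pow_le_pow_left₀ (norm_nonneg _) h1 2
    have h4 : m ^ 2 / K ^ 2 * ‖w - T w‖ ^ 2 ≤ 0 := by linarith
    have h5 : 0 < m ^ 2 / K ^ 2 := by positivity
    have h6 : ‖w - T w‖ ^ 2 ≤ 0 := by
      by_contra! h
      have := mul_pos h5 h
      linarith
    have h7 : ‖w - T w‖ = 0 := by nlinarith [norm_nonneg (w - T w)]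
    exact (sub_eq_zero.1 (norm_eq_zero.1 h7)).symm
  have h := inner_sub_proj_nonpos hS hc hne (w - τ • A w) hs
  have e : proj S (w - τ • A w) = w := hfix
  rw [e, show w - τ • A w - w = -(τ • A w) by abel, inner_neg_left, real_inner_smul_left] at h
  by_contra! hneg
  nlinarith

/-- One projection step moves by at most `√2` times the distance to the solution. -/
theorem norm_sub_sq_le_of_projection_step {A : H → H} {τ : ℝ} (hτ : 0 ≤ τ) {z w z' : H}
    (hz' : z' ∈ S) (hwS : w ∈ S) (hw : ∀ s ∈ S, 0 ≤ ⟪A w, s - w⟫)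
    (hmono : 0 ≤ ⟪A z - A w, z - w⟫) (hlip : τ * ‖A z - A w‖ ≤ ‖z - w‖)
    (hstep : ∀ s ∈ S, ⟪z - τ • A z - z', s - z'⟫ ≤ 0) :
    ‖z' - z‖ ^ 2 ≤ 2 * ‖z - w‖ ^ 2 := by
  have h1 := hstep w hwS
  have h2 := hw z' hz'
  set a := z' - z with ha
  set d := z - w with hd
  set V := τ • (A z - A w) with hV
  have e1 : ⟪z - τ • A z - z', w - z'⟫ = ⟪a + V, a + d⟫ + τ * ⟪A w, z' - w⟫ := by
    rw [← real_inner_smul_left, show z' - w = a + d by rw [ha, hd]; abel, ← inner_add_left,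
      show w - z' = -(a + d) by rw [ha, hd]; abel, inner_neg_right, ← inner_neg_left]
    congr 1
    rw [ha, hV, smul_sub]
    abel
  have h3 : ⟪a + V, a + d⟫ ≤ 0 := by
    have := mul_nonneg hτ h2
    linarith
  have h4 : 0 ≤ ⟪V, d⟫ := by
    rw [hV, real_inner_smul_left]; exact mul_nonneg hτ hmono
  have h5 : ‖V‖ ≤ ‖d‖ := by
    rw [hV, norm_smul, Real.norm_eq_abs, abs_of_nonneg hτ]; exact hlip
  have h6 : 0 ≤ ‖a + V + d‖ ^ 2 := by positivity
  -- Together with `h3` this identity gives ‖a‖² ≤ ‖V‖² + ‖d‖², hence the factor 2.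
  have h7 : ‖a + V + d‖ ^ 2 = 2 * ⟪a + V, a + d⟫ - ‖a‖ ^ 2 + ‖V‖ ^ 2 + ‖d‖ ^ 2 := by
    simp only [← real_inner_self_eq_norm_sq, inner_add_left, inner_add_right,
      real_inner_comm a V, real_inner_comm a d, real_inner_comm V d]
    ring
  nlinarith [norm_nonneg V, norm_nonneg d]

/-! ### Forward-backward-forward steps -/

/-- One forward-backward-forward step from `u`: the point of `S` at which it is centered. -/
def fbfPoint (S : Set H) (τ : ℝ) (B : H → H) (u : H) : H := proj S (u - τ • B (proj S u))

/-- One forward-backward-forward step from `u`. -/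
def fbfNext (S : Set H) (τ : ℝ) (B : H → H) (u : H) : H :=
  fbfPoint S τ B u - τ • (B (fbfPoint S τ B u) - B (proj S u))

variable {τ : ℝ} {B : H → H}

theorem fbfPoint_mem (hS : IsCompact S) (hne : S.Nonempty) (u : H) : fbfPoint S τ B u ∈ S :=
  (proj_spec hS hne _).1

/-- The vector u - `fbfNext` is τ times the value of B at `fbfPoint` plus a normal vector of S
there; the normal vector has the right sign. The iterate u may leave S, so B is evaluated at its
projection. -/
theorem inner_le_inner_fbf (hS : IsCompact S) (hc : Convex ℝ S) (hne : S.Nonempty)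
    (u : H) {s : H} (hs : s ∈ S) :
    τ * ⟪B (fbfPoint S τ B u), fbfPoint S τ B u - s⟫
      ≤ ⟪u - fbfNext S τ B u, fbfPoint S τ B u - s⟫ := by
  have h := inner_sub_proj_nonpos hS hc hne (u - τ • B (proj S u)) hs
  change ⟪u - τ • B (proj S u) - fbfPoint S τ B u, s - fbfPoint S τ B u⟫ ≤ 0 at h
  rw [fbfNext]
  set w := fbfPoint S τ B u
  have e : ⟪u - (w - τ • (B w - B (proj S u))), w - s⟫
      = τ * ⟪B w, w - s⟫ - ⟪u - τ • B (proj S u) - w, s - w⟫ := by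
    rw [← real_inner_smul_left, show s - w = -(w - s) by abel, inner_neg_right, sub_neg_eq_add,
      ← inner_add_left]
    congr 1
    rw [smul_sub]
    abel
  linarith

/-- The correction is τ(B w - B(proj u)) with w in S, and projecting u brings it no farther from w.
This inequality pays for the error term in the regret bound `two_inner_fbf_le`. -/
theorem norm_fbfNext_sub_le (hS : IsCompact S) (hc : Convex ℝ S) (hne : S.Nonempty) {K : ℝ}
    (hτ : 0 ≤ τ) (hK : τ * K ≤ 1)
    (hlip : ∀ u ∈ S, ∀ v ∈ S, ‖B u - B v‖ ≤ K * ‖u - v‖) (u : H) :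
    ‖fbfNext S τ B u - fbfPoint S τ B u‖ ≤ ‖u - fbfPoint S τ B u‖ := by
  have hw : fbfPoint S τ B u ∈ S := fbfPoint_mem hS hne u
  rw [fbfNext]
  set w := fbfPoint S τ B u
  rw [show w - τ • (B w - B (proj S u)) - w = -(τ • (B w - B (proj S u))) by abel, norm_neg,
    norm_smul, Real.norm_eq_abs, abs_of_nonneg hτ]
  have h1 := hlip w hw _ (proj_spec hS hne u).1
  have h2 := norm_proj_sub_le hS hc u hw
  rw [norm_sub_rev] at h2
  calc τ * ‖B w - B (proj S u)‖ ≤ τ * (K * ‖w - proj S u‖) := by gcongr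
    _ = τ * K * ‖w - proj S u‖ := by ring
    _ ≤ 1 * ‖w - proj S u‖ := by gcongr
    _ ≤ ‖u - w‖ := by rwa [one_mul]

theorem two_inner_fbf_le (hS : IsCompact S) (hc : Convex ℝ S) (hne : S.Nonempty) {K : ℝ}
    (hτ : 0 ≤ τ) (hK : τ * K ≤ 1)
    (hlip : ∀ u ∈ S, ∀ v ∈ S, ‖B u - B v‖ ≤ K * ‖u - v‖) (u s : H) :
    2 * ⟪u - fbfNext S τ B u, fbfPoint S τ B u - s⟫
      ≤ ‖u - s‖ ^ 2 - ‖fbfNext S τ B u - s‖ ^ 2 := by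
  have h := norm_fbfNext_sub_le hS hc hne hτ hK hlip u
  set w := fbfPoint S τ B u
  set u' := fbfNext S τ B u
  have h2 := pow_le_pow_left₀ (norm_nonneg _) h 2
  have e : 2 * ⟪u - u', w - s⟫
      = ‖u - s‖ ^ 2 - ‖u' - s‖ ^ 2 + (‖u' - w‖ ^ 2 - ‖u - w‖ ^ 2) := by
    simp only [← real_inner_self_eq_norm_sq, inner_sub_left, inner_sub_right,
      real_inner_comm u w, real_inner_comm u s, real_inner_comm u' w, real_inner_comm u' s]
    ring
  linarith

end Projection

/-! ### Averages of forward-backward-forward iterations -/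

section Averages

variable {H : Type*} [NormedAddCommGroup H] [InnerProductSpace ℝ H] {S : Set H}
  {τ : ℝ} {B : H → H}

/-- The points of `S` that the forward-backward-forward iteration from `u` visits. -/
def fbfSeq (S : Set H) (τ : ℝ) (B : H → H) (u : H) (i : ℕ) : H :=
  fbfPoint S τ B ((fbfNext S τ B)^[i] u)

/-- The average of the points that the iteration visits in its first `N` steps. -/
def fbfAverage (S : Set H) (τ : ℝ) (B : H → H) (u : H) (N : ℕ) : H :=
  (N : ℝ)⁻¹ • ∑ i ∈ Finset.range N, fbfSeq S τ B u i

/-- The average residual over the first `N` steps. -/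
def fbfResidual (S : Set H) (τ : ℝ) (B : H → H) (u : H) (N : ℕ) : H :=
  (τ * N)⁻¹ • (u - (fbfNext S τ B)^[N] u)

theorem fbfSeq_mem (hS : IsCompact S) (hne : S.Nonempty) (u : H) (i : ℕ) :
    fbfSeq S τ B u i ∈ S := fbfPoint_mem hS hne _

theorem fbfAverage_mem (hS : IsCompact S) (hc : Convex ℝ S) (hne : S.Nonempty) (u : H) {N : ℕ}
    (hN : 0 < N) : fbfAverage S τ B u N ∈ S := by
  rw [fbfAverage, Finset.smul_sum]
  refine hc.sum_mem (fun i _ => by positivity) ?_ fun i _ => fbfSeq_mem hS hne u i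
  have : (N : ℝ) ≠ 0 := by positivity
  simp [this]

theorem sum_fbfSeq_sub_average (u : H) {N : ℕ} (hN : 0 < N) :
    ∑ i ∈ Finset.range N, (fbfSeq S τ B u i - fbfAverage S τ B u N) = 0 := by
  have : (N : ℝ) ≠ 0 := by positivity
  rw [Finset.sum_sub_distrib, Finset.sum_const, Finset.card_range, fbfAverage,
    ← Nat.cast_smul_eq_nsmul ℝ, smul_smul, mul_inv_cancel₀ this, one_smul, sub_self]

theorem sum_fbf_regret (hS : IsCompact S) (hc : Convex ℝ S) (hne : S.Nonempty) {K : ℝ}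
    (hτ : 0 ≤ τ) (hK : τ * K ≤ 1)
    (hlip : ∀ u ∈ S, ∀ v ∈ S, ‖B u - B v‖ ≤ K * ‖u - v‖) (u s : H) (N : ℕ) :
    2 * ∑ i ∈ Finset.range N,
        ⟪(fbfNext S τ B)^[i] u - (fbfNext S τ B)^[i + 1] u, fbfSeq S τ B u i - s⟫
      ≤ ‖u - s‖ ^ 2 - ‖(fbfNext S τ B)^[N] u - s‖ ^ 2 := by
  rw [Finset.mul_sum]
  calc _ ≤ ∑ i ∈ Finset.range N, (‖(fbfNext S τ B)^[i] u - s‖ ^ 2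
        - ‖(fbfNext S τ B)^[i + 1] u - s‖ ^ 2) := by
        refine Finset.sum_le_sum fun i _ => ?_
        rw [Function.iterate_succ_apply' _ i u]
        exact two_inner_fbf_le hS hc hne hτ hK hlip _ s
    _ = _ := by
        rw [Finset.sum_range_sub' (fun i => ‖(fbfNext S τ B)^[i] u - s‖ ^ 2)]
        rfl

/-- The increments telescope to τN times the average residual. Thus the linear part of the regret is
captured exactly by one vector, whatever the comparison point s is. -/
theorem sum_fbf_residual (u s : H) {N : ℕ} (hN : 0 < N) (hτ : 0 < τ) :
    ∑ i ∈ Finset.range N,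
        ⟪(fbfNext S τ B)^[i] u - (fbfNext S τ B)^[i + 1] u - τ • fbfResidual S τ B u N, s⟫ = 0 := by
  have : (N : ℝ) ≠ 0 := by positivity
  rw [← sum_inner, Finset.sum_sub_distrib,
    Finset.sum_range_sub' (fun i => (fbfNext S τ B)^[i] u), Finset.sum_const, Finset.card_range,
    fbfResidual, ← Nat.cast_smul_eq_nsmul ℝ, smul_smul, smul_smul,
    show (N : ℝ) * τ * (τ * N)⁻¹ = 1 by field_simp, one_smul]
  simp

section Solution

variable (hS : IsCompact S) (hc : Convex ℝ S) (hne : S.Nonempty) {K : ℝ} (hτ : 0 < τ)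
  (hK : τ * K ≤ 1) (hlip : ∀ u ∈ S, ∀ v ∈ S, ‖B u - B v‖ ≤ K * ‖u - v‖)
  (hmono : ∀ u ∈ S, ∀ v ∈ S, 1 / 2 * ‖u - v‖ ^ 2 ≤ ⟪B u - B v, u - v⟫)
  {w : H} (hwS : w ∈ S) (hw : ∀ s ∈ S, 0 ≤ ⟪B w, s - w⟫)
include hS hc hne hτ hK hlip hmono hwS hw

/-- Regret against the solution itself: strong monotonicity bounds each summand from below by a
squared distance. Both the residual and the average are controlled by this sum. -/
theorem sum_norm_fbfSeq_sub_sq_le (u : H) (N : ℕ) :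
    τ * ∑ i ∈ Finset.range N, ‖fbfSeq S τ B u i - w‖ ^ 2
      ≤ ‖u - w‖ ^ 2 - ‖(fbfNext S τ B)^[N] u - w‖ ^ 2 := by
  refine le_trans ?_ (sum_fbf_regret hS hc hne hτ.le hK hlip u w N)
  rw [Finset.mul_sum, Finset.mul_sum]
  refine Finset.sum_le_sum fun i _ => ?_
  have hi : fbfSeq S τ B u i ∈ S := fbfSeq_mem hS hne u i
  have h1 := inner_le_inner_fbf (τ := τ) (B := B) hS hc hne ((fbfNext S τ B)^[i] u) hwS
  have h2 := hmono _ hi w hwS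
  have h3 := hw _ hi
  rw [inner_sub_left] at h2
  rw [Function.iterate_succ_apply' _ i u]
  change τ * ⟪B (fbfSeq S τ B u i), fbfSeq S τ B u i - w⟫
    ≤ ⟪_ - _, fbfSeq S τ B u i - w⟫ at h1
  have h4 : 1 / 2 * ‖fbfSeq S τ B u i - w‖ ^ 2
      ≤ ⟪B (fbfSeq S τ B u i), fbfSeq S τ B u i - w⟫ := by linarith
  have h5 := mul_le_mul_of_nonneg_left h4 hτ.le
  linarith

theorem norm_fbfResidual_le (u : H) {N : ℕ} (hN : 0 < N) :
    τ * N * ‖fbfResidual S τ B u N‖ ≤ 2 * ‖u - w‖ := by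
  have hN' : (0 : ℝ) < N := by positivity
  have h1 := sum_norm_fbfSeq_sub_sq_le hS hc hne hτ hK hlip hmono hwS hw u N
  have h2 : 0 ≤ τ * ∑ i ∈ Finset.range N, ‖fbfSeq S τ B u i - w‖ ^ 2 := by positivity
  have h3 : ‖(fbfNext S τ B)^[N] u - w‖ ≤ ‖u - w‖ :=
    (sq_le_sq₀ (norm_nonneg _) (norm_nonneg _)).1 (by linarith)
  rw [fbfResidual, norm_smul, Real.norm_eq_abs, abs_of_pos (by positivity), ← mul_assoc,
    mul_inv_cancel₀ (by positivity), one_mul]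
  calc ‖u - (fbfNext S τ B)^[N] u‖ = ‖(u - w) - ((fbfNext S τ B)^[N] u - w)‖ := by congr 1; abel
    _ ≤ ‖u - w‖ + ‖(fbfNext S τ B)^[N] u - w‖ := norm_sub_le _ _
    _ ≤ _ := by linarith

theorem norm_fbfAverage_sub_sq_le (u : H) {N : ℕ} (hN : 0 < N) :
    τ * N * ‖fbfAverage S τ B u N - w‖ ^ 2 ≤ ‖u - w‖ ^ 2 := by
  have h1 := sum_norm_fbfSeq_sub_sq_le hS hc hne hτ hK hlip hmono hwS hw u N
  have h2 : (N : ℝ) * ‖fbfAverage S τ B u N - w‖ ^ 2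
      ≤ ∑ i ∈ Finset.range N, ‖fbfSeq S τ B u i - w‖ ^ 2 := by
    -- Jensen's inequality for the squared norm: the cross terms vanish in the sum because
    -- deviations from the average add up to zero.
    have h3 : ∑ i ∈ Finset.range N, (‖fbfAverage S τ B u N - w‖ ^ 2
        + 2 * ⟪fbfSeq S τ B u i - fbfAverage S τ B u N, fbfAverage S τ B u N - w⟫)
        ≤ ∑ i ∈ Finset.range N, ‖fbfSeq S τ B u i - w‖ ^ 2 := by
      refine Finset.sum_le_sum fun i _ => ?_
      rw [show fbfSeq S τ B u i - w = (fbfSeq S τ B u i - fbfAverage S τ B u N)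
        + (fbfAverage S τ B u N - w) by abel, norm_add_sq_real]
      have := sq_nonneg ‖fbfSeq S τ B u i - fbfAverage S τ B u N‖
      linarith
    rw [Finset.sum_add_distrib, Finset.sum_const, Finset.card_range, nsmul_eq_mul,
      ← Finset.mul_sum, ← sum_inner, sum_fbfSeq_sub_average u hN, inner_zero_left, mul_zero,
      add_zero] at h3
    exact h3
  have h4 := mul_le_mul_of_nonneg_left h2 hτ.le
  have h5 := sq_nonneg ‖(fbfNext S τ B)^[N] u - w‖
  linarith

end Solution

end Averages

/-! ### The accelerated proximal point method with relative errors -/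

section Accelerated

variable {H : Type*} [NormedAddCommGroup H] [InnerProductSpace ℝ H]

/-- `q` is a proximal point of `f` at `c` up to a relative error, and `v` is an approximate
subgradient there. -/
def IsRelativeProx (Q : Set H) (f : H → ℝ) (σ : ℝ) (c q v : H) : Prop :=
  q ∈ Q ∧ ∃ e : ℝ, (∀ u ∈ Q, f q + ⟪v, u - q⟫ + σ / 2 * ‖u - q‖ ^ 2 - e ≤ f u) ∧
    ‖v + (q - c)‖ ^ 2 + 2 * e ≤ 1 / 4 * ‖q - c‖ ^ 2

variable {Q : Set H} {f : H → ℝ} {σ : ℝ}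

/-- A single inexact proximal step from c starts the potential: the subgradient inequality at p,
with v close to c - q, leaves only half the squared distance from c to p, and the term with σ ≤ 1 is
at most the other half. -/
theorem IsRelativeProx.initial (hσ1 : σ ≤ 1) {c q v p : H} (hσ0 : 0 ≤ σ)
    (h : IsRelativeProx Q f σ c q v) (hp : p ∈ Q) :
    f q - f p + σ / 2 * ‖c - p‖ ^ 2 ≤ ‖c - p‖ ^ 2 := by
  obtain ⟨-, e, h1, h2⟩ := h
  have h3 := h1 p hp
  have h4 : 0 ≤ σ / 2 * ‖p - q‖ ^ 2 := by positivity
  have e1 : ⟪v, p - q⟫ = ⟪v + (q - c), p - q⟫ + 1 / 2 * (‖q - c‖ ^ 2 + ‖p - q‖ ^ 2 - ‖c - p‖ ^ 2) := by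
    rw [show c - p = -((q - c) + (p - q)) by abel, norm_neg, norm_add_sq_real, inner_add_left]
    ring
  have h5 := norm_add_sq_real (v + (q - c)) (p - q)
  have h6 := sq_nonneg ‖v + (q - c) + (p - q)‖
  have h7 := sq_nonneg ‖q - c‖
  have h8 : σ / 2 * ‖c - p‖ ^ 2 ≤ 1 / 2 * ‖c - p‖ ^ 2 := by gcongr
  linarith

/-- One step of the accelerated method contracts the Lyapunov function f(p) - f(x) + (σ/2)‖q - x‖²
by 1 - α. The subgradient inequality is used at p with weight 1 - α and at x with weight α. Taking α
= √σ/2 instead of √σ leaves the slack that absorbs the relative error. -/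
theorem IsRelativeProx.accelerated_step {α : ℝ} (hα : 0 < α) (hα' : α ^ 2 = σ / 4) (hσ : σ ≤ 1)
    {p q p' v x : H} (hp : p ∈ Q) (hx : x ∈ Q)
    (h : IsRelativeProx Q f σ ((1 + α)⁻¹ • (p + α • q)) p' v) :
    f p' - f x + σ / 2 * ‖(1 - α) • q + α • p' - (α / σ) • v - x‖ ^ 2
      ≤ (1 - α) * (f p - f x + σ / 2 * ‖q - x‖ ^ 2) := by
  obtain ⟨-, e, h1, h2⟩ := h
  have hσ0 : 0 < σ := by nlinarith
  have hα1 : α ≤ 1 / 2 := by nlinarith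
  set c := (1 + α)⁻¹ • (p + α • q) with hc
  have hc' : (1 + α) • c = p + α • q := by
    rw [hc, smul_smul, mul_inv_cancel₀ (by positivity), one_smul]
  have hp1 := mul_le_mul_of_nonneg_left (h1 p hp) (by linarith : 0 ≤ 1 - α)
  have hx1 := mul_le_mul_of_nonneg_left (h1 x hx) hα.le
  have hpp : 0 ≤ (1 - α) * (σ / 2 * ‖p - p'‖ ^ 2) :=
    mul_nonneg (by linarith) (by positivity)
  -- expansion of the distance to `x`
  set b := (1 - α) • (q - x) + α • (p' - x) with hb
  have e1 : (1 - α) • q + α • p' - (α / σ) • v - x = b - (α / σ) • v := by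
    rw [hb]; module
  have e2 : σ / 2 * ‖b - (α / σ) • v‖ ^ 2
      = σ / 2 * ‖b‖ ^ 2 - α * ⟪v, b⟫ + 1 / 8 * ‖v‖ ^ 2 := by
    rw [norm_sub_sq_real, real_inner_smul_right, norm_smul, mul_pow, Real.norm_eq_abs, sq_abs,
      real_inner_comm v b, div_pow, hα']
    field_simp
    ring
  have e3 : ‖b‖ ^ 2 ≤ (1 - α) * ‖q - x‖ ^ 2 + α * ‖p' - x‖ ^ 2 := by
    have : (1 - α) * ‖q - x‖ ^ 2 + α * ‖p' - x‖ ^ 2 - ‖b‖ ^ 2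
        = (1 - α) * α * ‖(q - x) - (p' - x)‖ ^ 2 := by
      rw [hb, norm_add_sq_real, norm_sub_sq_real (q - x) (p' - x), norm_smul, norm_smul, mul_pow, mul_pow,
        Real.norm_eq_abs, Real.norm_eq_abs, sq_abs, sq_abs, real_inner_smul_left,
        real_inner_smul_right]
      ring
    have h4 : 0 ≤ (1 - α) * α * ‖(q - x) - (p' - x)‖ ^ 2 :=
      mul_nonneg (mul_nonneg (by linarith) hα.le) (by positivity)
    linarith
  -- The center c is chosen so that all linear terms collapse into a multiple of p' - c.
  have e4 : (1 - α) * ⟪v, p - p'⟫ + α * ⟪v, x - p'⟫ + α * ⟪v, b⟫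
      = -((1 - α ^ 2) * ⟪v, p' - c⟫) := by
    have h5 : (1 - α ^ 2) • (p' - c) = (1 - α ^ 2) • p' - (1 - α) • (p + α • q) := by
      rw [← hc']; module
    rw [← real_inner_smul_right, ← real_inner_smul_right, ← real_inner_smul_right,
      ← real_inner_smul_right, h5, ← inner_add_right, ← inner_add_right, ← inner_neg_right]
    congr 1
    rw [hb]
    module
  have e5 := norm_add_sq_real v (p' - c)
  rw [norm_sub_rev x p'] at hx1
  have e6 := mul_le_mul_of_nonneg_left e3 (by positivity : 0 ≤ σ / 2)
  have hv := sq_nonneg ‖v‖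
  have hd := sq_nonneg ‖p' - c‖
  have hr := sq_nonneg ‖v + (p' - c)‖
  -- The coefficient 1/8 is α²/(2σ). The error condition gives ⟪v, p' - c⟫ ≤ -e - ‖v‖²/2 - (3/8)‖p'
  -- - c‖², and α² ≤ 1/4 leaves enough of the last two terms to cover 1/8 ‖v‖² and the remaining α²
  -- e.
  have e7 : (1 - α ^ 2) * ⟪v, p' - c⟫ + 1 / 8 * ‖v‖ ^ 2 + e ≤ 0 := by
    have hα2 : 0 ≤ 1 - α ^ 2 := by nlinarith
    have i1 : ⟪v, p' - c⟫ ≤ 1 / 2 * (1 / 4 * ‖p' - c‖ ^ 2 - 2 * e - ‖v‖ ^ 2 - ‖p' - c‖ ^ 2) := by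
      linarith
    have i2 := mul_le_mul_of_nonneg_left i1 hα2
    have i3 : α ^ 2 * e ≤ α ^ 2 * (1 / 8 * ‖p' - c‖ ^ 2) := by
      gcongr
      linarith
    nlinarith
  rw [e1, e2]
  linarith

end Accelerated

/-! ### Saddle fields -/

section Pairs

variable {E F : Type*} [NormedAddCommGroup E] [InnerProductSpace ℝ E]
  [NormedAddCommGroup F] [InnerProductSpace ℝ F]

theorem pair_inner (z z' : PairSpace E F) : ⟪z, z'⟫ = ⟪z.fst, z'.fst⟫ + ⟪z.snd, z'.snd⟫ :=
  WithLp.prod_inner_apply z z'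

omit [InnerProductSpace ℝ E] [InnerProductSpace ℝ F] in
theorem pair_norm_sq (z : PairSpace E F) : ‖z‖ ^ 2 = ‖z.fst‖ ^ 2 + ‖z.snd‖ ^ 2 :=
  WithLp.prod_norm_sq_eq_of_L2 z

omit [NormedAddCommGroup E] [InnerProductSpace ℝ E] [NormedAddCommGroup F]
  [InnerProductSpace ℝ F] in
theorem pair_fst_snd (z : PairSpace E F) : pair z.fst z.snd = z := rfl

omit [NormedAddCommGroup E] [InnerProductSpace ℝ E] [NormedAddCommGroup F]
  [InnerProductSpace ℝ F] in
theorem fst_pair (x : E) (y : F) : (pair x y).fst = x := rfl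

omit [NormedAddCommGroup E] [InnerProductSpace ℝ E] [NormedAddCommGroup F]
  [InnerProductSpace ℝ F] in
theorem snd_pair (x : E) (y : F) : (pair x y).snd = y := rfl

omit [NormedAddCommGroup E] [InnerProductSpace ℝ E] [NormedAddCommGroup F]
  [InnerProductSpace ℝ F] in
theorem pair_ext {z z' : PairSpace E F} (h₁ : z.fst = z'.fst) (h₂ : z.snd = z'.snd) : z = z' := by
  rw [← pair_fst_snd z, h₁, h₂, pair_fst_snd]

omit [InnerProductSpace ℝ E] [InnerProductSpace ℝ F] in
theorem norm_fst_le_norm (z : PairSpace E F) : ‖z.fst‖ ≤ ‖z‖ := by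
  refine (sq_le_sq₀ (norm_nonneg _) (norm_nonneg _)).1 ?_
  rw [pair_norm_sq]
  exact le_add_of_nonneg_right (sq_nonneg _)

omit [InnerProductSpace ℝ E] [InnerProductSpace ℝ F] in
theorem norm_snd_le_norm (z : PairSpace E F) : ‖z.snd‖ ≤ ‖z‖ := by
  refine (sq_le_sq₀ (norm_nonneg _) (norm_nonneg _)).1 ?_
  rw [pair_norm_sq]
  exact le_add_of_nonneg_left (sq_nonneg _)

variable {X : Set E} {Y : Set F}

omit [InnerProductSpace ℝ E] [InnerProductSpace ℝ F] in
theorem strategies_eq_preimage :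
    strategies X Y = (WithLp.homeomorphProd 2 E F) ⁻¹' (X ×ˢ Y) := rfl

omit [InnerProductSpace ℝ E] [InnerProductSpace ℝ F] in
theorem isCompact_strategies (hX : IsCompact X) (hY : IsCompact Y) :
    IsCompact (strategies X Y) := by
  rw [strategies_eq_preimage]
  exact (WithLp.homeomorphProd 2 E F).isCompact_preimage.2 (hX.prod hY)

theorem convex_strategies (hX : Convex ℝ X) (hY : Convex ℝ Y) : Convex ℝ (strategies X Y) :=
  fun _ h _ h' _ _ ha hb hab => ⟨hX h.1 h'.1 ha hb hab, hY h.2 h'.2 ha hb hab⟩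

/-- `A` is the field `(∇ₓ Φ, -∇_y Φ)` of a saddle function `Φ` with moduli `m`, `n` on `X × Y`. -/
structure IsSaddleField (X : Set E) (Y : Set F) (m n K : ℝ) (Φ : PairSpace E F → ℝ)
    (A : PairSpace E F → PairSpace E F) : Prop where
  lower : ∀ z ∈ strategies X Y, ∀ x ∈ X,
    Φ z + ⟪(A z).fst, x - z.fst⟫ + m / 2 * ‖x - z.fst‖ ^ 2 ≤ Φ (pair x z.snd)
  upper : ∀ z ∈ strategies X Y, ∀ y ∈ Y,
    Φ (pair z.fst y) ≤ Φ z - ⟪(A z).snd, y - z.snd⟫ - n / 2 * ‖y - z.snd‖ ^ 2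
  lipschitz : ∀ z ∈ strategies X Y, ∀ z' ∈ strategies X Y, ‖A z - A z'‖ ≤ K * ‖z - z'‖

variable {m n K σ κ : ℝ} {Φ : PairSpace E F → ℝ} {A : PairSpace E F → PairSpace E F}

namespace IsSaddleField

/-- The sum of the two one-sided inequalities, in which Φ z cancels. -/
theorem gap_le (h : IsSaddleField X Y m n K Φ A) {z : PairSpace E F} (hz : z ∈ strategies X Y)
    {x : E} (hx : x ∈ X) {y : F} (hy : y ∈ Y) :
    Φ (pair z.fst y) - Φ (pair x z.snd)
      ≤ ⟪A z, z - pair x y⟫ - m / 2 * ‖z.fst - x‖ ^ 2 - n / 2 * ‖z.snd - y‖ ^ 2 := by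
  have h1 := h.lower z hz x hx
  have h2 := h.upper z hz y hy
  rw [norm_sub_rev, ← neg_sub z.fst x, inner_neg_right] at h1
  rw [norm_sub_rev, ← neg_sub z.snd y, inner_neg_right] at h2
  rw [pair_inner]
  simp only [WithLp.sub_fst, WithLp.sub_snd, fst_pair, snd_pair]
  linarith

theorem monotone (h : IsSaddleField X Y m n K Φ A) {z z' : PairSpace E F}
    (hz : z ∈ strategies X Y) (hz' : z' ∈ strategies X Y) :
    m * ‖z.fst - z'.fst‖ ^ 2 + n * ‖z.snd - z'.snd‖ ^ 2 ≤ ⟪A z - A z', z - z'⟫ := by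
  have h1 := h.gap_le hz hz'.1 hz'.2
  have h2 := h.gap_le hz' hz.1 hz.2
  rw [pair_fst_snd] at h1 h2
  rw [norm_sub_rev, norm_sub_rev z'.snd, ← neg_sub z z', inner_neg_right] at h2
  rw [inner_sub_left]
  linarith

theorem smul (h : IsSaddleField X Y m n K Φ A) {c : ℝ} (hc : 0 ≤ c) :
    IsSaddleField X Y (c * m) (c * n) (c * K) (fun z => c * Φ z) (fun z => c • A z) where
  lower z hz x hx := by
    have := mul_le_mul_of_nonneg_left (h.lower z hz x hx) hc
    simp only [WithLp.smul_fst, real_inner_smul_left]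
    linarith
  upper z hz y hy := by
    have := mul_le_mul_of_nonneg_left (h.upper z hz y hy) hc
    simp only [WithLp.smul_snd, real_inner_smul_left]
    linarith
  lipschitz z hz z' hz' := by
    rw [← smul_sub, norm_smul, Real.norm_eq_abs, abs_of_nonneg hc, mul_assoc]
    exact mul_le_mul_of_nonneg_left (h.lipschitz z hz z' hz') hc

end IsSaddleField

/-- The field of the proximal subproblem at the center `c`. -/
def proxField (A : PairSpace E F → PairSpace E F) (c w : PairSpace E F) : PairSpace E F :=
  A w + pair (-(1 / 2 : ℝ) • (w.fst + c.fst)) (w.snd - c.snd)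

omit [InnerProductSpace ℝ F] in
theorem proxField_sub (A : PairSpace E F → PairSpace E F) (c u v : PairSpace E F) :
    proxField A c u - proxField A c v
      = (A u - A v) + pair (-(1 / 2 : ℝ) • (u.fst - v.fst)) (u.snd - v.snd) := by
  rw [proxField, proxField, add_sub_add_comm]
  congr 1
  apply pair_ext
  · simp only [WithLp.sub_fst, fst_pair]
    module
  · simp only [WithLp.sub_snd, snd_pair]
    abel

/-- In f(z, y) + ‖(z, y) - c‖²/2 the best z for a given x is (c.fst - x)/2, which turns the
quadratic terms in z into ‖x + c.fst‖²/4. What remains is the saddle function Φ - ‖x + c.fst‖²/4 -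
‖y - c.snd‖²/2, with field `proxField`: half of the modulus 1 in x is spent, and the modulus in y
grows by 1. -/
theorem IsSaddleField.proxField_monotone (h : IsSaddleField X Y 1 σ κ Φ A) (hσ : 0 ≤ σ)
    (c : PairSpace E F) : ∀ u ∈ strategies X Y, ∀ v ∈ strategies X Y,
      1 / 2 * ‖u - v‖ ^ 2 ≤ ⟪proxField A c u - proxField A c v, u - v⟫ := by
  intro u hu v hv
  have h1 := h.monotone hu hv
  rw [proxField_sub, inner_add_left, pair_inner (pair _ (u.snd - v.snd)), pair_norm_sq]
  simp only [WithLp.sub_fst, WithLp.sub_snd, fst_pair, snd_pair, real_inner_smul_left,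
    real_inner_self_eq_norm_sq]
  have := mul_nonneg hσ (sq_nonneg ‖u.snd - v.snd‖)
  have := sq_nonneg ‖u.snd - v.snd‖
  linarith

theorem IsSaddleField.proxField_lipschitz (h : IsSaddleField X Y 1 σ κ Φ A)
    (c : PairSpace E F) : ∀ u ∈ strategies X Y, ∀ v ∈ strategies X Y,
      ‖proxField A c u - proxField A c v‖ ≤ (κ + 1) * ‖u - v‖ := by
  intro u hu v hv
  have h2 : ‖pair (-(1 / 2 : ℝ) • (u.fst - v.fst)) (u.snd - v.snd)‖ ≤ ‖u - v‖ := by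
    refine (sq_le_sq₀ (norm_nonneg _) (norm_nonneg _)).1 ?_
    rw [pair_norm_sq, pair_norm_sq]
    simp only [WithLp.sub_fst, WithLp.sub_snd, fst_pair, snd_pair, norm_smul, mul_pow]
    norm_num
    have := sq_nonneg ‖u.fst - v.fst‖
    linarith
  rw [proxField_sub]
  calc _ ≤ ‖A u - A v‖ + _ := norm_add_le _ _
    _ ≤ κ * ‖u - v‖ + ‖u - v‖ := add_le_add (h.lipschitz u hu v hv) h2
    _ = _ := by ring

/-! ### The jointly convex dual function -/

/-- The dual function `(z, y) ↦ sup_{x ∈ X} (‖x + z‖² / 2 - Φ(x, y))`. -/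
def dualFun (X : Set E) (Φ : PairSpace E F → ℝ) (p : PairSpace E F) : ℝ :=
  ⨆ x : X, (1 / 2 * ‖(x : E) + p.fst‖ ^ 2 - Φ (pair x p.snd))

/-- Without this bound the supremum in `dualFun` would be a default value. The affine minorant of Φ
at one point x₀ suffices, as an affine function is bounded on compact X. -/
theorem IsSaddleField.bddAbove_dualFun (h : IsSaddleField X Y m n K Φ A) (hm : 0 ≤ m)
    (hX : IsCompact X)
    (p : PairSpace E F) (hp : p.snd ∈ Y) :
    BddAbove (Set.range fun x : X => 1 / 2 * ‖(x : E) + p.fst‖ ^ 2 - Φ (pair x p.snd)) := by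
  rcases X.eq_empty_or_nonempty with rfl | ⟨x₀, hx₀⟩
  · exact ⟨0, by rintro _ ⟨⟨x, hx⟩, rfl⟩; exact hx.elim⟩
  obtain ⟨M, hM⟩ := hX.bddAbove_image (f := fun x : E => 1 / 2 * ‖x + p.fst‖ ^ 2
    - Φ (pair x₀ p.snd) - ⟪(A (pair x₀ p.snd)).fst, x - x₀⟫) (by fun_prop)
  refine ⟨M, ?_⟩
  rintro _ ⟨⟨x, hx⟩, rfl⟩
  refine le_trans ?_ (hM ⟨x, hx, rfl⟩)
  have h1 := h.lower (pair x₀ p.snd) ⟨hx₀, hp⟩ x hx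
  have h2 : 0 ≤ m / 2 * ‖x - x₀‖ ^ 2 := by positivity
  dsimp only [fst_pair, snd_pair] at h1 ⊢
  linarith

/-- A saddle gap estimate at `w` is an approximate subgradient inequality for the dual
function. -/
theorem IsSaddleField.dualFun_subgradient (h : IsSaddleField X Y 1 σ κ Φ A) (hσ1 : σ ≤ 1)
    (hX : IsCompact X) {w : PairSpace E F} (hw : w ∈ strategies X Y) {z : E} {s : F} {e : ℝ}
    (hgap : ∀ x ∈ X, ∀ y ∈ Y, Φ (pair w.fst y) - Φ (pair x w.snd)
      ≤ 1 / 2 * ‖w.fst‖ ^ 2 - 1 / 2 * ‖x‖ ^ 2 + ⟪z, w.fst - x⟫ + ⟪s, w.snd - y⟫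
        - σ / 2 * ‖w.snd - y‖ ^ 2 + e) (p : PairSpace E F) (hp : p.snd ∈ Y) :
    dualFun X Φ (pair z w.snd) + ⟪pair (z + w.fst) s, p - pair z w.snd⟫
      + σ / 2 * ‖p - pair z w.snd‖ ^ 2 - e ≤ dualFun X Φ p := by
  have : Nonempty X := ⟨⟨w.fst, hw.1⟩⟩
  -- At p the supremum is bounded from below by the single candidate x = w.fst; at the base point
  -- the gap estimate bounds it over all x.
  have h1 : 1 / 2 * ‖w.fst + p.fst‖ ^ 2 - Φ (pair w.fst p.snd) ≤ dualFun X Φ p :=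
    le_ciSup (h.bddAbove_dualFun zero_le_one hX p hp) (⟨w.fst, hw.1⟩ : X)
  have h2 : dualFun X Φ (pair z w.snd) ≤ 1 / 2 * ‖w.fst + z‖ ^ 2 - Φ (pair w.fst p.snd)
      + ⟪s, w.snd - p.snd⟫ - σ / 2 * ‖w.snd - p.snd‖ ^ 2 + e := by
    refine ciSup_le fun x => ?_
    have h3 := hgap x x.2 p.snd hp
    have e1 := norm_add_sq_real (x : E) z
    have e2 := norm_add_sq_real w.fst z
    rw [inner_sub_right, real_inner_comm _ z, real_inner_comm _ z] at h3
    simp only [fst_pair, snd_pair]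
    linarith
  rw [pair_inner, pair_norm_sq]
  simp only [WithLp.sub_fst, WithLp.sub_snd, fst_pair, snd_pair]
  have e1 : ‖w.fst + p.fst‖ ^ 2
      = ‖w.fst + z‖ ^ 2 + 2 * ⟪z + w.fst, p.fst - z⟫ + ‖p.fst - z‖ ^ 2 := by
    rw [show w.fst + p.fst = (z + w.fst) + (p.fst - z) by abel, norm_add_sq_real,
      add_comm w.fst z]
  rw [← neg_sub p.snd w.snd, inner_neg_right, norm_neg] at h2
  have h4 : σ / 2 * ‖p.fst - z‖ ^ 2 ≤ 1 / 2 * ‖p.fst - z‖ ^ 2 := by gcongr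
  linarith

/-- The dual function grows quadratically around the point that corresponds to a saddle point. -/
theorem IsSaddleField.dualFun_growth (h : IsSaddleField X Y 1 σ κ Φ A) (hσ1 : σ ≤ 1)
    (hX : IsCompact X) {w : PairSpace E F} (hw : w ∈ strategies X Y)
    (hsol : ∀ s ∈ strategies X Y, 0 ≤ ⟪A w, s - w⟫) (p : PairSpace E F) (hp : p.snd ∈ Y) :
    dualFun X Φ (pair (-w.fst) w.snd) + σ / 2 * ‖p - pair (-w.fst) w.snd‖ ^ 2
      ≤ dualFun X Φ p := by
  have h1 := h.dualFun_subgradient hσ1 hX hw (z := -w.fst) (s := 0) (e := 0) (by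
    intro x hx y hy
    have h2 := h.gap_le hw hx hy
    have h3 := hsol (pair x y) ⟨hx, hy⟩
    rw [← neg_sub w, inner_neg_right] at h3
    have e1 : ‖x‖ ^ 2 = ‖w.fst‖ ^ 2 - 2 * ⟪w.fst, w.fst - x⟫ + ‖w.fst - x‖ ^ 2 := by
      rw [← norm_sub_sq_real]; congr 2; abel
    rw [inner_zero_left, inner_neg_left]
    linarith) p hp
  have e : pair (-w.fst + w.fst) (0 : F) = 0 := by rw [neg_add_cancel]; rfl
  rw [e, inner_zero_left] at h1
  linarith

end Pairs

/-! ### Inexact proximal steps for saddle fields -/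

section ProxStep

variable {E F : Type*} [NormedAddCommGroup E] [InnerProductSpace ℝ E]
  [NormedAddCommGroup F] [InnerProductSpace ℝ F]
  {X : Set E} {Y : Set F} {σ κ τ : ℝ} {Φ : PairSpace E F → ℝ} {A : PairSpace E F → PairSpace E F}

/-- The starting point of the inner iteration for the center `c`. -/
def proxStart (c : PairSpace E F) : PairSpace E F := pair (-c.fst) c.snd

/-- The average of the inner iterates. -/
def proxAverage (X : Set E) (Y : Set F) (τ : ℝ) (N : ℕ) (A : PairSpace E F → PairSpace E F)
    (c : PairSpace E F) : PairSpace E F :=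
  fbfAverage (strategies X Y) τ (proxField A c) (proxStart c) N

/-- The average residual of the inner iteration. -/
def proxResidual (X : Set E) (Y : Set F) (τ : ℝ) (N : ℕ) (A : PairSpace E F → PairSpace E F)
    (c : PairSpace E F) : PairSpace E F :=
  fbfResidual (strategies X Y) τ (proxField A c) (proxStart c) N

/-- The dual point with average `w` and residual `r`. -/
def dualPoint (c w r : PairSpace E F) : PairSpace E F :=
  pair (r.fst - (1 / 2 : ℝ) • w.fst + (1 / 2 : ℝ) • c.fst) w.snd

/-- The approximate subgradient of the dual function at `dualPoint c w r`. -/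
def dualSubgradient (c w r : PairSpace E F) : PairSpace E F :=
  pair ((dualPoint c w r).fst + w.fst) (r.snd - (w.snd - c.snd))

/-- One summand of the ergodic estimate. -/
theorem IsSaddleField.ergodic_summand (h : IsSaddleField X Y 1 σ κ Φ A) (hσ : 0 ≤ σ)
    {c w wi r g : PairSpace E F} {x : E} {y : F} (hτ : 0 ≤ τ)
    (hw : w ∈ strategies X Y) (hwi : wi ∈ strategies X Y) (hx : x ∈ X) (hy : y ∈ Y)
    (hg : τ * ⟪proxField A c wi, wi - pair x y⟫ ≤ ⟪g, wi - pair x y⟫) :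
    τ * (Φ (pair w.fst y) - Φ (pair x w.snd))
      ≤ τ * (1 / 2 * ‖w.fst‖ ^ 2 - 1 / 2 * ‖x‖ ^ 2 + ⟪(dualPoint c w r).fst, w.fst - x⟫
          + ⟪(dualSubgradient c w r).snd, w.snd - y⟫ - σ / 2 * ‖w.snd - y‖ ^ 2)
        + ⟪g, wi - w⟫ + ⟪g - τ • r, w - pair x y⟫
        + τ * ⟪wi - w, pair ((1 / 2 : ℝ) • (w.fst + c.fst) - (1 / 2 : ℝ) • (w.fst - x)
              - (A (pair w.fst y)).fst)
            (-(A (pair x w.snd)).snd - (w.snd - c.snd) - (1 + σ) • (w.snd - y))⟫ := by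
  have h1 := h.lower (pair w.fst y) ⟨hw.1, hy⟩ wi.fst hwi.1
  have h2 := h.upper (pair x w.snd) ⟨hx, hw.2⟩ wi.snd hwi.2
  have h3 := h.gap_le hwi hx hy
  have e1 : ⟪g, wi - pair x y⟫ + τ * 0
      = ⟪g, wi - w⟫ + ⟪g - τ • r, w - pair x y⟫ + τ * ⟪r, w - pair x y⟫ := by
    rw [← real_inner_smul_left, show wi - pair x y = (wi - w) + (w - pair x y) by abel,
      inner_add_right, inner_sub_left]
    ring
  have e2 : ⟪proxField A c wi, wi - pair x y⟫ = ⟪A wi, wi - pair x y⟫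
      - 1 / 2 * ⟪wi.fst + c.fst, wi.fst - x⟫ + ⟪wi.snd - c.snd, wi.snd - y⟫ := by
    rw [proxField, inner_add_left, pair_inner (pair _ (wi.snd - c.snd))]
    simp only [WithLp.sub_fst, WithLp.sub_snd, fst_pair, snd_pair, real_inner_smul_left]
    ring
  have h4 : τ * (Φ (pair w.fst y) - Φ (pair x w.snd)) ≤ τ * (⟪A wi, wi - pair x y⟫
      - 1 / 2 * ‖wi.fst - x‖ ^ 2 - σ / 2 * ‖wi.snd - y‖ ^ 2
      - ⟪(A (pair w.fst y)).fst, wi.fst - w.fst⟫ - 1 / 2 * ‖wi.fst - w.fst‖ ^ 2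
      - ⟪(A (pair x w.snd)).snd, wi.snd - w.snd⟫ - σ / 2 * ‖wi.snd - w.snd‖ ^ 2) := by
    apply mul_le_mul_of_nonneg_left _ hτ
    simp only [fst_pair, snd_pair] at h1 h2
    linarith
  rw [e2] at hg
  have h5 : 0 ≤ τ * ((1 + σ) * ‖wi.snd - w.snd‖ ^ 2 + 1 / 2 * ‖wi.fst - w.fst‖ ^ 2) := by
    positivity
  rw [pair_inner r] at e1
  rw [pair_inner (wi - w) (pair _ _)]
  clear h1 h2 h3 e2
  generalize ⟪A wi, wi - pair x y⟫ = P at *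
  generalize ⟪g, wi - pair x y⟫ = q₁ at *
  generalize ⟪g, wi - w⟫ = q₂ at *
  generalize ⟪g - τ • r, w - pair x y⟫ = q₃ at *
  generalize (A (pair w.fst y)).fst = u₁ at *
  generalize (A (pair x w.snd)).snd = u₂ at *
  generalize Φ (pair w.fst y) - Φ (pair x w.snd) = Δ at *
  simp only [WithLp.sub_fst, WithLp.sub_snd, fst_pair, snd_pair, dualPoint,
    dualSubgradient] at e1 ⊢
  have hwx : wi.fst - x = (w.fst - x) + (wi.fst - w.fst) := by abel
  have hwy : wi.snd - y = (w.snd - y) + (wi.snd - w.snd) := by abel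
  have hcx : wi.fst + c.fst = (w.fst + c.fst) + (wi.fst - w.fst) := by abel
  have hcy : wi.snd - c.snd = (w.snd - c.snd) + (wi.snd - w.snd) := by abel
  have hrx : r.fst - (1 / 2 : ℝ) • w.fst + (1 / 2 : ℝ) • c.fst
      = r.fst + (1 / 2 : ℝ) • (w.fst + c.fst) - w.fst := by module
  have e3 : ‖x‖ ^ 2 = ‖w.fst‖ ^ 2 - 2 * ⟪w.fst, w.fst - x⟫ + ‖w.fst - x‖ ^ 2 := by
    rw [← norm_sub_sq_real]; congr 2; abel
  rw [hwx, hwy] at h4 hg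
  rw [hcx, hcy] at hg
  rw [hrx, e3]
  generalize w.fst - x = a at *
  generalize w.snd - y = b at *
  generalize wi.fst - w.fst = d at *
  generalize wi.snd - w.snd = k at *
  generalize w.fst + c.fst = m at *
  generalize w.snd - c.snd = t at *
  simp only [inner_add_left, inner_add_right, inner_sub_left, inner_sub_right,
    real_inner_smul_left, real_inner_smul_right, inner_neg_right, norm_add_sq_real,
    real_inner_self_eq_norm_sq, real_inner_comm a d, real_inner_comm b k,
    real_inner_comm d m, real_inner_comm k t, real_inner_comm d u₁,
    real_inner_comm k u₂] at h4 hg ⊢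
  linarith

/-- The regret is taken against the average w itself and not against (x, y). The dependence on (x,
y) is then carried by the residual, so the error term is uniform and can serve as the error of an
approximate subgradient of the dual function. -/
theorem IsSaddleField.ergodic (h : IsSaddleField X Y 1 σ κ Φ A) (hσ : 0 ≤ σ)
    (hX : IsCompact X) (hXc : Convex ℝ X) (hY : IsCompact Y) (hYc : Convex ℝ Y)
    (hne : (strategies X Y).Nonempty) (hτ : 0 < τ) (hK : τ * (κ + 1) ≤ 1)
    (c : PairSpace E F) {N : ℕ} (hN : 0 < N) {x : E} {y : F} (hx : x ∈ X) (hy : y ∈ Y) :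
    Φ (pair (proxAverage X Y τ N A c).fst y) - Φ (pair x (proxAverage X Y τ N A c).snd)
      ≤ 1 / 2 * ‖(proxAverage X Y τ N A c).fst‖ ^ 2 - 1 / 2 * ‖x‖ ^ 2
        + ⟪(dualPoint c (proxAverage X Y τ N A c) (proxResidual X Y τ N A c)).fst,
            (proxAverage X Y τ N A c).fst - x⟫
        + ⟪(dualSubgradient c (proxAverage X Y τ N A c) (proxResidual X Y τ N A c)).snd,
            (proxAverage X Y τ N A c).snd - y⟫
        - σ / 2 * ‖(proxAverage X Y τ N A c).snd - y‖ ^ 2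
        + ‖proxStart c - proxAverage X Y τ N A c‖ ^ 2 / (2 * (τ * N)) := by
  have hS := isCompact_strategies hX hY
  have hSc := convex_strategies hXc hYc
  have hN' : (0 : ℝ) < N := by positivity
  set w := proxAverage X Y τ N A c with hw
  set r := proxResidual X Y τ N A c with hr
  set u := proxStart c
  have hwS : w ∈ strategies X Y := fbfAverage_mem hS hSc hne _ hN
  have h1 := Finset.sum_le_sum fun i (_ : i ∈ Finset.range N) =>
    h.ergodic_summand hσ (c := c) (w := w) (r := r) hτ.le hwS
      (fbfSeq_mem (τ := τ) (B := proxField A c) hS hne u i) hx hy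
      (inner_le_inner_fbf hS hSc hne _ ⟨hx, hy⟩)
  simp only [← Function.iterate_succ_apply' (fbfNext (strategies X Y) τ (proxField A c)),
    Nat.succ_eq_add_one] at h1
  have e1 : ∀ v, ∑ i ∈ Finset.range N,
      ⟪fbfSeq (strategies X Y) τ (proxField A c) u i - w, v⟫ = 0 := by
    intro v
    rw [← sum_inner, show ∑ i ∈ Finset.range N,
      (fbfSeq (strategies X Y) τ (proxField A c) u i - w) = 0 from
      sum_fbfSeq_sub_average u hN, inner_zero_left]
  have e2 : ∀ v, ∑ i ∈ Finset.range N, ⟪(fbfNext (strategies X Y) τ (proxField A c))^[i] u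
      - (fbfNext (strategies X Y) τ (proxField A c))^[i + 1] u - τ • r, v⟫ = 0 :=
    fun v => sum_fbf_residual u v hN hτ
  rw [Finset.sum_add_distrib, Finset.sum_add_distrib, Finset.sum_add_distrib, Finset.sum_const,
    Finset.sum_const, Finset.card_range, ← Finset.mul_sum, e1, e2, mul_zero, add_zero, add_zero,
    nsmul_eq_mul, nsmul_eq_mul] at h1
  have h2 := sum_fbf_regret hS hSc hne hτ.le hK (h.proxField_lipschitz c) u w N
  have h3 := sq_nonneg ‖(fbfNext (strategies X Y) τ (proxField A c))^[N] u - w‖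
  have h4 : ‖u - w‖ ^ 2 / (2 * (τ * N)) * (τ * N) = 1 / 2 * ‖u - w‖ ^ 2 := by
    field_simp
  rw [← sub_nonneg]
  refine nonneg_of_mul_nonneg_left (b := τ * N) ?_ (by positivity)
  rw [sub_mul, add_mul, h4]
  linarith

/-- The inner iteration computes a proximal point of the dual function up to a relative error. -/
theorem IsSaddleField.isRelativeProx (h : IsSaddleField X Y 1 σ κ Φ A) (hσ : 0 ≤ σ) (hσ1 : σ ≤ 1)
    (hX : IsCompact X) (hXc : Convex ℝ X) (hY : IsCompact Y) (hYc : Convex ℝ Y)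
    (hne : (strategies X Y).Nonempty) (hτ : 0 < τ) (hκ : 0 ≤ κ) (hK : τ * (κ + 1) ≤ 1)
    (c : PairSpace E F) {N : ℕ} (hN : 64 ≤ τ * N) :
    IsRelativeProx {p : PairSpace E F | p.snd ∈ Y} (dualFun X Φ) σ c
      (dualPoint c (proxAverage X Y τ N A c) (proxResidual X Y τ N A c))
      (dualSubgradient c (proxAverage X Y τ N A c) (proxResidual X Y τ N A c)) := by
  have hS := isCompact_strategies hX hY
  have hSc := convex_strategies hXc hYc
  have hN0 : 0 < N := by
    rcases Nat.eq_zero_or_pos N with rfl | h0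
    · norm_num at hN
    · exact h0
  obtain ⟨s, hs, hsol⟩ := exists_variational_solution hS hSc hne (by norm_num)
    (by linarith) (h.proxField_monotone hσ c) (h.proxField_lipschitz c)
  have hr := norm_fbfResidual_le hS hSc hne hτ hK (h.proxField_lipschitz c)
    (h.proxField_monotone hσ c) hs hsol (proxStart c) hN0
  have ha := norm_fbfAverage_sub_sq_le hS hSc hne hτ hK (h.proxField_lipschitz c)
    (h.proxField_monotone hσ c) hs hsol (proxStart c) hN0
  have hwS : proxAverage X Y τ N A c ∈ strategies X Y := fbfAverage_mem hS hSc hne _ hN0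
  have herg := fun x hx y hy =>
    h.ergodic hσ hX hXc hY hYc hne hτ hK c hN0 (x := x) (y := y) hx hy
  change τ * N * ‖proxResidual X Y τ N A c‖ ≤ _ at hr
  change τ * N * ‖proxAverage X Y τ N A c - s‖ ^ 2 ≤ _ at ha
  refine ⟨hwS.2, ‖proxStart c - proxAverage X Y τ N A c‖ ^ 2 / (2 * (τ * N)), fun p hp =>
    h.dualFun_subgradient hσ1 hX hwS herg p hp, ?_⟩
  generalize proxAverage X Y τ N A c = w at *
  generalize proxResidual X Y τ N A c = r at *
  -- Every error is compared with the distance R from the start to the exact solution s. With τN ≥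
  -- 64 the residual is at most R/32 and the average lies within R/8 of s.
  set R := ‖proxStart c - s‖ with hR
  have hR0 : 0 ≤ R := norm_nonneg _
  have hr' : ‖r‖ ≤ R / 32 := by nlinarith [norm_nonneg r]
  have ha' : ‖w - s‖ ≤ R / 8 := by
    refine (sq_le_sq₀ (norm_nonneg _) (by positivity)).1 ?_
    nlinarith [sq_nonneg ‖w - s‖]
  have hu : ‖proxStart c - w‖ ≤ 9 / 8 * R := by
    have : proxStart c - w = (proxStart c - s) - (w - s) := by abel
    rw [this]
    linarith [norm_sub_le (proxStart c - s) (w - s)]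
  have hl : 7 / 8 * R ≤ ‖w - proxStart c‖ := by
    have : proxStart c - s = (w - s) - (w - proxStart c) := by abel
    have h2 := norm_sub_le (w - s) (w - proxStart c)
    rw [← this] at h2
    linarith
  have he : ‖proxStart c - w‖ ^ 2 / (2 * (τ * N)) ≤ (9 / 8 * R) ^ 2 / 128 := by
    have h2 : ‖proxStart c - w‖ ^ 2 ≤ (9 / 8 * R) ^ 2 := pow_le_pow_left₀ (norm_nonneg _) hu 2
    gcongr
    linarith
  have hv : ‖dualSubgradient c w r + (dualPoint c w r - c)‖ ≤ 2 * ‖r‖ := by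
    refine (sq_le_sq₀ (norm_nonneg _) (by positivity)).1 ?_
    rw [mul_pow, pair_norm_sq, pair_norm_sq r]
    have e1 : (dualSubgradient c w r + (dualPoint c w r - c)).fst = (2 : ℝ) • r.fst := by
      simp only [dualSubgradient, dualPoint, WithLp.add_fst, WithLp.sub_fst, fst_pair]
      module
    have e2 : (dualSubgradient c w r + (dualPoint c w r - c)).snd = r.snd := by
      simp only [dualSubgradient, dualPoint, WithLp.add_snd, WithLp.sub_snd, snd_pair]
      abel
    rw [e1, e2, norm_smul, mul_pow, Real.norm_ofNat]
    have := sq_nonneg ‖r.snd‖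
    linarith
  -- Up to the residual, the dual point minus c is w minus the start, with the first component
  -- multiplied by -1/2.
  have hd : 1 / 2 * ‖w - proxStart c‖ ≤ ‖dualPoint c w r - c‖ + ‖r‖ := by
    have e : ‖(dualPoint c w r - c) - pair r.fst 0‖ ≥ 1 / 2 * ‖w - proxStart c‖ := by
      refine (sq_le_sq₀ (by positivity) (norm_nonneg _)).1 ?_
      rw [mul_pow, pair_norm_sq, pair_norm_sq ((_ : PairSpace E F) - _)]
      have e1 : ((dualPoint c w r - c) - pair r.fst 0).fst
          = -(1 / 2 : ℝ) • (w - proxStart c).fst := by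
        simp only [dualPoint, proxStart, WithLp.sub_fst, fst_pair]
        module
      have e2 : ((dualPoint c w r - c) - pair r.fst 0).snd = (w - proxStart c).snd := by
        simp only [dualPoint, proxStart, WithLp.sub_snd, snd_pair, sub_zero]
      rw [e1, e2, norm_smul, mul_pow]
      norm_num
      have := sq_nonneg ‖(w - proxStart c).snd‖
      simp only [WithLp.sub_snd] at this
      linarith
    have e3 : ‖pair r.fst (0 : F)‖ ≤ ‖r‖ := by
      refine (sq_le_sq₀ (norm_nonneg _) (norm_nonneg _)).1 ?_
      rw [pair_norm_sq, pair_norm_sq r, fst_pair, snd_pair, norm_zero]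
      have := sq_nonneg ‖r.snd‖
      linarith
    linarith [norm_sub_le (dualPoint c w r - c) (pair r.fst 0)]
  have hd' : 13 / 32 * R ≤ ‖dualPoint c w r - c‖ := by linarith
  have hv' : ‖dualSubgradient c w r + (dualPoint c w r - c)‖ ^ 2 ≤ (R / 16) ^ 2 :=
    pow_le_pow_left₀ (norm_nonneg _) (by linarith) 2
  have hd2 : (13 / 32 * R) ^ 2 ≤ ‖dualPoint c w r - c‖ ^ 2 :=
    pow_le_pow_left₀ (by positivity) hd' 2
  -- In units of R², the left side is at most (1/16)² + (9/8)²/64 < 0.024, and the right side at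
  -- least (13/32)²/4 > 0.041.
  nlinarith [sq_nonneg R]

end ProxStep

/-! ### Composition of query methods -/

namespace QueryMethod

variable {Q A O O' Q' A' : Type*}

theorem run_bind (f : Q → A) (M : QueryMethod Q A O) (k : O → QueryMethod Q A O') :
    (M.bind k).run f = (k (M.run f)).run f := by
  induction M with
  | output o => rfl
  | query q next ih => exact ih (f q)

theorem numQueries_bind (f : Q → A) (M : QueryMethod Q A O) (k : O → QueryMethod Q A O') :
    (M.bind k).numQueries f = M.numQueries f + (k (M.run f)).numQueries f := by
  induction M with
  | output o => exact (zero_add _).symm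
  | query q next ih =>
    change ((next (f q)).bind k).numQueries f + 1
      = (next (f q)).numQueries f + 1 + (k ((next (f q)).run f)).numQueries f
    rw [ih (f q)]
    ring

/-- Repeat a step of a method. -/
def iterate (step : O → QueryMethod Q A O) : ℕ → O → QueryMethod Q A O
  | 0, o => .output o
  | n + 1, o => (step o).bind (iterate step n)

theorem run_iterate (f : Q → A) (step : O → QueryMethod Q A O) (n : ℕ) (o : O) :
    (iterate step n o).run f = (fun o => (step o).run f)^[n] o := by
  induction n generalizing o with
  | zero => rfl
  | succ n ih =>
    rw [iterate, run_bind, ih, Function.iterate_succ_apply]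

theorem numQueries_iterate (f : Q → A) (step : O → QueryMethod Q A O) {c : ℕ}
    (hc : ∀ o, (step o).numQueries f = c) (n : ℕ) (o : O) :
    (iterate step n o).numQueries f = n * c := by
  induction n generalizing o with
  | zero => exact (zero_mul c).symm
  | succ n ih =>
    rw [iterate, numQueries_bind, ih, hc]
    ring

/-- Translate the queries, the answers and the output of a method. -/
def translate (q : Q → Q') (a : Q → A' → A) (r : O → O') : QueryMethod Q A O → QueryMethod Q' A' O'
  | output o => .output (r o)
  | query z next => .query (q z) fun b => translate q a r (next (a z b))

theorem run_translate (f : Q' → A') (q : Q → Q') (a : Q → A' → A) (r : O → O')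
    (M : QueryMethod Q A O) :
    (M.translate q a r).run f = r (M.run fun z => a z (f (q z))) := by
  induction M with
  | output o => rfl
  | query z next ih => exact ih _

theorem numQueries_translate (f : Q' → A') (q : Q → Q') (a : Q → A' → A) (r : O → O')
    (M : QueryMethod Q A O) :
    (M.translate q a r).numQueries f = M.numQueries fun z => a z (f (q z)) := by
  induction M with
  | output o => rfl
  | query z next ih => exact congrArg (· + 1) (ih _)

end QueryMethod

/-! ### The saddle point method -/

section SaddleMethod

variable {E F : Type*} [NormedAddCommGroup E] [InnerProductSpace ℝ E]
  [NormedAddCommGroup F] [InnerProductSpace ℝ F]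

/-- A method that queries a field and returns an element of `O`. -/
abbrev FieldMethod (E F O : Type*) := QueryMethod (PairSpace E F) (PairSpace E F) O

/-- One step of the inner iteration; the second component accumulates the visited points. -/
def innerStepMethod (X : Set E) (Y : Set F) (τ : ℝ) (c : PairSpace E F)
    (t : PairSpace E F × PairSpace E F) : FieldMethod E F (PairSpace E F × PairSpace E F) :=
  .query (proj (strategies X Y) t.1) fun a =>
    .query (proj (strategies X Y)
        (t.1 - τ • proxField (fun _ => a) c (proj (strategies X Y) t.1))) fun b =>
      .output
        (proj (strategies X Y)
            (t.1 - τ • proxField (fun _ => a) c (proj (strategies X Y) t.1))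
          - τ • (proxField (fun _ => b) c (proj (strategies X Y)
              (t.1 - τ • proxField (fun _ => a) c (proj (strategies X Y) t.1)))
            - proxField (fun _ => a) c (proj (strategies X Y) t.1)),
        t.2 + proj (strategies X Y)
            (t.1 - τ • proxField (fun _ => a) c (proj (strategies X Y) t.1)))

/-- The inner iteration: the average of the visited points, and the average residual. -/
def proxMethod (X : Set E) (Y : Set F) (τ : ℝ) (N : ℕ) (c : PairSpace E F) :
    FieldMethod E F (PairSpace E F × PairSpace E F) :=
  (QueryMethod.iterate (innerStepMethod X Y τ c) N (proxStart c, 0)).bind fun t =>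
    .output ((N : ℝ)⁻¹ • t.2, (τ * N)⁻¹ • (proxStart c - t.1))

variable {X : Set E} {Y : Set F} {σ κ τ : ℝ} {Φ : PairSpace E F → ℝ}
  {A : PairSpace E F → PairSpace E F}

theorem run_proxMethod (N : ℕ) (c : PairSpace E F) :
    (proxMethod X Y τ N c).run A = (proxAverage X Y τ N A c, proxResidual X Y τ N A c) := by
  rw [proxMethod, QueryMethod.run_bind, QueryMethod.run_iterate]
  have e : ∀ n : ℕ, (fun t => (innerStepMethod X Y τ c t).run A)^[n] (proxStart c, 0)
      = ((fbfNext (strategies X Y) τ (proxField A c))^[n] (proxStart c),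
        ∑ i ∈ Finset.range n, fbfSeq (strategies X Y) τ (proxField A c) (proxStart c) i) := by
    intro n
    induction n with
    | zero => rfl
    | succ n ih =>
      rw [Function.iterate_succ_apply', ih, Function.iterate_succ_apply', Finset.sum_range_succ]
      rfl
  rw [e]
  rfl

theorem numQueries_proxMethod (N : ℕ) (c : PairSpace E F) :
    (proxMethod X Y τ N c).numQueries A = N * 2 := by
  rw [proxMethod, QueryMethod.numQueries_bind,
    QueryMethod.numQueries_iterate A _ (c := 2) (fun _ => rfl)]
  rfl

/-- One accelerated outer step, from the state `s = (p, q)`. -/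
def outerStep (X : Set E) (Y : Set F) (σ τ α : ℝ) (N : ℕ) (A : PairSpace E F → PairSpace E F)
    (s : PairSpace E F × PairSpace E F) : PairSpace E F × PairSpace E F :=
  let c := (1 + α)⁻¹ • (s.1 + α • s.2)
  let p := dualPoint c (proxAverage X Y τ N A c) (proxResidual X Y τ N A c)
  (p, (1 - α) • s.2 + α • p
    - (α / σ) • dualSubgradient c (proxAverage X Y τ N A c) (proxResidual X Y τ N A c))

/-- The state after the initial proximal step at `w`. -/
def outerStart (X : Set E) (Y : Set F) (τ : ℝ) (N : ℕ) (A : PairSpace E F → PairSpace E F)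
    (w : PairSpace E F) : PairSpace E F × PairSpace E F :=
  (dualPoint (proxStart w) (proxAverage X Y τ N A (proxStart w))
    (proxResidual X Y τ N A (proxStart w)), proxStart w)

/-- `outerStep` as a method. -/
def outerStepMethod (X : Set E) (Y : Set F) (σ τ α : ℝ) (N : ℕ)
    (s : PairSpace E F × PairSpace E F) : FieldMethod E F (PairSpace E F × PairSpace E F) :=
  (proxMethod X Y τ N ((1 + α)⁻¹ • (s.1 + α • s.2))).bind fun t =>
    .output (dualPoint ((1 + α)⁻¹ • (s.1 + α • s.2)) t.1 t.2,
      (1 - α) • s.2 + α • dualPoint ((1 + α)⁻¹ • (s.1 + α • s.2)) t.1 t.2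
        - (α / σ) • dualSubgradient ((1 + α)⁻¹ • (s.1 + α • s.2)) t.1 t.2)

/-- The complete method: an initial proximal step, `k` accelerated steps, and a projection step. -/
def saddleMethod (X : Set E) (Y : Set F) (σ κ τ α : ℝ) (N k : ℕ) (w : PairSpace E F) :
    FieldMethod E F (PairSpace E F) :=
  (proxMethod X Y τ N (proxStart w)).bind fun t =>
    (QueryMethod.iterate (outerStepMethod X Y σ τ α N) k
      (dualPoint (proxStart w) t.1 t.2, proxStart w)).bind fun s =>
        .query (proj (strategies X Y) (proxStart s.1)) fun a =>
          .output (proj (strategies X Y) (proj (strategies X Y) (proxStart s.1) - κ⁻¹ • a))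

theorem run_saddleMethod (α : ℝ) (N k : ℕ) (w : PairSpace E F) :
    (saddleMethod X Y σ κ τ α N k w).run A
      = proj (strategies X Y) (proj (strategies X Y) (proxStart
          ((outerStep X Y σ τ α N A)^[k] (outerStart X Y τ N A w)).1)
        - κ⁻¹ • A (proj (strategies X Y) (proxStart
          ((outerStep X Y σ τ α N A)^[k] (outerStart X Y τ N A w)).1))) := by
  rw [saddleMethod, QueryMethod.run_bind, QueryMethod.run_bind, QueryMethod.run_iterate,
    run_proxMethod]
  have e : (fun s => (outerStepMethod X Y σ τ α N s).run A) = outerStep X Y σ τ α N A := by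
    funext s
    rw [outerStepMethod, QueryMethod.run_bind, run_proxMethod]
    rfl
  rw [e]
  rfl

theorem numQueries_saddleMethod (α : ℝ) (N k : ℕ) (w : PairSpace E F) :
    (saddleMethod X Y σ κ τ α N k w).numQueries A = (k + 1) * (N * 2) + 1 := by
  rw [saddleMethod, QueryMethod.numQueries_bind, QueryMethod.numQueries_bind,
    QueryMethod.numQueries_iterate A _ (c := N * 2), numQueries_proxMethod]
  · change N * 2 + (k * (N * 2) + 1) = _
    ring
  · intro s
    rw [outerStepMethod, QueryMethod.numQueries_bind, numQueries_proxMethod]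
    rfl

omit [InnerProductSpace ℝ E] [NormedAddCommGroup F] [InnerProductSpace ℝ F] in
theorem proxStart_proxStart (p : PairSpace E F) : proxStart (proxStart p) = p :=
  pair_ext (neg_neg p.fst) rfl

omit [InnerProductSpace ℝ E] [InnerProductSpace ℝ F] in
theorem norm_proxStart_sub (p w : PairSpace E F) :
    ‖proxStart p - w‖ = ‖p - proxStart w‖ := by
  refine (sq_eq_sq₀ (norm_nonneg _) (norm_nonneg _)).1 ?_
  rw [pair_norm_sq, pair_norm_sq (p - proxStart w)]
  simp only [proxStart, WithLp.sub_fst, WithLp.sub_snd, fst_pair, snd_pair]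
  rw [← norm_neg (-p.fst - w.fst)]
  congr 3
  abel

/-- After a projection step from `u`, the variational gap is bounded by the distance of `u` to
the solution. -/
theorem gap_le_of_projection_step {S : Set (PairSpace E F)} (hS : IsCompact S)
    (hc : Convex ℝ S) {D : ℝ} (hD : ∀ u ∈ S, ∀ v ∈ S, ‖u - v‖ ≤ D) (hκ : 0 < κ)
    (hlip : ∀ u ∈ S, ∀ v ∈ S, ‖A u - A v‖ ≤ κ * ‖u - v‖)
    (hmono : ∀ u ∈ S, ∀ v ∈ S, 0 ≤ ⟪A u - A v, u - v⟫)
    {w : PairSpace E F} (hw : w ∈ S) (hsol : ∀ s ∈ S, 0 ≤ ⟪A w, s - w⟫)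
    {u : PairSpace E F} (hu : u ∈ S) {s : PairSpace E F} (hs : s ∈ S) :
    ⟪A (proj S (u - κ⁻¹ • A u)), proj S (u - κ⁻¹ • A u) - s⟫ ≤ 3 * κ * D * ‖u - w‖ := by
  have hz : proj S (u - κ⁻¹ • A u) ∈ S := (proj_spec hS ⟨w, hw⟩ _).1
  have hp : ∀ s ∈ S, ⟪u - κ⁻¹ • A u - proj S (u - κ⁻¹ • A u), s - proj S (u - κ⁻¹ • A u)⟫ ≤ 0 :=
    fun s hs => inner_sub_proj_nonpos hS hc ⟨w, hw⟩ _ hs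
  generalize proj S (u - κ⁻¹ • A u) = z at *
  have hmove := norm_sub_sq_le_of_projection_step (inv_nonneg.2 hκ.le) hz hw hsol
    (hmono u hu w hw) (by
      rw [inv_mul_le_iff₀ hκ]; exact hlip u hu w hw) hp
  -- The factor √2 is rounded up to 3/2, which makes the final constant 2 · 3/2 = 3.
  have hmove' : ‖z - u‖ ≤ 3 / 2 * ‖u - w‖ := by
    refine (sq_le_sq₀ (norm_nonneg _) (by positivity)).1 ?_
    nlinarith [sq_nonneg ‖u - w‖]
  have h1 := hp s hs
  have e : ⟪A z, z - s⟫ = ⟪A z - A u - κ • (z - u), z - s⟫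
      + κ * ⟪u - κ⁻¹ • A u - z, s - z⟫ := by
    rw [← real_inner_smul_left, show s - z = -(z - s) by abel, inner_neg_right, ← inner_neg_left,
      ← inner_add_left]
    congr 1
    rw [smul_sub, smul_sub κ (u - κ⁻¹ • A u), smul_sub κ u, smul_smul, mul_inv_cancel₀ hκ.ne', one_smul]
    abel
  have h2 := real_inner_le_norm (A z - A u - κ • (z - u)) (z - s)
  have h3 : ‖A z - A u - κ • (z - u)‖ ≤ 2 * κ * ‖z - u‖ := by
    have := norm_sub_le (A z - A u) (κ • (z - u))
    rw [norm_smul, Real.norm_eq_abs, abs_of_pos hκ] at this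
    linarith [hlip z hz u hu]
  have h4 := hD z hz s hs
  have h5 : κ * ⟪u - κ⁻¹ • A u - z, s - z⟫ ≤ 0 := mul_nonpos_of_nonneg_of_nonpos hκ.le h1
  calc ⟪A z, z - s⟫ ≤ ‖A z - A u - κ • (z - u)‖ * ‖z - s‖ := by linarith
    _ ≤ (2 * κ * (3 / 2 * ‖u - w‖)) * D := by
        gcongr
        exact h3.trans (by gcongr)
    _ = _ := by ring

/-- The potential decays geometrically from at most D², quadratic growth of the dual function
converts it into a distance to (-x*, y*), and the last projection step converts the distance into a
variational gap. -/
theorem IsSaddleField.saddleMethod_spec (h : IsSaddleField X Y 1 σ κ Φ A) (hσ : 0 < σ)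
    (hσ1 : σ ≤ 1) (hX : IsCompact X) (hXc : Convex ℝ X) (hY : IsCompact Y) (hYc : Convex ℝ Y)
    (hτ : 0 < τ) (hκ : 0 < κ) (hK : τ * (κ + 1) ≤ 1) {α D e : ℝ} (hα : 0 < α)
    (hασ : α ^ 2 = σ / 4) {N k : ℕ} (hN : 64 ≤ τ * N)
    (hD : ∀ u ∈ strategies X Y, ∀ v ∈ strategies X Y, ‖u - v‖ ≤ D) (he : 0 < e)
    (hk : 18 * κ ^ 2 * D ^ 4 * (1 - α) ^ k ≤ σ * e ^ 2)
    {w₀ : PairSpace E F} (hw₀ : w₀ ∈ strategies X Y) :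
    (saddleMethod X Y σ κ τ α N k w₀).run A ∈ strategies X Y ∧ ∀ s ∈ strategies X Y,
      ⟪A ((saddleMethod X Y σ κ τ α N k w₀).run A),
        (saddleMethod X Y σ κ τ α N k w₀).run A - s⟫ ≤ e := by
  have hS := isCompact_strategies hX hY
  have hSc := convex_strategies hXc hYc
  have hne : (strategies X Y).Nonempty := ⟨w₀, hw₀⟩
  have hα1 : α ≤ 1 / 2 := by nlinarith
  have hmono : ∀ u ∈ strategies X Y, ∀ v ∈ strategies X Y,
      σ * ‖u - v‖ ^ 2 ≤ ⟪A u - A v, u - v⟫ := by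
    intro u hu v hv
    refine le_trans ?_ (h.monotone hu hv)
    rw [pair_norm_sq, mul_add]
    simp only [WithLp.sub_fst, WithLp.sub_snd]
    gcongr
  obtain ⟨w, hw, hsol⟩ := exists_variational_solution hS hSc hne hσ hκ hmono h.lipschitz
  have hprox := h.isRelativeProx hσ.le hσ1 hX hXc hY hYc hne hτ hκ.le hK (N := N) (hN := hN)
  have hx : proxStart w ∈ {p : PairSpace E F | p.snd ∈ Y} := hw.2
  have hpot : ∀ k : ℕ,
      ((outerStep X Y σ τ α N A)^[k] (outerStart X Y τ N A w₀)).1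
          ∈ {p : PairSpace E F | p.snd ∈ Y} ∧
      dualFun X Φ ((outerStep X Y σ τ α N A)^[k] (outerStart X Y τ N A w₀)).1
          - dualFun X Φ (proxStart w)
          + σ / 2 * ‖((outerStep X Y σ τ α N A)^[k] (outerStart X Y τ N A w₀)).2
              - proxStart w‖ ^ 2
        ≤ (1 - α) ^ k * D ^ 2 := by
    intro k
    induction k with
    | zero =>
      refine ⟨(hprox (proxStart w₀)).1, ?_⟩
      have h1 := (hprox (proxStart w₀)).initial hσ1 hσ.le hx
      have h2 : ‖proxStart w₀ - proxStart w‖ ^ 2 ≤ D ^ 2 := by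
        rw [← norm_proxStart_sub, proxStart_proxStart]
        exact pow_le_pow_left₀ (norm_nonneg _) (hD w₀ hw₀ w hw) 2
      rw [pow_zero, one_mul]
      exact h1.trans h2
    | succ k ih =>
      rw [Function.iterate_succ_apply']
      generalize (outerStep X Y σ τ α N A)^[k] (outerStart X Y τ N A w₀) = s at *
      have h1 := hprox ((1 + α)⁻¹ • (s.1 + α • s.2))
      refine ⟨h1.1, (h1.accelerated_step hα hασ hσ1 ih.1 hx).trans ?_⟩
      rw [pow_succ' (1 - α), mul_assoc]
      exact mul_le_mul_of_nonneg_left ih.2 (by linarith)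
  obtain ⟨hp, hpot⟩ := hpot k
  rw [run_saddleMethod]
  generalize (outerStep X Y σ τ α N A)^[k] (outerStart X Y τ N A w₀) = s at *
  have hu : proj (strategies X Y) (proxStart s.1) ∈ strategies X Y := (proj_spec hS hne _).1
  refine ⟨(proj_spec hS hne _).1, fun v hv => ?_⟩
  refine (gap_le_of_projection_step hS hSc hD hκ h.lipschitz (fun u hu v hv =>
    le_trans (by positivity) (hmono u hu v hv)) hw hsol hu hv).trans ?_
  have hd := norm_proj_sub_le hS hSc (proxStart s.1) hw
  rw [norm_proxStart_sub] at hd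
  have hgrow := h.dualFun_growth hσ1 hX hw hsol s.1 hp
  change dualFun X Φ (proxStart w) + σ / 2 * ‖s.1 - proxStart w‖ ^ 2 ≤ _ at hgrow
  have h2 : 0 ≤ σ / 2 * ‖s.2 - proxStart w‖ ^ 2 := by positivity
  have h3 : σ * ‖s.1 - proxStart w‖ ^ 2 ≤ 2 * ((1 - α) ^ k * D ^ 2) := by linarith
  have hD0 : 0 ≤ D := (norm_nonneg _).trans (hD w₀ hw₀ w₀ hw₀)
  refine (mul_le_mul_of_nonneg_left hd (by positivity)).trans ?_
  refine (sq_le_sq₀ (by positivity) he.le).1 ?_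
  refine le_of_mul_le_mul_left ?_ hσ
  calc σ * (3 * κ * D * ‖s.1 - proxStart w‖) ^ 2
      = 9 * κ ^ 2 * D ^ 2 * (σ * ‖s.1 - proxStart w‖ ^ 2) := by ring
    _ ≤ 9 * κ ^ 2 * D ^ 2 * (2 * ((1 - α) ^ k * D ^ 2)) := by gcongr
    _ = 18 * κ ^ 2 * D ^ 4 * (1 - α) ^ k := by ring
    _ ≤ _ := hk

end SaddleMethod

/-! ### Saddle point solvers for arbitrary moduli -/

section SaddleSolver

variable {E F : Type*} [NormedAddCommGroup E] [InnerProductSpace ℝ E]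
  [NormedAddCommGroup F] [InnerProductSpace ℝ F]
  {X : Set E} {Y : Set F} {m n K D e l : ℝ}

/-- The two players exchanged. -/
def swapPair (z : PairSpace E F) : PairSpace F E := pair z.snd z.fst

omit [InnerProductSpace ℝ E] [InnerProductSpace ℝ F] in
theorem norm_swapPair (z : PairSpace E F) : ‖swapPair z‖ = ‖z‖ := by
  refine (sq_eq_sq₀ (norm_nonneg _) (norm_nonneg _)).1 ?_
  rw [pair_norm_sq, pair_norm_sq z, add_comm]
  rfl

theorem inner_swapPair (z z' : PairSpace E F) : ⟪swapPair z, swapPair z'⟫ = ⟪z, z'⟫ := by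
  rw [pair_inner, pair_inner z, add_comm]
  rfl

omit [InnerProductSpace ℝ E] [InnerProductSpace ℝ F] in
theorem swapPair_sub (z z' : PairSpace E F) : swapPair (z - z') = swapPair z - swapPair z' :=
  rfl

omit [NormedAddCommGroup E] [InnerProductSpace ℝ E] [NormedAddCommGroup F]
  [InnerProductSpace ℝ F] in
theorem swapPair_mem {z : PairSpace E F} (hz : z ∈ strategies X Y) :
    swapPair z ∈ strategies Y X := ⟨hz.2, hz.1⟩

theorem IsSaddleField.swap {Φ : PairSpace E F → ℝ} {A : PairSpace E F → PairSpace E F}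
    (h : IsSaddleField X Y m n K Φ A) :
    IsSaddleField Y X n m K (fun z => -Φ (swapPair z)) (fun z => swapPair (A (swapPair z))) where
  lower z hz y hy := by
    have := h.upper (swapPair z) (swapPair_mem hz) y hy
    change -Φ (swapPair z) + ⟪(A (swapPair z)).snd, y - (swapPair z).snd⟫
      + n / 2 * ‖y - (swapPair z).snd‖ ^ 2 ≤ -Φ (pair (swapPair z).fst y)
    linarith
  upper z hz x hx := by
    have := h.lower (swapPair z) (swapPair_mem hz) x hx
    change -Φ (pair x (swapPair z).snd) ≤ -Φ (swapPair z)
      - ⟪(A (swapPair z)).fst, x - (swapPair z).fst⟫ - m / 2 * ‖x - (swapPair z).fst‖ ^ 2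
    linarith
  lipschitz z hz z' hz' := by
    have := h.lipschitz _ (swapPair_mem hz) _ (swapPair_mem hz')
    rw [← swapPair_sub, norm_swapPair, ← norm_swapPair (z - z'), swapPair_sub z z']
    exact this

/-- A method for saddle fields with the given moduli that needs at most
`1033 K / √(m n) * l` queries for the accuracy `e`. -/
def HasSaddleSolver (X : Set E) (Y : Set F) (m n K e l : ℝ) : Prop :=
  ∃ M : FieldMethod E F (PairSpace E F),
    ∀ (Φ : PairSpace E F → ℝ) (A : PairSpace E F → PairSpace E F),
      IsSaddleField X Y m n K Φ A →
        (M.run A ∈ strategies X Y ∧ ∀ s ∈ strategies X Y, ⟪A (M.run A), M.run A - s⟫ ≤ e) ∧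
          (M.numQueries A : ℝ) ≤ 1033 * (K / √(m * n)) * l

theorem hasSaddleSolver_normalized (hX : IsCompact X) (hXc : Convex ℝ X) (hY : IsCompact Y)
    (hYc : Convex ℝ Y) (hne : (strategies X Y).Nonempty) {σ κ : ℝ} (hσ : 0 < σ) (hσ1 : σ ≤ 1)
    (hκ : 1 ≤ κ) (hD : ∀ u ∈ strategies X Y, ∀ v ∈ strategies X Y, ‖u - v‖ ≤ D) (he : 0 < e)
    (hl1 : 1 ≤ l) (hl : 18 * κ ^ 2 * D ^ 4 ≤ σ * e ^ 2 * Real.exp l) :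
    HasSaddleSolver X Y 1 σ κ e l := by
  obtain ⟨w, hw⟩ := hne
  have hκ0 : 0 < κ := by linarith
  -- The choices are forced by the earlier estimates: α² = σ/4 for acceleration, τ(κ + 1) ≤ 1 from κ
  -- ≥ 1, τN ≥ 64 for the relative error, and αk ≥ l so that (1 - α)^k ≤ exp(-l).
  set α : ℝ := √σ / 2 with hα
  have hsσ : 0 < √σ := Real.sqrt_pos.2 hσ
  have hsσ1 : √σ ≤ 1 := Real.sqrt_le_one.2 hσ1
  have hα0 : 0 < α := by positivity
  have hασ : α ^ 2 = σ / 4 := by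
    rw [hα, div_pow, Real.sq_sqrt hσ.le]; norm_num
  set τ : ℝ := 1 / (2 * κ) with hτ
  have hτ0 : 0 < τ := by positivity
  have hK : τ * (κ + 1) ≤ 1 := by
    rw [hτ, div_mul_eq_mul_div, div_le_one (by positivity)]; linarith
  set N : ℕ := ⌈128 * κ⌉₊ with hN
  have hN1 : 128 * κ ≤ N := Nat.le_ceil _
  have hN2 : (N : ℝ) ≤ 129 * κ := by
    have := (Nat.ceil_lt_add_one (by positivity : 0 ≤ 128 * κ)).le
    linarith
  have hτN : 64 ≤ τ * N := by
    rw [hτ, div_mul_eq_mul_div, le_div_iff₀ (by positivity)]; linarith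
  set k : ℕ := ⌈l / α⌉₊ with hk
  have hk1 : l / α ≤ k := Nat.le_ceil _
  have hk2 : (k : ℝ) ≤ l / α + 1 := (Nat.ceil_lt_add_one (by positivity)).le
  have hkl : l ≤ α * k := by rwa [div_le_iff₀' hα0] at hk1
  have hpow : (1 - α) ^ k ≤ Real.exp (-l) := by
    have h1 : 1 - α ≤ Real.exp (-α) := by linarith [Real.add_one_le_exp (-α)]
    calc (1 - α) ^ k ≤ Real.exp (-α) ^ k :=
          pow_le_pow_left₀ (by rw [hα]; linarith) h1 k
      _ = Real.exp (-(α * k)) := by rw [← Real.exp_nat_mul]; ring_nf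
      _ ≤ _ := Real.exp_le_exp.2 (by linarith)
  have hkσ : 18 * κ ^ 2 * D ^ 4 * (1 - α) ^ k ≤ σ * e ^ 2 := by
    have h0 : 0 ≤ 18 * κ ^ 2 * D ^ 4 := by positivity
    calc 18 * κ ^ 2 * D ^ 4 * (1 - α) ^ k ≤ 18 * κ ^ 2 * D ^ 4 * Real.exp (-l) := by gcongr
      _ ≤ σ * e ^ 2 * Real.exp l * Real.exp (-l) := by gcongr
      _ = σ * e ^ 2 := by rw [mul_assoc, ← Real.exp_add]; simp
  refine ⟨saddleMethod X Y σ κ τ α N k w, fun Φ A h => ⟨h.saddleMethod_spec hσ hσ1 hX hXc hY hYc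
    hτ0 hκ0 hK hα0 hασ hτN hD he hkσ hw, ?_⟩⟩
  rw [numQueries_saddleMethod, one_mul]
  push_cast
  have hq : 1 ≤ l / √σ := by rw [le_div_iff₀ hsσ]; linarith
  have hk3 : (k : ℝ) + 1 ≤ 4 * (l / √σ) := by
    have : l / α = 2 * (l / √σ) := by rw [hα]; field_simp
    linarith
  -- The constant is 4 · 129 · 2 for the k + 1 proximal steps, plus 1 for the query of the final
  -- step.
  calc ((k : ℝ) + 1) * (N * 2) + 1 ≤ (4 * (l / √σ)) * (129 * κ * 2) + 1 * 1 := by gcongr; norm_num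
    _ ≤ (4 * (l / √σ)) * (129 * κ * 2) + κ * (l / √σ) := by gcongr
    _ = 1033 * (κ / √σ) * l := by ring

/-- Dividing Φ by the larger modulus m gives moduli 1 and n/m. The accuracy scales along, and
(K/m)/√(n/m) = K/√(m n). -/
theorem hasSaddleSolver_of_le (hX : IsCompact X) (hXc : Convex ℝ X) (hY : IsCompact Y)
    (hYc : Convex ℝ Y) (hne : (strategies X Y).Nonempty) (hn : 0 < n) (hnm : n ≤ m) (hmK : m ≤ K)
    (hD : ∀ u ∈ strategies X Y, ∀ v ∈ strategies X Y, ‖u - v‖ ≤ D) (he : 0 < e)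
    (hl1 : 1 ≤ l) (hl : 18 * K ^ 2 * D ^ 4 * m ≤ n * e ^ 2 * Real.exp l) :
    HasSaddleSolver X Y m n K e l := by
  have hm : 0 < m := hn.trans_le hnm
  obtain ⟨M, hM⟩ := hasSaddleSolver_normalized (σ := n / m) (κ := K / m) (e := e / m) (l := l)
    hX hXc hY hYc hne (by positivity) ((div_le_one hm).2 hnm) ((one_le_div hm).2 hmK) hD
    (by positivity) hl1 (by
      rw [show 18 * (K / m) ^ 2 * D ^ 4 = (18 * K ^ 2 * D ^ 4 * m) / m ^ 3 by field_simp,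
        show n / m * (e / m) ^ 2 * Real.exp l = (n * e ^ 2 * Real.exp l) / m ^ 3 by field_simp]
      gcongr)
  refine ⟨M.translate id (fun _ a => m⁻¹ • a) id, fun Φ A h => ?_⟩
  have h' := h.smul (inv_nonneg.2 hm.le)
  rw [inv_mul_cancel₀ hm.ne', inv_mul_eq_div, inv_mul_eq_div] at h'
  obtain ⟨⟨h1, h2⟩, h3⟩ := hM _ _ h'
  rw [QueryMethod.run_translate, QueryMethod.numQueries_translate]
  refine ⟨⟨h1, fun s hs => ?_⟩, h3.trans_eq ?_⟩
  · have h4 := h2 s hs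
    rw [real_inner_smul_left, inv_mul_eq_div] at h4
    exact (div_le_div_iff_of_pos_right hm).1 h4
  · have e1 : √(1 * (n / m)) = √(m * n) / m := by
      rw [one_mul, show n / m = (m * n) / m ^ 2 by field_simp, Real.sqrt_div' _ (by positivity),
        Real.sqrt_sq hm.le]
    rw [e1, div_div_div_cancel_right₀ hm.ne']

theorem HasSaddleSolver.of_swap (h : HasSaddleSolver Y X n m K e l) :
    HasSaddleSolver X Y m n K e l := by
  obtain ⟨M, hM⟩ := h
  refine ⟨M.translate swapPair (fun _ a => swapPair a) swapPair, fun Φ A h => ?_⟩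
  obtain ⟨⟨h1, h2⟩, h3⟩ := hM _ _ h.swap
  rw [QueryMethod.run_translate, QueryMethod.numQueries_translate, mul_comm m n]
  refine ⟨⟨swapPair_mem h1, fun s hs => ?_⟩, h3⟩
  refine le_trans (le_of_eq ?_) (h2 (swapPair s) (swapPair_mem hs))
  rw [← inner_swapPair, swapPair_sub]
  rfl

theorem hasSaddleSolver (hX : IsCompact X) (hXc : Convex ℝ X) (hY : IsCompact Y)
    (hYc : Convex ℝ Y) (hne : (strategies X Y).Nonempty) (hm : 0 < m) (hn : 0 < n) (hmK : m ≤ K)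
    (hnK : n ≤ K) (hD : ∀ u ∈ strategies X Y, ∀ v ∈ strategies X Y, ‖u - v‖ ≤ D) (he : 0 < e)
    (hl1 : 1 ≤ l)
    (hl : 18 * K ^ 2 * D ^ 4 * max m n ≤ min m n * e ^ 2 * Real.exp l) :
    HasSaddleSolver X Y m n K e l := by
  rcases le_total n m with hnm | hnm
  · rw [max_eq_left hnm, min_eq_right hnm] at hl
    exact hasSaddleSolver_of_le hX hXc hY hYc hne hn hnm hmK hD he hl1 hl
  · rw [max_eq_right hnm, min_eq_left hnm] at hl
    obtain ⟨w, hw⟩ := hne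
    refine (hasSaddleSolver_of_le hY hYc hX hXc ⟨swapPair w, swapPair_mem hw⟩ hm hnm hnK
      (fun u hu v hv => ?_) he hl1 hl).of_swap
    rw [← norm_swapPair, swapPair_sub]
    exact hD _ (swapPair_mem hu) _ (swapPair_mem hv)

end SaddleSolver

/-! ### First-order inequalities -/

section FirstOrder

variable {H : Type*} [NormedAddCommGroup H] [InnerProductSpace ℝ H] {S : Set H} {f : H → ℝ}

theorem hasDerivWithinAt_segment {v z z' : H} (hS : Convex ℝ S) (hz : z ∈ S) (hz' : z' ∈ S)
    {t : ℝ}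
    (hf : HasFDerivWithinAt f (innerSL ℝ v) S (z + t • (z' - z))) :
    HasDerivWithinAt (fun t : ℝ => f (z + t • (z' - z))) ⟪v, z' - z⟫ (Set.Icc 0 1) t := by
  have h1 : HasDerivWithinAt (fun t : ℝ => z + t • (z' - z)) (z' - z) (Set.Icc 0 1) t := by
    simpa using ((hasDerivWithinAt_id t (Set.Icc (0 : ℝ) 1)).smul_const (z' - z)).const_add z
  have h2 : Set.MapsTo (fun t : ℝ => z + t • (z' - z)) (Set.Icc 0 1) S :=
    fun s hs => hS.add_smul_sub_mem hz hz' hs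
  exact hf.comp_hasDerivWithinAt t h1 h2

/-- The gradient inequality, with a modulus of convexity along the segment. -/
theorem add_inner_add_le_of_convex_segment {v z z' : H} (hS : Convex ℝ S) (hz : z ∈ S)
    (hz' : z' ∈ S) (hf : HasFDerivWithinAt f (innerSL ℝ v) S z) {c : ℝ}
    (hc : ∀ t ∈ Set.Ioo (0 : ℝ) 1,
      f (z + t • (z' - z)) ≤ (1 - t) * f z + t * f z' - t * (1 - t) * c) :
    f z + ⟪v, z' - z⟫ + c ≤ f z' := by
  have h1 := hasDerivWithinAt_segment hS hz hz' (t := 0) (by simpa using hf)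
  -- Only the one-sided derivative along the segment is used, since S may have empty interior. The
  -- bound on the difference quotient by f z' - f z - (1 - t)c passes to the limit t → 0.
  have h2 : HasDerivWithinAt (fun t : ℝ => f (z + t • (z' - z))) ⟪v, z' - z⟫ (Set.Ioi 0) 0 :=
    (h1.mono (Set.Ioo_subset_Icc_self)).Ioi_of_Ioo zero_lt_one
  rw [hasDerivWithinAt_iff_tendsto_slope' (by simp)] at h2
  have h3 : Filter.Tendsto (fun t : ℝ => f z' - f z - (1 - t) * c) (nhdsWithin 0 (Set.Ioi 0))
      (nhds (f z' - f z - (1 - 0) * c)) := by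
    apply tendsto_nhdsWithin_of_tendsto_nhds
    exact Continuous.tendsto (by fun_prop) 0
  have h4 := le_of_tendsto_of_tendsto h2 h3 (by
    filter_upwards [Ioo_mem_nhdsGT (zero_lt_one' ℝ)] with t ht
    rw [slope_def_field, sub_zero, zero_smul, add_zero, div_le_iff₀ ht.1]
    have := hc t ht
    linarith)
  linarith

/-- The descent inequality for a smooth function on a convex set. -/
theorem le_add_inner_add_of_smooth {G : H → H} {K : ℝ} (hS : Convex ℝ S)
    (hf : ∀ z ∈ S, HasFDerivWithinAt f (innerSL ℝ (G z)) S z)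
    (hG : ∀ z ∈ S, ∀ z' ∈ S, ‖G z' - G z‖ ≤ K * ‖z' - z‖) {z z' : H} (hz : z ∈ S) (hz' : z' ∈ S) :
    f z' ≤ f z + ⟪G z, z' - z⟫ + K / 2 * ‖z' - z‖ ^ 2 := by
  have hmem : ∀ t ∈ Set.Icc (0 : ℝ) 1, z + t • (z' - z) ∈ S :=
    fun t ht => hS.add_smul_sub_mem hz hz' ht
  have h1 : ∀ t ∈ Set.Icc (0 : ℝ) 1, HasDerivWithinAt
      (fun t : ℝ => f (z + t • (z' - z)) - t * ⟪G z, z' - z⟫ - t ^ 2 * (K / 2 * ‖z' - z‖ ^ 2))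
      (⟪G (z + t • (z' - z)), z' - z⟫ - ⟪G z, z' - z⟫ - 2 * t * (K / 2 * ‖z' - z‖ ^ 2))
      (Set.Icc 0 1) t := by
    intro t ht
    have h2 := hasDerivWithinAt_segment hS hz hz' (hf _ (hmem t ht))
    have h3 : HasDerivWithinAt (fun t : ℝ => t * ⟪G z, z' - z⟫) ⟪G z, z' - z⟫ (Set.Icc 0 1) t := by
      simpa using (hasDerivWithinAt_id t (Set.Icc (0 : ℝ) 1)).mul_const ⟪G z, z' - z⟫
    have h4 : HasDerivWithinAt (fun t : ℝ => t ^ 2 * (K / 2 * ‖z' - z‖ ^ 2))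
        (2 * t * (K / 2 * ‖z' - z‖ ^ 2)) (Set.Icc 0 1) t := by
      simpa using ((hasDerivAt_pow 2 t).mul_const (K / 2 * ‖z' - z‖ ^ 2)).hasDerivWithinAt
    exact (h2.sub h3).sub h4
  -- By the Lipschitz bound on the gradient, f along the segment minus its quadratic upper model has
  -- nonpositive derivative; comparing the endpoints gives the claim.
  have h2 : AntitoneOn (fun t : ℝ => f (z + t • (z' - z)) - t * ⟪G z, z' - z⟫
      - t ^ 2 * (K / 2 * ‖z' - z‖ ^ 2)) (Set.Icc 0 1) := by
    refine antitoneOn_of_hasDerivWithinAt_nonpos (convex_Icc 0 1)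
      (fun t ht => (h1 t ht).continuousWithinAt)
      (fun t ht => (h1 t (interior_subset ht)).mono interior_subset) fun t ht => ?_
    have ht' := interior_subset ht
    have h3 := real_inner_le_norm (G (z + t • (z' - z)) - G z) (z' - z)
    have h4 := hG z hz _ (hmem t ht')
    rw [add_sub_cancel_left, norm_smul, Real.norm_eq_abs, abs_of_nonneg ht'.1] at h4
    rw [inner_sub_left] at h3
    nlinarith [norm_nonneg (z' - z)]
  have h3 := h2 (Set.left_mem_Icc.2 zero_le_one) (Set.right_mem_Icc.2 zero_le_one) zero_le_one
  simp only [one_smul, zero_smul, add_zero, add_sub_cancel] at h3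
  linarith

end FirstOrder

/-! ### The saddle fields of a game -/

section GameFields

variable {E F : Type*} [NormedAddCommGroup E] [InnerProductSpace ℝ E]
  [NormedAddCommGroup F] [InnerProductSpace ℝ F]
  {X : Set E} {Y : Set F} {m n K L δ μ ν : ℝ} {Φ : PairSpace E F → ℝ}
  {A : PairSpace E F → PairSpace E F} {Γ : Game E F}

/-- The vector `z` with the sign of the second component changed. -/
def flipSnd (z : PairSpace E F) : PairSpace E F := pair z.fst (-z.snd)

omit [InnerProductSpace ℝ E] [InnerProductSpace ℝ F] in
theorem norm_flipSnd (z : PairSpace E F) : ‖flipSnd z‖ = ‖z‖ := by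
  refine (sq_eq_sq₀ (norm_nonneg _) (norm_nonneg _)).1 ?_
  rw [pair_norm_sq, pair_norm_sq z, flipSnd, fst_pair, snd_pair, norm_neg]

omit [InnerProductSpace ℝ E] [InnerProductSpace ℝ F] in
theorem flipSnd_sub (z z' : PairSpace E F) : flipSnd (z - z') = flipSnd z - flipSnd z' := by
  apply pair_ext
  · simp only [flipSnd, WithLp.sub_fst, fst_pair]
  · simp only [flipSnd, WithLp.sub_snd, snd_pair]
    abel

theorem norm_pair_smul_le {p q c : ℝ} (hp : 0 ≤ p) (hq : 0 ≤ q) (hpc : p ≤ c) (hqc : q ≤ c)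
    (z : PairSpace E F) : ‖pair (p • z.fst) (q • z.snd)‖ ≤ c * ‖z‖ := by
  have hc : 0 ≤ c := hp.trans hpc
  refine (sq_le_sq₀ (norm_nonneg _) (by positivity)).1 ?_
  rw [mul_pow, pair_norm_sq, pair_norm_sq z, fst_pair, snd_pair, norm_smul, norm_smul, mul_pow,
    mul_pow, Real.norm_eq_abs, Real.norm_eq_abs, sq_abs, sq_abs, mul_add]
  gcongr

/-- Adding a separable quadratic and a linear term to a saddle function. -/
theorem IsSaddleField.add_quadratic (h : IsSaddleField X Y m n K Φ A) {p q c : ℝ} (hp : 0 ≤ p)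
    (hq : 0 ≤ q) (hpc : 2 * p ≤ c) (hqc : 2 * q ≤ c) (w g : PairSpace E F) :
    IsSaddleField X Y (m + 2 * p) (n + 2 * q) (K + c)
      (fun z => Φ z + p * ‖z.fst - w.fst‖ ^ 2 - q * ‖z.snd - w.snd‖ ^ 2
        + ⟪g.fst, z.fst⟫ - ⟪g.snd, z.snd⟫)
      (fun z => A z + pair ((2 * p) • (z.fst - w.fst)) ((2 * q) • (z.snd - w.snd)) + g) where
  lower z hz x hx := by
    have h1 := h.lower z hz x hx
    have e : ‖x - w.fst‖ ^ 2 = ‖z.fst - w.fst‖ ^ 2 + 2 * ⟪z.fst - w.fst, x - z.fst⟫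
        + ‖x - z.fst‖ ^ 2 := by
      rw [← norm_add_sq_real]; congr 2; abel
    simp only [WithLp.add_fst, fst_pair, snd_pair, inner_add_left, real_inner_smul_left]
    rw [e, inner_sub_right g.fst]
    linarith
  upper z hz y hy := by
    have h1 := h.upper z hz y hy
    have e : ‖y - w.snd‖ ^ 2 = ‖z.snd - w.snd‖ ^ 2 + 2 * ⟪z.snd - w.snd, y - z.snd⟫
        + ‖y - z.snd‖ ^ 2 := by
      rw [← norm_add_sq_real]; congr 2; abel
    simp only [WithLp.add_snd, fst_pair, snd_pair, inner_add_left, real_inner_smul_left]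
    rw [e, inner_sub_right g.snd]
    linarith
  lipschitz z hz z' hz' := by
    have e : A z + pair ((2 * p) • (z.fst - w.fst)) ((2 * q) • (z.snd - w.snd)) + g
        - (A z' + pair ((2 * p) • (z'.fst - w.fst)) ((2 * q) • (z'.snd - w.snd)) + g)
        = (A z - A z') + pair ((2 * p) • (z - z').fst) ((2 * q) • (z - z').snd) := by
      apply pair_ext
      · simp only [WithLp.add_fst, WithLp.sub_fst, fst_pair]
        module
      · simp only [WithLp.add_snd, WithLp.sub_snd, snd_pair]
        module
    rw [e, add_mul]
    exact (norm_add_le _ _).trans (add_le_add (h.lipschitz z hz z' hz')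
      (norm_pair_smul_le (by positivity) (by positivity) hpc hqc _))

/-- The field `(∇ₓ h, -∇_y h)` of the zero-sum part. -/
def Game.saddleField (Γ : Game E F) (z : PairSpace E F) : PairSpace E F := flipSnd (Γ.gradh z)

theorem IsMonotoneNearZeroSum.hasFDerivWithinAt_h (h : IsMonotoneNearZeroSum X Y L δ μ ν Γ)
    {z : PairSpace E F} (hz : z ∈ strategies X Y) :
    HasFDerivWithinAt Γ.h (innerSL ℝ (Γ.gradh z)) (strategies X Y) z := by
  have h1 := ((h.smooth₁.1 z hz).neg.add (h.smooth₂.1 z hz)).const_smul (1 / 2 : ℝ)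
  have e : innerSL ℝ (Γ.gradh z)
      = (1 / 2 : ℝ) • (-innerSL ℝ (Γ.grad₁ z) + innerSL ℝ (Γ.grad₂ z)) := by
    rw [Game.gradh, map_smul, map_add, map_neg]
  rw [e]
  exact h1

theorem IsMonotoneNearZeroSum.norm_gradh_sub_le (h : IsMonotoneNearZeroSum X Y L δ μ ν Γ)
    {z z' : PairSpace E F} (hz : z ∈ strategies X Y) (hz' : z' ∈ strategies X Y) :
    ‖Γ.gradh z - Γ.gradh z'‖ ≤ L * ‖z - z'‖ := by
  have h1 := h.smooth₁.2 z' hz' z hz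
  have h2 := h.smooth₂.2 z' hz' z hz
  have e : Γ.gradh z - Γ.gradh z'
      = (1 / 2 : ℝ) • ((Γ.grad₂ z - Γ.grad₂ z') - (Γ.grad₁ z - Γ.grad₁ z')) := by
    rw [Game.gradh, Game.gradh]; module
  rw [e, norm_smul]
  have h3 := norm_sub_le (Γ.grad₂ z - Γ.grad₂ z') (Γ.grad₁ z - Γ.grad₁ z')
  norm_num
  linarith

theorem IsMonotoneNearZeroSum.isSaddleField_h (h : IsMonotoneNearZeroSum X Y L δ μ ν Γ)
    (hX : Convex ℝ X) (hY : Convex ℝ Y) :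
    IsSaddleField X Y μ ν L Γ.h Γ.saddleField where
  lower z hz x hx := by
    have hz' : pair x z.snd ∈ strategies X Y := ⟨hx, hz.2⟩
    have h1 := add_inner_add_le_of_convex_segment (c := μ / 2 * ‖x - z.fst‖ ^ 2)
      (convex_strategies hX hY) hz hz' (h.hasFDerivWithinAt_h hz) (fun t ht => by
        have h2 := (h.convex_h z.snd hz.2).2 hz.1 hx (sub_nonneg.2 ht.2.le) ht.1.le
          (sub_add_cancel 1 t)
        have e1 : (1 - t) • z.fst + t • x = z.fst + t • (x - z.fst) := by module
        have e2 : z + t • (pair x z.snd - z) = pair (z.fst + t • (x - z.fst)) z.snd := by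
          apply pair_ext
          · rfl
          · simp only [WithLp.add_snd, WithLp.smul_snd, WithLp.sub_snd, snd_pair, sub_self,
              smul_zero, add_zero]
        have e3 : ‖x‖ ^ 2 = ‖z.fst‖ ^ 2 + 2 * ⟪z.fst, x - z.fst⟫ + ‖x - z.fst‖ ^ 2 := by
          rw [← norm_add_sq_real]; congr 2; abel
        rw [e1] at h2
        dsimp only at h2
        rw [norm_add_sq_real, e3, real_inner_smul_right, norm_smul, mul_pow,
          Real.norm_eq_abs, sq_abs, smul_eq_mul, smul_eq_mul, pair_fst_snd] at h2
        rw [e2]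
        linarith)
    rw [pair_inner] at h1
    simp only [WithLp.sub_fst, WithLp.sub_snd, fst_pair, snd_pair, sub_self, inner_zero_right,
      add_zero] at h1
    exact h1
  upper z hz y hy := by
    have hz' : pair z.fst y ∈ strategies X Y := ⟨hz.1, hy⟩
    have hd : HasFDerivWithinAt (fun z => -Γ.h z) (innerSL ℝ (-Γ.gradh z)) (strategies X Y) z := by
      rw [map_neg]
      exact (h.hasFDerivWithinAt_h hz).neg
    have h1 := add_inner_add_le_of_convex_segment (c := ν / 2 * ‖y - z.snd‖ ^ 2)
      (convex_strategies hX hY) hz hz' hd (fun t ht => by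
        have h2 := (h.concave_h z.fst hz.1).2 hz.2 hy (sub_nonneg.2 ht.2.le) ht.1.le
          (sub_add_cancel 1 t)
        have e1 : (1 - t) • z.snd + t • y = z.snd + t • (y - z.snd) := by module
        have e2 : z + t • (pair z.fst y - z) = pair z.fst (z.snd + t • (y - z.snd)) := by
          apply pair_ext
          · simp only [WithLp.add_fst, WithLp.smul_fst, WithLp.sub_fst, fst_pair, sub_self,
              smul_zero, add_zero]
          · rfl
        have e3 : ‖y‖ ^ 2 = ‖z.snd‖ ^ 2 + 2 * ⟪z.snd, y - z.snd⟫ + ‖y - z.snd‖ ^ 2 := by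
          rw [← norm_add_sq_real]; congr 2; abel
        rw [e1] at h2
        dsimp only at h2
        rw [norm_add_sq_real, e3, real_inner_smul_right, norm_smul, mul_pow,
          Real.norm_eq_abs, sq_abs, smul_eq_mul, smul_eq_mul, pair_fst_snd] at h2
        rw [e2]
        linarith)
    rw [pair_inner] at h1
    simp only [WithLp.sub_fst, WithLp.sub_snd, WithLp.neg_snd, fst_pair, snd_pair, sub_self,
      inner_zero_right, zero_add, inner_neg_left] at h1
    simp only [Game.saddleField, flipSnd, snd_pair, inner_neg_left]
    linarith
  lipschitz z hz z' hz' := by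
    rw [Game.saddleField, Game.saddleField, ← flipSnd_sub, norm_flipSnd]
    exact h.norm_gradh_sub_le hz hz'

theorem IsMonotoneNearZeroSum.g_add_inner_le (h : IsMonotoneNearZeroSum X Y L δ μ ν Γ)
    (hX : Convex ℝ X) (hY : Convex ℝ Y) {z z' : PairSpace E F} (hz : z ∈ strategies X Y)
    (hz' : z' ∈ strategies X Y) : Γ.g z + ⟪Γ.gradg z, z' - z⟫ ≤ Γ.g z' := by
  have h1 := add_inner_add_le_of_convex_segment (c := 0) (convex_strategies hX hY) hz hz'
    (h.smooth_g.1 z hz) (fun t ht => by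
      have h2 := h.convex_g.2 hz hz' (sub_nonneg.2 ht.2.le) ht.1.le (sub_add_cancel 1 t)
      have e1 : (1 - t) • z + t • z' = z + t • (z' - z) := by module
      rw [e1, smul_eq_mul, smul_eq_mul] at h2
      linarith)
  linarith

theorem IsMonotoneNearZeroSum.g_le (h : IsMonotoneNearZeroSum X Y L δ μ ν Γ)
    (hX : Convex ℝ X) (hY : Convex ℝ Y) {z z' : PairSpace E F} (hz : z ∈ strategies X Y)
    (hz' : z' ∈ strategies X Y) :
    Γ.g z' ≤ Γ.g z + ⟪Γ.gradg z, z' - z⟫ + δ / 2 * ‖z' - z‖ ^ 2 :=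
  le_add_inner_add_of_smooth (convex_strategies hX hY) h.smooth_g.1 h.smooth_g.2 hz hz'

end GameFields

/-! ### Parameters -/

namespace Params

/-- The standing assumptions on the parameters. -/
structure Admissible (P : Params) : Prop where
  L_pos : 0 < P.L
  δ_mem : P.δ ∈ Set.Icc 0 P.L
  μ_mem : P.μ ∈ Set.Icc 0 P.L
  ν_mem : P.ν ∈ Set.Icc 0 P.L
  DX_pos : 0 < P.DX
  DY_pos : 0 < P.DY
  ε_pos : 0 < P.ε

/-- The smaller one of the two moduli of the regularized game. -/
def m (P : Params) : ℝ := min P.μbar P.νbar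

variable {P : Params}

theorem μ_add_two_mul_a (P : Params) : P.μ + 2 * P.a = P.μbar := by
  rw [μbar, a, mul_min_of_nonneg _ _ zero_le_two]
  congr 2 <;> ring

theorem ν_add_two_mul_b (P : Params) : P.ν + 2 * P.b = P.νbar := by
  rw [νbar, b, mul_min_of_nonneg _ _ zero_le_two]
  congr 2 <;> ring

theorem two_mul_a_le (P : Params) : 2 * P.a ≤ P.L := by
  have : P.a ≤ P.L / 2 := min_le_right _ _
  linarith

theorem two_mul_b_le (P : Params) : 2 * P.b ≤ P.L := by
  have : P.b ≤ P.L / 2 := min_le_right _ _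
  linarith

theorem inv_η (P : Params) : P.η⁻¹ = max P.δ P.m := by
  rw [η, one_div, inv_inv, m]

theorem DX_le_D (P : Params) : P.DX ≤ P.D :=
  Real.le_sqrt_of_sq_le (le_add_of_nonneg_right (sq_nonneg _))

theorem DY_le_D (P : Params) : P.DY ≤ P.D :=
  Real.le_sqrt_of_sq_le (le_add_of_nonneg_left (sq_nonneg _))

theorem θ_eq (P : Params) : P.θ = P.m / (P.η⁻¹ + P.m) := rfl

theorem innerAccuracy_eq (P : Params) : P.innerAccuracy = P.θ * P.accuracy * P.η⁻¹ / 4 := by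
  rw [innerAccuracy]
  field_simp

theorem inv_γ (P : Params) : P.γ⁻¹ = 2 * √2 * P.L := by
  rw [γ, one_div, inv_inv]
  ring

namespace Admissible

variable (hP : P.Admissible)
include hP

theorem a_pos : 0 < P.a := by
  have h1 := hP.L_pos
  have h2 := hP.DX_pos
  have h3 := hP.ε_pos
  exact lt_min (by positivity) (by positivity)

theorem b_pos : 0 < P.b := by
  have h1 := hP.L_pos
  have h2 := hP.DY_pos
  have h3 := hP.ε_pos
  exact lt_min (by positivity) (by positivity)

theorem μbar_pos : 0 < P.μbar := by
  rw [← μ_add_two_mul_a]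
  have h1 := hP.a_pos
  have h2 := hP.μ_mem.1
  positivity

theorem νbar_pos : 0 < P.νbar := by
  rw [← ν_add_two_mul_b]
  have h1 := hP.b_pos
  have h2 := hP.ν_mem.1
  positivity

theorem μbar_le : P.μbar ≤ 2 * P.L := by
  rw [← μ_add_two_mul_a]
  have h1 := two_mul_a_le P
  have h2 := hP.μ_mem.2
  linarith

theorem νbar_le : P.νbar ≤ 2 * P.L := by
  rw [← ν_add_two_mul_b]
  have h1 := two_mul_b_le P
  have h2 := hP.ν_mem.2
  linarith

theorem m_pos : 0 < P.m := lt_min hP.μbar_pos hP.νbar_pos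

theorem m_le : P.m ≤ 2 * P.L := (min_le_left _ _).trans hP.μbar_le

theorem inv_η_pos : 0 < P.η⁻¹ := by
  rw [P.inv_η]
  exact lt_max_of_lt_right hP.m_pos

theorem inv_η_le : P.η⁻¹ ≤ 2 * P.L := by
  rw [P.inv_η]
  have h1 := hP.L_pos
  exact max_le (hP.δ_mem.2.trans (by linarith)) hP.m_le

theorem D_pos : 0 < P.D := by
  have h1 := hP.DX_pos
  exact Real.sqrt_pos.2 (by positivity)

theorem accuracy_pos : 0 < P.accuracy := by
  have h1 := hP.L_pos
  have h2 := hP.D_pos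
  have h3 := hP.ε_pos
  rw [accuracy]
  positivity

theorem θ_pos : 0 < P.θ := by
  have h1 := hP.m_pos
  have h2 := hP.inv_η_pos
  rw [P.θ_eq]
  positivity

theorem θ_lt_one : P.θ < 1 := by
  have h1 := hP.m_pos
  have h2 := hP.inv_η_pos
  rw [P.θ_eq, div_lt_one (by positivity)]
  linarith

theorem innerAccuracy_pos : 0 < P.innerAccuracy := by
  have h1 := hP.θ_pos
  have h2 := hP.accuracy_pos
  have h3 := hP.inv_η_pos
  rw [P.innerAccuracy_eq]
  positivity

theorem γ_pos : 0 < P.γ := by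
  have h1 := hP.L_pos
  rw [γ]
  positivity

end Admissible

end Params

/-! ### The regularized game -/

section Reduced

variable {E F : Type*} [NormedAddCommGroup E] [InnerProductSpace ℝ E]
  [NormedAddCommGroup F] [InnerProductSpace ℝ F]
  {X : Set E} {Y : Set F} {P : Params} {Γ : Game E F} {z₀ : PairSpace E F}

omit [InnerProductSpace ℝ E] [InnerProductSpace ℝ F] in
theorem norm_sub_le_D (hX : IsCompact X) (hY : IsCompact Y) (hDX : Metric.diam X ≤ P.DX)
    (hDY : Metric.diam Y ≤ P.DY) {u v : PairSpace E F} (hu : u ∈ strategies X Y)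
    (hv : v ∈ strategies X Y) : ‖u - v‖ ≤ P.D := by
  refine Real.le_sqrt_of_sq_le ?_
  rw [pair_norm_sq]
  have h1 := (Metric.dist_le_diam_of_mem hX.isBounded hu.1 hv.1).trans hDX
  have h2 := (Metric.dist_le_diam_of_mem hY.isBounded hu.2 hv.2).trans hDY
  rw [dist_eq_norm] at h1 h2
  exact add_le_add (pow_le_pow_left₀ (norm_nonneg _) h1 2) (pow_le_pow_left₀ (norm_nonneg _) h2 2)

theorem gradg_reduced (Γ : Game E F) (P : Params) (z₀ z : PairSpace E F) :
    (Γ.reduced P z₀).gradg z = Γ.gradg z := by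
  simp only [Game.gradg, Game.reduced, Game.regularize]
  congr 1
  abel

theorem gradh_reduced (Γ : Game E F) (P : Params) (z₀ z : PairSpace E F) :
    (Γ.reduced P z₀).gradh z = Γ.gradh z - regGrad P.a P.b z₀ z := by
  simp only [Game.gradh, Game.reduced, Game.regularize]
  module

theorem isSaddleField_reduced (hP : P.Admissible)
    (hΓ : IsMonotoneNearZeroSum X Y P.L P.δ P.μ P.ν Γ) (hX : Convex ℝ X) (hY : Convex ℝ Y)
    (z₀ : PairSpace E F) :
    IsSaddleField X Y P.μbar P.νbar (2 * P.L) (Γ.reduced P z₀).h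
      (Γ.reduced P z₀).saddleField := by
  have h := (hΓ.isSaddleField_h hX hY).add_quadratic hP.a_pos.le hP.b_pos.le P.two_mul_a_le
    P.two_mul_b_le z₀ 0
  rw [P.μ_add_two_mul_a, P.ν_add_two_mul_b, ← two_mul] at h
  convert h using 1
  · funext z
    simp only [Game.h, Game.reduced, Game.regularize, WithLp.zero_fst, WithLp.zero_snd,
      inner_zero_left]
    ring
  · funext z
    rw [Game.saddleField, Game.saddleField, gradh_reduced, flipSnd_sub, add_zero, sub_eq_add_neg]
    congr 1
    apply pair_ext
    · simp only [WithLp.neg_fst, flipSnd, regGrad, fst_pair]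
      module
    · simp only [WithLp.neg_snd, flipSnd, regGrad, snd_pair]
      module

theorem flipSnd_subproblemGrad (Γ : Game E F) (P : Params) (z₀ w z : PairSpace E F) :
    flipSnd (subproblemGrad (Γ.reduced P z₀) P.η w z)
      = (Γ.reduced P z₀).saddleField z + P.η⁻¹ • (z - w) + Γ.gradg w := by
  rw [← gradg_reduced Γ P z₀, Game.saddleField]
  generalize (Γ.reduced P z₀) = R
  apply pair_ext
  · simp only [flipSnd, subproblemGrad, WithLp.add_fst, WithLp.sub_fst, WithLp.smul_fst, fst_pair,
      one_div]
    abel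
  · simp only [flipSnd, subproblemGrad, WithLp.add_snd, WithLp.sub_snd, WithLp.smul_snd, snd_pair,
      one_div]
    abel

theorem isSaddleField_subproblem (hP : P.Admissible)
    (hΓ : IsMonotoneNearZeroSum X Y P.L P.δ P.μ P.ν Γ) (hX : Convex ℝ X) (hY : Convex ℝ Y)
    (z₀ w : PairSpace E F) :
    IsSaddleField X Y (P.μbar + P.η⁻¹) (P.νbar + P.η⁻¹) (4 * P.L)
      (subproblem (Γ.reduced P z₀) P.η w)
      (fun z => flipSnd (subproblemGrad (Γ.reduced P z₀) P.η w z)) := by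
  have h0 := hP.inv_η_pos.le
  have e2 : 2 * (P.η⁻¹ / 2) = P.η⁻¹ := by ring
  have h := ((isSaddleField_reduced hP hΓ hX hY z₀).add_quadratic (p := P.η⁻¹ / 2)
    (q := P.η⁻¹ / 2) (c := 2 * P.L) (by positivity) (by positivity) (e2.trans_le hP.inv_η_le)
    (e2.trans_le hP.inv_η_le) w ((Γ.reduced P z₀).gradg w))
  rw [e2, ← add_mul, show (2 + 2 : ℝ) = 4 by norm_num] at h
  convert h using 1
  · funext z
    rw [subproblem, show 1 / (2 * P.η) = P.η⁻¹ / 2 by rw [one_div, mul_inv]; ring]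
    ring
  · funext z
    rw [flipSnd_subproblemGrad, gradg_reduced]
    rfl

theorem isInexactSolution_iff (R : Game E F) (η e : ℝ) (w z : PairSpace E F) :
    IsInexactSolution X Y R η e w z ↔ z ∈ strategies X Y ∧
      ∀ s ∈ strategies X Y, ⟪flipSnd (subproblemGrad R η w z), z - s⟫ ≤ e := by
  have key : ∀ s : PairSpace E F, ⟪flipSnd (subproblemGrad R η w z), z - s⟫
      = ⟪(subproblemGrad R η w z).fst, z.fst - s.fst⟫
        - ⟪(subproblemGrad R η w z).snd, z.snd - s.snd⟫ := by
    intro s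
    rw [pair_inner]
    simp only [flipSnd, fst_pair, snd_pair, inner_neg_left, WithLp.sub_fst, WithLp.sub_snd]
    ring
  refine and_congr_right fun _ => ⟨fun h s hs => ?_, fun h x hx y hy => ?_⟩
  · rw [key]
    exact h _ hs.1 _ hs.2
  · have := h (pair x y) ⟨hx, hy⟩
    rwa [key] at this

/-! ### Convergence of ICL -/

/-- The monotone operator whose variational inequality characterizes the Nash equilibria of the
regularized game. -/
def nashField (R : Game E F) (z : PairSpace E F) : PairSpace E F := R.gradg z + R.saddleField z

/-- Convexity of g makes its gradient monotone, by adding the gradient inequalities in both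
directions; the regularized zero-sum part contributes the modulus. -/
theorem nashField_monotone (hP : P.Admissible)
    (hΓ : IsMonotoneNearZeroSum X Y P.L P.δ P.μ P.ν Γ) (hX : Convex ℝ X) (hY : Convex ℝ Y)
    (z₀ : PairSpace E F) : ∀ u ∈ strategies X Y, ∀ v ∈ strategies X Y,
      P.m * ‖u - v‖ ^ 2
        ≤ ⟪nashField (Γ.reduced P z₀) u - nashField (Γ.reduced P z₀) v, u - v⟫ := by
  intro u hu v hv
  have h1 := (isSaddleField_reduced hP hΓ hX hY z₀).monotone hu hv
  have h2 := hΓ.g_add_inner_le hX hY hu hv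
  have h3 := hΓ.g_add_inner_le hX hY hv hu
  rw [nashField, nashField, add_sub_add_comm, inner_add_left, gradg_reduced, gradg_reduced,
    inner_sub_left, pair_norm_sq, mul_add]
  rw [← neg_sub u v, inner_neg_right] at h2
  have h4 : P.m * ‖(u - v).fst‖ ^ 2 ≤ P.μbar * ‖u.fst - v.fst‖ ^ 2 :=
    mul_le_mul_of_nonneg_right (min_le_left _ _) (sq_nonneg _)
  have h5 : P.m * ‖(u - v).snd‖ ^ 2 ≤ P.νbar * ‖u.snd - v.snd‖ ^ 2 :=
    mul_le_mul_of_nonneg_right (min_le_right _ _) (sq_nonneg _)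
  linarith

theorem exists_nash (hP : P.Admissible) (hΓ : IsMonotoneNearZeroSum X Y P.L P.δ P.μ P.ν Γ)
    (hX : IsCompact X) (hXc : Convex ℝ X) (hY : IsCompact Y) (hYc : Convex ℝ Y)
    (hne : (strategies X Y).Nonempty) (z₀ : PairSpace E F) :
    ∃ w ∈ strategies X Y, ∀ s ∈ strategies X Y, 0 ≤ ⟪nashField (Γ.reduced P z₀) w, s - w⟫ := by
  refine exists_variational_solution (K := P.δ + 2 * P.L) (isCompact_strategies hX hY)
    (convex_strategies hXc hYc) hne hP.m_pos ?_ (nashField_monotone hP hΓ hXc hYc z₀)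
    fun u hu v hv => ?_
  · have h1 := hP.L_pos
    have h2 := hP.δ_mem.1
    positivity
  · rw [nashField, nashField, add_sub_add_comm, gradg_reduced, gradg_reduced, add_mul]
    exact (norm_add_le _ _).trans (add_le_add (hΓ.smooth_g.2 v hv u hu)
      ((isSaddleField_reduced hP hΓ hXc hYc z₀).lipschitz u hu v hv))

/-- The optimality condition of the subproblem is tested at the equilibrium w and that of w at z'.
Strong monotonicity compares the zero-sum parts, and the three inequalities for g compare the frozen
gradient at z with the gradient at w. -/
theorem icl_step (hP : P.Admissible) (hΓ : IsMonotoneNearZeroSum X Y P.L P.δ P.μ P.ν Γ)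
    (hX : Convex ℝ X) (hY : Convex ℝ Y) {w z z' : PairSpace E F} {e : ℝ}
    (hw : w ∈ strategies X Y)
    (hsol : ∀ s ∈ strategies X Y, 0 ≤ ⟪nashField (Γ.reduced P z₀) w, s - w⟫)
    (hz : z ∈ strategies X Y) (hz' : IsInexactSolution X Y (Γ.reduced P z₀) P.η e z z') :
    (P.η⁻¹ + 2 * P.m) * ‖z' - w‖ ^ 2 ≤ P.η⁻¹ * ‖z - w‖ ^ 2 + 2 * e := by
  rw [isInexactSolution_iff] at hz'
  obtain ⟨hz'S, hz'⟩ := hz'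
  have h1 := hz' w hw
  have h2 := hsol z' hz'S
  rw [flipSnd_subproblemGrad, inner_add_left, inner_add_left, real_inner_smul_left] at h1
  rw [nashField, inner_add_left, gradg_reduced] at h2
  have h3 := (isSaddleField_reduced hP hΓ hX hY z₀).monotone hz'S hw
  rw [inner_sub_left] at h3
  have h4 : P.m * ‖(z' - w).fst‖ ^ 2 ≤ P.μbar * ‖z'.fst - w.fst‖ ^ 2 :=
    mul_le_mul_of_nonneg_right (min_le_left _ _) (sq_nonneg _)
  have h5 : P.m * ‖(z' - w).snd‖ ^ 2 ≤ P.νbar * ‖z'.snd - w.snd‖ ^ 2 :=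
    mul_le_mul_of_nonneg_right (min_le_right _ _) (sq_nonneg _)
  have h6 := hΓ.g_le hX hY hz hz'S
  have h7 := hΓ.g_add_inner_le hX hY hz hw
  have h8 := hΓ.g_add_inner_le hX hY hw hz'S
  have h9 : ⟪Γ.gradg z, z' - w⟫ = ⟪Γ.gradg z, z' - z⟫ - ⟪Γ.gradg z, w - z⟫ := by
    rw [← inner_sub_right]; congr 1; abel
  -- This is where the step size matters: the linearization error is dominated by the proximal term
  -- in ‖z' - z‖².
  have h10 : P.δ * ‖z' - z‖ ^ 2 ≤ P.η⁻¹ * ‖z' - z‖ ^ 2 := by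
    rw [P.inv_η]
    exact mul_le_mul_of_nonneg_right (le_max_left _ _) (sq_nonneg _)
  have h11 : 2 * ⟪z' - z, z' - w⟫ = ‖z' - z‖ ^ 2 + ‖z' - w‖ ^ 2 - ‖z - w‖ ^ 2 := by
    rw [show z - w = (z' - w) - (z' - z) by abel, norm_sub_sq_real (z' - w),
      real_inner_comm (z' - z)]
    ring
  have h12 : P.η⁻¹ * ⟪z' - z, z' - w⟫
      = P.η⁻¹ * (‖z' - z‖ ^ 2 + ‖z' - w‖ ^ 2 - ‖z - w‖ ^ 2) / 2 := by
    rw [← h11]; ring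
  have h13 := pair_norm_sq (z' - w)
  have h14 : P.m * ‖z' - w‖ ^ 2 = P.m * ‖(z' - w).fst‖ ^ 2 + P.m * ‖(z' - w).snd‖ ^ 2 := by
    rw [h13]; ring
  linarith

/-- The recursion is solved with ε'/2 as the accumulated inexactness; the number of iterations makes
the geometric part at most ε'/2 as well. -/
theorem icl_convergence (hP : P.Admissible) (hΓ : IsMonotoneNearZeroSum X Y P.L P.δ P.μ P.ν Γ)
    (hX : IsCompact X) (hXc : Convex ℝ X) (hY : IsCompact Y) (hYc : Convex ℝ Y)
    (hDX : Metric.diam X ≤ P.DX) (hDY : Metric.diam Y ≤ P.DY)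
    {w : PairSpace E F} (hw : w ∈ strategies X Y)
    (hsol : ∀ s ∈ strategies X Y, 0 ≤ ⟪nashField (Γ.reduced P z₀) w, s - w⟫)
    {T : ℕ} {z : ℕ → PairSpace E F} (hz0 : z 0 ∈ strategies X Y) (hT : P.iterationBound ≤ T)
    (hz : IsICLRun X Y (Γ.reduced P z₀) P.η P.innerAccuracy T z) :
    z T ∈ strategies X Y ∧ ‖z T - w‖ ^ 2 ≤ P.accuracy := by
  have hm := hP.m_pos
  have hη := hP.inv_η_pos
  have hD := hP.D_pos
  have hacc := hP.accuracy_pos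
  have key : ∀ t ≤ T, z t ∈ strategies X Y ∧
      ‖z t - w‖ ^ 2 ≤ (1 - P.θ) ^ t * P.D ^ 2 + P.accuracy / 2 := by
    intro t
    induction t with
    | zero =>
      intro _
      refine ⟨hz0, ?_⟩
      have := pow_le_pow_left₀ (norm_nonneg _) (norm_sub_le_D hX hY hDX hDY hz0 hw) 2
      linarith
    | succ t ih =>
      intro ht
      obtain ⟨h1, h2⟩ := ih (by omega)
      refine ⟨(hz t (by omega)).1, ?_⟩
      have h3 := icl_step hP hΓ hXc hYc hw hsol h1 (hz t (by omega))
      rw [P.innerAccuracy_eq, P.θ_eq] at h3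
      have e1 : 1 - P.θ = P.η⁻¹ / (P.η⁻¹ + P.m) := by
        rw [P.θ_eq, one_sub_div (by positivity), add_sub_cancel_right]
      -- One of the two copies of m gained in a step is given up, so that the factor is exactly 1 -
      -- θ.
      have h4 : (P.η⁻¹ + P.m) * ‖z (t + 1) - w‖ ^ 2
          ≤ (P.η⁻¹ + 2 * P.m) * ‖z (t + 1) - w‖ ^ 2 := by
        gcongr; linarith
      have h5 : P.m / (P.η⁻¹ + P.m) * P.accuracy * P.η⁻¹
          ≤ P.m * P.accuracy := by
        have : P.η⁻¹ / (P.η⁻¹ + P.m) ≤ 1 := by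
          rw [div_le_one (by positivity)]; linarith
        calc _ = P.m * P.accuracy * (P.η⁻¹ / (P.η⁻¹ + P.m)) := by ring
          _ ≤ P.m * P.accuracy * 1 := by gcongr
          _ = _ := mul_one _
      have h6 := mul_le_mul_of_nonneg_left h2 hη.le
      have e2 : (P.η⁻¹ + P.m) * ((1 - P.θ) ^ (t + 1) * P.D ^ 2 + P.accuracy / 2)
          = P.η⁻¹ * ((1 - P.θ) ^ t * P.D ^ 2) + (P.η⁻¹ + P.m) * (P.accuracy / 2) := by
        have e3 : (P.η⁻¹ + P.m) * (1 - P.θ) = P.η⁻¹ := by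
          rw [e1, mul_div_cancel₀ _ (by positivity)]
        rw [pow_succ]
        linear_combination (1 - P.θ) ^ t * P.D ^ 2 * e3
      refine le_of_mul_le_mul_left ?_ (by positivity : 0 < P.η⁻¹ + P.m)
      linarith
  obtain ⟨h1, h2⟩ := key T le_rfl
  refine ⟨h1, ?_⟩
  have hθ := hP.θ_pos
  have hθ1 := hP.θ_lt_one
  have h3 : Real.log (2 * P.D ^ 2 / P.accuracy) ≤ P.θ * T := by
    rw [Params.iterationBound, one_div, inv_mul_le_iff₀ hθ] at hT
    exact hT
  have h4 : (1 - P.θ) ^ T ≤ Real.exp (-(P.θ * T)) := by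
    calc (1 - P.θ) ^ T ≤ Real.exp (-P.θ) ^ T :=
          pow_le_pow_left₀ (by linarith) (by linarith [Real.add_one_le_exp (-P.θ)]) T
      _ = _ := by rw [← Real.exp_nat_mul]; ring_nf
  have h5 : Real.exp (-(P.θ * T)) ≤ P.accuracy / (2 * P.D ^ 2) := by
    rw [← Real.le_log_iff_exp_le (by positivity), ← inv_div (2 * P.D ^ 2), Real.log_inv]
    linarith
  have h6 : (1 - P.θ) ^ T * P.D ^ 2 ≤ P.accuracy / (2 * P.D ^ 2) * P.D ^ 2 := by
    gcongr
    exact h4.trans h5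
  have e : P.accuracy / (2 * P.D ^ 2) * P.D ^ 2 = P.accuracy / 2 := by field_simp
  linarith

end Reduced

/-! ### The extragradient step -/

section Extragradient

variable {E F : Type*} [NormedAddCommGroup E] [InnerProductSpace ℝ E]
  [NormedAddCommGroup F] [InnerProductSpace ℝ F]
  {X : Set E} {Y : Set F} {P : Params} {Γ : Game E F} {z₀ : PairSpace E F}

theorem nashField_eq (R : Game E F) (z : PairSpace E F) :
    nashField R z = -pair (R.grad₁ z).fst (R.grad₂ z).snd := by
  apply pair_ext
  · simp only [nashField, Game.saddleField, Game.gradg, Game.gradh, flipSnd, WithLp.add_fst,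
      WithLp.smul_fst, WithLp.neg_fst, fst_pair]
    module
  · simp only [nashField, Game.saddleField, Game.gradg, Game.gradh, flipSnd, WithLp.add_snd,
      WithLp.smul_snd, WithLp.neg_snd, snd_pair]
    module

theorem norm_regGrad_sub_le (hP : P.Admissible) (z₀ z z' : PairSpace E F) :
    ‖regGrad P.a P.b z₀ z - regGrad P.a P.b z₀ z'‖ ≤ P.L * ‖z - z'‖ := by
  have h := norm_pair_smul_le (mul_pos two_pos hP.a_pos).le (mul_pos two_pos hP.b_pos).le
    P.two_mul_a_le P.two_mul_b_le (flipSnd (z' - z))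
  rw [norm_flipSnd, norm_sub_rev] at h
  convert h using 2
  apply pair_ext
  · simp only [regGrad, flipSnd, WithLp.sub_fst, fst_pair]
    module
  · simp only [regGrad, flipSnd, WithLp.sub_snd, snd_pair]
    module

theorem norm_grad₁_reduced_sub_le (hP : P.Admissible)
    (hΓ : IsMonotoneNearZeroSum X Y P.L P.δ P.μ P.ν Γ) (z₀ : PairSpace E F) {z z' : PairSpace E F}
    (hz : z ∈ strategies X Y) (hz' : z' ∈ strategies X Y) :
    ‖(Γ.reduced P z₀).grad₁ z - (Γ.reduced P z₀).grad₁ z'‖ ≤ 2 * P.L * ‖z - z'‖ := by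
  have h1 := hΓ.smooth₁.2 z' hz' z hz
  have h2 := norm_regGrad_sub_le hP z₀ z z'
  have e : (Γ.reduced P z₀).grad₁ z - (Γ.reduced P z₀).grad₁ z'
      = (Γ.grad₁ z - Γ.grad₁ z') + (regGrad P.a P.b z₀ z - regGrad P.a P.b z₀ z') := by
    simp only [Game.reduced, Game.regularize]
    abel
  rw [e]
  linarith [norm_add_le (Γ.grad₁ z - Γ.grad₁ z') (regGrad P.a P.b z₀ z - regGrad P.a P.b z₀ z')]

theorem norm_grad₂_reduced_sub_le (hP : P.Admissible)
    (hΓ : IsMonotoneNearZeroSum X Y P.L P.δ P.μ P.ν Γ) (z₀ : PairSpace E F) {z z' : PairSpace E F}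
    (hz : z ∈ strategies X Y) (hz' : z' ∈ strategies X Y) :
    ‖(Γ.reduced P z₀).grad₂ z - (Γ.reduced P z₀).grad₂ z'‖ ≤ 2 * P.L * ‖z - z'‖ := by
  have h1 := hΓ.smooth₂.2 z' hz' z hz
  have h2 := norm_regGrad_sub_le hP z₀ z z'
  have e : (Γ.reduced P z₀).grad₂ z - (Γ.reduced P z₀).grad₂ z'
      = (Γ.grad₂ z - Γ.grad₂ z') - (regGrad P.a P.b z₀ z - regGrad P.a P.b z₀ z') := by
    simp only [Game.reduced, Game.regularize]
    abel
  rw [e]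
  linarith [norm_sub_le (Γ.grad₂ z - Γ.grad₂ z') (regGrad P.a P.b z₀ z - regGrad P.a P.b z₀ z')]

/-- After a projected gradient step from `x` to `x'`, the gain of a deviation to `u` is small, even
for the gradient without the regularization term `-2 r (x' - x₀)`. -/
theorem inner_le_of_projected_step {H : Type*} [NormedAddCommGroup H] [InnerProductSpace ℝ H]
    {S : Set H} (hS : IsCompact S) (hc : Convex ℝ S) {L D ε r γ d : ℝ} (hγ : 0 < γ)
    (hγL : γ⁻¹ = 2 * √2 * L) (hL : 0 < L) (hDS : Metric.diam S ≤ D)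
    (hr0 : 0 ≤ r) (hr : r * D ^ 2 ≤ ε / 4) (hd : 8 * L * D * d ≤ ε) (hd0 : 0 ≤ d)
    {x x₀ u v v' : H} (hx₀ : x₀ ∈ S) (hu : u ∈ S) (hxx : ‖proj S (x + γ • v) - x‖ ≤ d)
    (hv : ‖v' - v‖ ≤ 2 * L * d) :
    ⟪v' + (2 * r) • (proj S (x + γ • v) - x₀), u - proj S (x + γ • v)⟫ ≤ ε := by
  have hx' : proj S (x + γ • v) ∈ S := (proj_spec hS ⟨u, hu⟩ _).1
  have hp := inner_sub_proj_nonpos hS hc ⟨u, hu⟩ (x + γ • v) hu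
  generalize proj S (x + γ • v) = x' at *
  have h1 := (Metric.dist_le_diam_of_mem hS.isBounded hu hx').trans hDS
  have h2 := (Metric.dist_le_diam_of_mem hS.isBounded hu hx₀).trans hDS
  rw [dist_eq_norm] at h1 h2
  have hD0 : 0 ≤ D := (norm_nonneg _).trans h1
  -- Three contributions: the change of the gradient together with the displacement, the projection
  -- inequality (nonpositive), and the regularization. The first is at most 5LdD ≤ 5ε/8 and the last
  -- at most rD² ≤ ε/4.
  have e1 : ⟪v' + (2 * r) • (x' - x₀), u - x'⟫ = ⟪v' - v + γ⁻¹ • (x' - x), u - x'⟫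
      + γ⁻¹ * ⟪x + γ • v - x', u - x'⟫ + r * (2 * ⟪x' - x₀, u - x'⟫) := by
    rw [← real_inner_smul_left, ← mul_assoc, mul_comm r 2, ← real_inner_smul_left,
      ← inner_add_left, ← inner_add_left]
    congr 2
    rw [smul_sub γ⁻¹ (x + γ • v), smul_add, smul_smul, inv_mul_cancel₀ hγ.ne', one_smul, smul_sub]
    abel
  have h3 : γ⁻¹ * ⟪x + γ • v - x', u - x'⟫ ≤ 0 :=
    mul_nonpos_of_nonneg_of_nonpos (inv_nonneg.2 hγ.le) hp
  have h4 : 2 * ⟪x' - x₀, u - x'⟫ ≤ D ^ 2 := by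
    have e2 : ‖u - x₀‖ ^ 2 = ‖x' - x₀‖ ^ 2 + 2 * ⟪x' - x₀, u - x'⟫ + ‖u - x'‖ ^ 2 := by
      rw [← norm_add_sq_real]; congr 2; abel
    have h5 := pow_le_pow_left₀ (norm_nonneg _) h2 2
    linarith [sq_nonneg ‖x' - x₀‖, sq_nonneg ‖u - x'‖]
  have h5 : √2 ≤ 3 / 2 := by
    rw [Real.sqrt_le_left (by norm_num)]; norm_num
  have h6 : ‖v' - v + γ⁻¹ • (x' - x)‖ ≤ 5 * L * d := by
    have := norm_add_le (v' - v) (γ⁻¹ • (x' - x))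
    rw [norm_smul, Real.norm_eq_abs, abs_of_pos (inv_pos.2 hγ), hγL] at this
    have h7 : 2 * √2 * L * ‖x' - x‖ ≤ 2 * (3 / 2) * L * d := by gcongr
    rw [hγL]
    linarith
  have h7 := real_inner_le_norm (v' - v + γ⁻¹ • (x' - x)) (u - x')
  have h8 : ‖v' - v + γ⁻¹ • (x' - x)‖ * ‖u - x'‖ ≤ 5 * L * d * D := by gcongr
  have h9 := mul_le_mul_of_nonneg_left h4 hr0
  have h10 : 0 ≤ 8 * L * D * d := by positivity
  linarith

theorem isApproxNash_extragradientStep (hP : P.Admissible)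
    (hΓ : IsMonotoneNearZeroSum X Y P.L P.δ P.μ P.ν Γ)
    (hX : IsCompact X) (hXc : Convex ℝ X) (hY : IsCompact Y) (hYc : Convex ℝ Y)
    (hDX : Metric.diam X ≤ P.DX) (hDY : Metric.diam Y ≤ P.DY) (hz₀ : z₀ ∈ strategies X Y)
    {w : PairSpace E F} (hw : w ∈ strategies X Y)
    (hsol : ∀ s ∈ strategies X Y, 0 ≤ ⟪nashField (Γ.reduced P z₀) w, s - w⟫)
    {z : PairSpace E F} (hz : z ∈ strategies X Y) (hzw : ‖z - w‖ ^ 2 ≤ P.accuracy) :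
    IsApproxNash X Y Γ P.ε (extragradientStep X Y P.γ z
      ((Γ.reduced P z₀).grad₁ z) ((Γ.reduced P z₀).grad₂ z)) := by
  have hL := hP.L_pos
  have hε := hP.ε_pos
  have hD := hP.D_pos
  have hγ := hP.γ_pos
  set R := Γ.reduced P z₀ with hR
  set z' := extragradientStep X Y P.γ z (R.grad₁ z) (R.grad₂ z) with hz'
  have hz'1 : z'.fst = proj X (z.fst + P.γ • (R.grad₁ z).fst) := rfl
  have hz'2 : z'.snd = proj Y (z.snd + P.γ • (R.grad₂ z).snd) := rfl
  have hz'S : z' ∈ strategies X Y :=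
    ⟨(proj_spec hX ⟨_, hz.1⟩ _).1, (proj_spec hY ⟨_, hz.2⟩ _).1⟩
  have hstep : ∀ s ∈ strategies X Y, ⟪z - P.γ • nashField R z - z', s - z'⟫ ≤ 0 := by
    intro s hs
    rw [nashField_eq, smul_neg, sub_neg_eq_add, pair_inner]
    simp only [WithLp.add_fst, WithLp.add_snd, WithLp.sub_fst, WithLp.sub_snd, WithLp.smul_fst,
      WithLp.smul_snd, fst_pair, snd_pair, hz'1, hz'2]
    exact add_nonpos (inner_sub_proj_nonpos hX hXc ⟨_, hz.1⟩ _ hs.1)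
      (inner_sub_proj_nonpos hY hYc ⟨_, hz.2⟩ _ hs.2)
  -- Each component comes from a 2L-Lipschitz gradient, so the operator is 2√2 L-Lipschitz; this is
  -- 1/γ.
  have hlip : P.γ * ‖nashField R z - nashField R w‖ ≤ ‖z - w‖ := by
    rw [← le_div_iff₀' hγ, div_eq_inv_mul, P.inv_γ]
    refine (sq_le_sq₀ (norm_nonneg _) (by positivity)).1 ?_
    have h1 := pow_le_pow_left₀ (norm_nonneg _)
      ((norm_fst_le_norm _).trans (norm_grad₁_reduced_sub_le hP hΓ z₀ hz hw)) 2
    have h2 := pow_le_pow_left₀ (norm_nonneg _)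
      ((norm_snd_le_norm _).trans (norm_grad₂_reduced_sub_le hP hΓ z₀ hz hw)) 2
    rw [nashField_eq, nashField_eq, ← neg_sub', norm_neg, pair_norm_sq]
    simp only [WithLp.sub_fst, WithLp.sub_snd, fst_pair, snd_pair] at h1 h2 ⊢
    have e : (2 * √2 * P.L * ‖z - w‖) ^ 2 = 2 * (2 * P.L * ‖z - w‖) ^ 2 := by
      rw [mul_pow, mul_pow, mul_pow, Real.sq_sqrt zero_le_two]; ring
    rw [e]
    linarith
  have hmono : 0 ≤ ⟪nashField R z - nashField R w, z - w⟫ :=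
    le_trans (mul_nonneg hP.m_pos.le (sq_nonneg _)) (nashField_monotone hP hΓ hXc hYc z₀ z hz w hw)
  have hmove := norm_sub_sq_le_of_projection_step hγ.le hz'S hw hsol hmono hlip hstep
  have hd : ‖z' - z‖ ≤ P.ε / (8 * P.L * P.D) := by
    refine (sq_le_sq₀ (norm_nonneg _) (by positivity)).1 ?_
    -- The constant 128 in ε' is 2 · 8²: the step is at most √2 times the distance to the
    -- equilibrium, and must not exceed ε/(8LD).
    have e : (P.ε / (8 * P.L * P.D)) ^ 2 = 2 * P.accuracy := by
      rw [Params.accuracy]; field_simp; norm_num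
    rw [e]
    linarith
  have hd0 : 0 ≤ P.ε / (8 * P.L * P.D) := by positivity
  have hd8 : 8 * P.L * P.D * (P.ε / (8 * P.L * P.D)) = P.ε := by field_simp
  have hdX : 8 * P.L * P.DX * (P.ε / (8 * P.L * P.D)) ≤ P.ε := by
    rw [← hd8]
    have := P.DX_le_D
    gcongr
    rw [hd8]
  have hdY : 8 * P.L * P.DY * (P.ε / (8 * P.L * P.D)) ≤ P.ε := by
    rw [← hd8]
    have := P.DY_le_D
    gcongr
    rw [hd8]
  have haD : P.a * P.DX ^ 2 ≤ P.ε / 4 := by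
    have := hP.DX_pos
    calc P.a * P.DX ^ 2 ≤ P.ε / (4 * P.DX ^ 2) * P.DX ^ 2 := by gcongr; exact min_le_left _ _
      _ = _ := by field_simp
  have hbD : P.b * P.DY ^ 2 ≤ P.ε / 4 := by
    have := hP.DY_pos
    calc P.b * P.DY ^ 2 ≤ P.ε / (4 * P.DY ^ 2) * P.DY ^ 2 := by gcongr; exact min_le_left _ _
      _ = _ := by field_simp
  have hfield := hΓ.isSaddleField_h hXc hYc
  have hu₁ : ∀ z, Γ.u₁ z = -Γ.g z - Γ.h z := fun z => by simp only [Game.g, Game.h]; ring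
  have hu₂ : ∀ z, Γ.u₂ z = -Γ.g z + Γ.h z := fun z => by simp only [Game.g, Game.h]; ring
  have hg₁ : Γ.grad₁ z' = -Γ.gradg z' - Γ.gradh z' := by
    simp only [Game.gradg, Game.gradh]; module
  have hg₂ : Γ.grad₂ z' = -Γ.gradg z' + Γ.gradh z' := by
    simp only [Game.gradg, Game.gradh]; module
  refine ⟨hz'S, fun x hx => ?_, fun y hy => ?_⟩
  -- Since u₁ = -g - h is concave in x, the gain of a deviation is at most the inner product of ∇ₓu₁
  -- with it.
  · have h1 := hΓ.g_add_inner_le hXc hYc hz'S (z' := pair x z'.snd) ⟨hx, hz'S.2⟩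
    have h2 := hfield.lower z' hz'S x hx
    have h3 : 0 ≤ P.μ / 2 * ‖x - z'.fst‖ ^ 2 :=
      mul_nonneg (div_nonneg hP.μ_mem.1 zero_le_two) (sq_nonneg _)
    rw [pair_inner] at h1
    simp only [WithLp.sub_fst, WithLp.sub_snd, fst_pair, snd_pair, sub_self, inner_zero_right,
      add_zero] at h1
    simp only [Game.saddleField, flipSnd, fst_pair] at h2
    have h4 := inner_le_of_projected_step hX hXc hγ P.inv_γ hL hDX hP.a_pos.le haD hdX hd0 hz₀.1
      hx (x := z.fst) (v := (R.grad₁ z).fst) (v' := (R.grad₁ z').fst)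
      (by rw [← hz'1]; exact (norm_fst_le_norm (z' - z)).trans hd)
      (((norm_fst_le_norm _).trans (norm_grad₁_reduced_sub_le hP hΓ z₀ hz'S hz)).trans (by gcongr))
    rw [← hz'1] at h4
    have e : (R.grad₁ z').fst + (2 * P.a) • (z'.fst - z₀.fst)
        = -(Γ.gradg z').fst - (Γ.gradh z').fst := by
      have : (Γ.grad₁ z').fst = -(Γ.gradg z').fst - (Γ.gradh z').fst := by rw [hg₁]; rfl
      rw [← this, hR]
      simp only [Game.reduced, Game.regularize, regGrad, WithLp.add_fst, fst_pair]
      module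
    rw [e, inner_sub_left, inner_neg_left] at h4
    rw [hu₁, hu₁]
    linarith
  · have h1 := hΓ.g_add_inner_le hXc hYc hz'S (z' := pair z'.fst y) ⟨hz'S.1, hy⟩
    have h2 := hfield.upper z' hz'S y hy
    have h3 : 0 ≤ P.ν / 2 * ‖y - z'.snd‖ ^ 2 :=
      mul_nonneg (div_nonneg hP.ν_mem.1 zero_le_two) (sq_nonneg _)
    rw [pair_inner] at h1
    simp only [WithLp.sub_fst, WithLp.sub_snd, fst_pair, snd_pair, sub_self, inner_zero_right,
      zero_add] at h1
    simp only [Game.saddleField, flipSnd, snd_pair, inner_neg_left] at h2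
    have h4 := inner_le_of_projected_step hY hYc hγ P.inv_γ hL hDY hP.b_pos.le hbD hdY hd0 hz₀.2
      hy (x := z.snd) (v := (R.grad₂ z).snd) (v' := (R.grad₂ z').snd)
      (by rw [← hz'2]; exact (norm_snd_le_norm (z' - z)).trans hd)
      (((norm_snd_le_norm _).trans (norm_grad₂_reduced_sub_le hP hΓ z₀ hz'S hz)).trans (by gcongr))
    rw [← hz'2] at h4
    have e : (R.grad₂ z').snd + (2 * P.b) • (z'.snd - z₀.snd)
        = -(Γ.gradg z').snd + (Γ.gradh z').snd := by
      have : (Γ.grad₂ z').snd = -(Γ.gradg z').snd + (Γ.gradh z').snd := by rw [hg₂]; rfl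
      rw [← this, hR]
      simp only [Game.reduced, Game.regularize, regGrad, WithLp.sub_snd, snd_pair]
      module
    rw [e, inner_add_left, inner_neg_left] at h4
    rw [hu₂, hu₂]
    linarith

/-- Every sufficiently long run of ICL, followed by an extragradient step, finds an approximate
Nash equilibrium. -/
theorem isApproxNash_of_isICLRun (hP : P.Admissible)
    (hΓ : IsMonotoneNearZeroSum X Y P.L P.δ P.μ P.ν Γ)
    (hX : IsCompact X) (hXc : Convex ℝ X) (hY : IsCompact Y) (hYc : Convex ℝ Y)
    (hDX : Metric.diam X ≤ P.DX) (hDY : Metric.diam Y ≤ P.DY) (hz₀ : z₀ ∈ strategies X Y)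
    {T : ℕ} {z : ℕ → PairSpace E F} (hz0 : z 0 = z₀) (hT : P.iterationBound ≤ T)
    (hz : IsICLRun X Y (Γ.reduced P z₀) P.η P.innerAccuracy T z) :
    IsApproxNash X Y Γ P.ε (extragradientStep X Y P.γ (z T)
      ((Γ.reduced P z₀).grad₁ (z T)) ((Γ.reduced P z₀).grad₂ (z T))) := by
  obtain ⟨w, hw, hsol⟩ := exists_nash hP hΓ hX hXc hY hYc ⟨z₀, hz₀⟩ z₀
  obtain ⟨h1, h2⟩ := icl_convergence hP hΓ hX hXc hY hYc hDX hDY hw hsol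
    (by rw [hz0]; exact hz₀) hT hz
  exact isApproxNash_extragradientStep hP hΓ hX hXc hY hYc hDX hDY hz₀ hw hsol h1 h2

end Extragradient

/-! ### The number of gradient queries -/

namespace Params

variable {P : Params}

/-- `L² D² / (m ε)`. -/
def innerRatio (P : Params) : ℝ := P.L ^ 2 * P.D ^ 2 / (P.m * P.ε)

/-- `L D² / ε`. -/
def outerRatio (P : Params) : ℝ := P.L * P.D ^ 2 / P.ε

theorem one_le_tlog (s : ℝ) : 1 ≤ tlog s := le_max_left _ _

theorem tlog_pos (s : ℝ) : 0 < tlog s := zero_lt_one.trans_le (one_le_tlog s)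

theorem le_exp_tlog {s : ℝ} (hs : 0 < s) : s ≤ Real.exp (tlog s) := by
  rw [← Real.log_le_iff_le_exp hs]
  exact le_max_right _ _

theorem two_le_exp_tlog (s : ℝ) : 2 ≤ Real.exp (tlog s) := by
  have := Real.add_one_le_exp (tlog s)
  linarith [one_le_tlog s]

namespace Admissible

variable (hP : P.Admissible)
include hP

theorem innerRatio_pos : 0 < P.innerRatio := by
  have h1 := hP.L_pos
  have h2 := hP.D_pos
  have h3 := hP.m_pos
  have h4 := hP.ε_pos
  rw [innerRatio]
  positivity

theorem outerRatio_pos : 0 < P.outerRatio := by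
  have h1 := hP.L_pos
  have h2 := hP.D_pos
  have h4 := hP.ε_pos
  rw [outerRatio]
  positivity

omit hP in
theorem m_le_inv_η (P : Params) : P.m ≤ P.η⁻¹ := by
  rw [P.inv_η]
  exact le_max_right _ _

theorem le_innerAccuracy : P.m * P.accuracy / 8 ≤ P.innerAccuracy := by
  have h1 := hP.m_pos
  have h2 := hP.inv_η_pos
  have h3 := hP.accuracy_pos
  have h4 : 1 / 2 ≤ P.η⁻¹ / (P.η⁻¹ + P.m) := by
    rw [div_le_div_iff₀ two_pos (by positivity)]
    linarith [m_le_inv_η P]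
  rw [P.innerAccuracy_eq, P.θ_eq]
  calc P.m * P.accuracy / 8 = P.m * P.accuracy / 4 * (1 / 2) := by ring
    _ ≤ P.m * P.accuracy / 4 * (P.η⁻¹ / (P.η⁻¹ + P.m)) := by gcongr
    _ = _ := by ring

/-- The accuracy of the subproblems is polynomial in the data, so the logarithm needed by the saddle
solver is a multiple of the truncated one. As exp of the latter is at least 2, absolute constants
become powers of it: 40 = 4 + 36. -/
theorem inner_exp_bound :
    18 * (4 * P.L) ^ 2 * P.D ^ 4 * max (P.μbar + P.η⁻¹) (P.νbar + P.η⁻¹)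
      ≤ min (P.μbar + P.η⁻¹) (P.νbar + P.η⁻¹) * P.innerAccuracy ^ 2
        * Real.exp (40 * tlog P.innerRatio) := by
  have hL := hP.L_pos
  have hD := hP.D_pos
  have hm := hP.m_pos
  have hε := hP.ε_pos
  have hacc := hP.accuracy_pos
  have hη := hP.inv_η_pos
  have h1 : max (P.μbar + P.η⁻¹) (P.νbar + P.η⁻¹) ≤ 4 * P.L :=
    max_le (by linarith [hP.μbar_le, hP.inv_η_le]) (by linarith [hP.νbar_le, hP.inv_η_le])
  have h2 : P.m ≤ min (P.μbar + P.η⁻¹) (P.νbar + P.η⁻¹) :=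
    min_le_min (by linarith) (by linarith)
  have h3 : P.innerRatio ^ 4 * 2 ^ 36 ≤ Real.exp (40 * tlog P.innerRatio) := by
    have e : Real.exp (40 * tlog P.innerRatio)
        = Real.exp (tlog P.innerRatio) ^ 4 * Real.exp (tlog P.innerRatio) ^ 36 := by
      rw [← pow_add, ← Real.exp_nat_mul]
      norm_num
    rw [e]
    have := hP.innerRatio_pos
    gcongr
    · exact le_exp_tlog hP.innerRatio_pos
    · exact two_le_exp_tlog _
  calc 18 * (4 * P.L) ^ 2 * P.D ^ 4 * max (P.μbar + P.η⁻¹) (P.νbar + P.η⁻¹)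
      ≤ 18 * (4 * P.L) ^ 2 * P.D ^ 4 * (4 * P.L) := by gcongr
    _ = 1152 * P.L ^ 3 * P.D ^ 4 := by ring
    _ ≤ 2 ^ 15 * P.L ^ 3 * P.D ^ 4 := by gcongr; norm_num
    _ = 2 ^ 15 * P.L ^ 4 * P.D ^ 4 / P.m * (P.m / P.L) := by field_simp
    _ ≤ 2 ^ 15 * P.L ^ 4 * P.D ^ 4 / P.m * 2 := by
        gcongr
        rw [div_le_iff₀ hL]
        exact hP.m_le
    _ = P.m * (P.m * P.accuracy / 8) ^ 2 * (P.innerRatio ^ 4 * 2 ^ 36) := by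
        rw [accuracy, innerRatio]
        field_simp
        norm_num
    _ ≤ _ := by
        have h4 := hP.innerRatio_pos
        have h5 := hP.innerAccuracy_pos
        have h6 : 0 < min (P.μbar + P.η⁻¹) (P.νbar + P.η⁻¹) := hm.trans_le h2
        gcongr
        exact hP.le_innerAccuracy

theorem iterations_le : (⌈P.iterationBound⌉₊ : ℝ) ≤ 9 * (1 / P.θ * tlog P.outerRatio) := by
  have hθ := hP.θ_pos
  have ht := one_le_tlog P.outerRatio
  have h1 : Real.log (2 * P.D ^ 2 / P.accuracy) ≤ 8 * tlog P.outerRatio := by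
    have hL := hP.L_pos
    have hD := hP.D_pos
    have hε := hP.ε_pos
    -- The logarithm is 2(4 log 2 + log s) with s = LD²/ε; since 8 log 2 < 6, it is at most 8 times
    -- the truncated logarithm.
    have e : 2 * P.D ^ 2 / P.accuracy = (2 ^ 4 * P.outerRatio) ^ 2 := by
      rw [accuracy, outerRatio]
      field_simp
      norm_num
    rw [e, Real.log_pow, Real.log_mul (by norm_num) hP.outerRatio_pos.ne', Real.log_pow]
    have h2 : Real.log P.outerRatio ≤ tlog P.outerRatio := le_max_right _ _
    have h3 := Real.log_two_lt_d9
    push_cast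
    linarith
  have h2 : P.iterationBound ≤ 8 * (1 / P.θ * tlog P.outerRatio) := by
    rw [iterationBound]
    calc _ ≤ 1 / P.θ * (8 * tlog P.outerRatio) := by gcongr
      _ = _ := by ring
  have h3 : 1 ≤ 1 / P.θ * tlog P.outerRatio := by
    have : 1 ≤ 1 / P.θ := (one_le_div hθ).2 hP.θ_lt_one.le
    exact one_le_mul_of_one_le_of_one_le this ht
  have h4 := Nat.ceil_lt_add_one (show 0 ≤ 8 * (1 / P.θ * tlog P.outerRatio) by linarith)
  have h5 : (⌈P.iterationBound⌉₊ : ℝ) ≤ ⌈8 * (1 / P.θ * tlog P.outerRatio)⌉₊ :=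
    Nat.cast_le.2 (Nat.ceil_mono h2)
  linarith

/-- The balance between the number of iterations of ICL and the cost of each. -/
theorem inv_θ_mul_le :
    1 / P.θ * (P.L / √((P.μbar + P.η⁻¹) * (P.νbar + P.η⁻¹)))
      ≤ 2 * (P.L / √(P.μbar * P.νbar)
          + P.L / min P.μbar P.νbar * min 1 √(P.δ / (P.μbar + P.νbar))) := by
  have hL := hP.L_pos
  have hm := hP.m_pos
  have hη := hP.inv_η_pos
  have hμ := hP.μbar_pos
  have hν := hP.νbar_pos
  have hδ := hP.δ_mem.1
  change _ ≤ 2 * (P.L / √(P.μbar * P.νbar)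
    + P.L / P.m * min 1 √(P.δ / (P.μbar + P.νbar)))
  have e : 1 / P.θ = (P.η⁻¹ + P.m) / P.m := by rw [P.θ_eq, one_div_div]
  rw [e]
  -- For δ ≤ m, 1/η = m and 1/θ = 2. For δ ≥ m, 1/η = δ and 1/θ ≤ 2δ/m.
  rcases le_total P.δ P.m with h | h
  · have h1 : P.η⁻¹ = P.m := by rw [P.inv_η, max_eq_right h]
    have h2 : 0 ≤ P.L / P.m * min 1 √(P.δ / (P.μbar + P.νbar)) := by positivity
    have h3 : P.L / √((P.μbar + P.m) * (P.νbar + P.m)) ≤ P.L / √(P.μbar * P.νbar) := by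
      gcongr
      · linarith
      · linarith
    have h4 : (P.m + P.m) / P.m = 2 := by field_simp; norm_num
    rw [h1, h4]
    linarith
  · have h1 : P.η⁻¹ = P.δ := by rw [P.inv_η, max_eq_left h]
    have hδ0 : 0 < P.δ := hm.trans_le h
    rw [h1]
    set q := (P.μbar + P.δ) * (P.νbar + P.δ) with hq
    have hq0 : 0 < q := by positivity
    -- Expanding the product gives q ≥ δ² and q ≥ δ(μbar + νbar), one for each entry of the minimum.
    have h2 : P.δ / √q ≤ min 1 √(P.δ / (P.μbar + P.νbar)) := by
      apply le_min
      · rw [div_le_one (Real.sqrt_pos.2 hq0)]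
        apply Real.le_sqrt_of_sq_le
        rw [hq]
        nlinarith [mul_pos hμ hν, mul_pos hμ hδ0, mul_pos hν hδ0]
      · apply Real.le_sqrt_of_sq_le
        rw [div_pow, Real.sq_sqrt hq0.le, div_le_div_iff₀ hq0 (by positivity), hq]
        nlinarith [mul_pos hμ hν, mul_pos (mul_pos hμ hν) hδ0, mul_pos hδ0 (mul_pos hδ0 hδ0)]
    have h3 : 0 ≤ P.L / √(P.μbar * P.νbar) := by positivity
    calc (P.δ + P.m) / P.m * (P.L / √q) ≤ (P.δ + P.δ) / P.m * (P.L / √q) := by gcongr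
      _ = 2 * (P.L / P.m * (P.δ / √q)) := by ring
      _ ≤ 2 * (P.L / P.m * min 1 √(P.δ / (P.μbar + P.νbar))) := by gcongr
      _ ≤ _ := by linarith

/-- The added query in each iteration is the one for ∇g, the final one belongs to the extragradient
step. Both are absorbed into the main term because all factors of the bound are bounded below, the
smallest by 1/4. -/
theorem total_le {q : ℝ} (hq : q ≤ 1033 *
      (4 * P.L / √((P.μbar + P.η⁻¹) * (P.νbar + P.η⁻¹))) * (40 * tlog P.innerRatio)) :
    ⌈P.iterationBound⌉₊ * (q + 1) + 1 ≤ 2975120 * P.rate := by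
  have hL := hP.L_pos
  have hη := hP.inv_η_pos
  have hμ := hP.μbar_pos
  have hν := hP.νbar_pos
  have hi := one_le_tlog P.innerRatio
  have ho := one_le_tlog P.outerRatio
  have hT := hP.iterations_le
  have hbal := hP.inv_θ_mul_le
  have hθ : 1 ≤ 1 / P.θ := (one_le_div hP.θ_pos).2 hP.θ_lt_one.le
  set r := P.L / √((P.μbar + P.η⁻¹) * (P.νbar + P.η⁻¹)) with hr
  have hr4 : 1 ≤ 4 * r := by
    rw [hr, mul_div_assoc', one_le_div (by positivity)]
    apply Real.sqrt_le_iff.2 ⟨by positivity, ?_⟩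
    rw [pow_two]
    exact mul_le_mul (by linarith [hP.μbar_le, hP.inv_η_le])
      (by linarith [hP.νbar_le, hP.inv_η_le]) (by positivity) (by positivity)
  have hr0 : 0 < r := by linarith
  have hone : 1 ≤ 4 * (r * tlog P.innerRatio) := by
    rw [← mul_assoc]
    exact one_le_mul_of_one_le_of_one_le hr4 hi
  -- 165280 = 1033 · 4 · 40, and `hone` pays 4 for the extra query.
  have hq1 : q + 1 ≤ 165284 * (r * tlog P.innerRatio) := by
    have e : 1033 * (4 * P.L / √((P.μbar + P.η⁻¹) * (P.νbar + P.η⁻¹))) * (40 * tlog P.innerRatio)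
        = 165280 * (r * tlog P.innerRatio) := by rw [hr]; ring
    linarith
  have hθo : 1 ≤ 1 / P.θ * tlog P.outerRatio := one_le_mul_of_one_le_of_one_le hθ ho
  have hlast : 1 ≤ 1 / P.θ * tlog P.outerRatio * (4 * (r * tlog P.innerRatio)) :=
    one_le_mul_of_one_le_of_one_le hθo hone
  have hrate : P.rate = (P.L / √(P.μbar * P.νbar)
      + P.L / min P.μbar P.νbar * min 1 √(P.δ / (P.μbar + P.νbar)))
        * tlog P.innerRatio * tlog P.outerRatio := rfl
  calc ⌈P.iterationBound⌉₊ * (q + 1) + 1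
      ≤ 9 * (1 / P.θ * tlog P.outerRatio) * (165284 * (r * tlog P.innerRatio))
        + 1 / P.θ * tlog P.outerRatio * (4 * (r * tlog P.innerRatio)) := by
        refine add_le_add ?_ hlast
        exact (mul_le_mul_of_nonneg_left hq1 (Nat.cast_nonneg _)).trans
          (mul_le_mul_of_nonneg_right hT (by positivity))
    _ = 1487560 * (1 / P.θ * r) * tlog P.innerRatio * tlog P.outerRatio := by ring
    _ ≤ 1487560 * (2 * (P.L / √(P.μbar * P.νbar)
      + P.L / min P.μbar P.νbar * min 1 √(P.δ / (P.μbar + P.νbar))))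
        * tlog P.innerRatio * tlog P.outerRatio := by gcongr
    _ = _ := by rw [hrate]; ring

/-! ### The explicit rates -/

/-- When m is at least of order ε/D², the argument of the inner logarithm is at most 2(LD²/ε)². Both
logarithms are then comparable, which explains the squared logarithm in the explicit rates. -/
theorem tlog_innerRatio_le (h : P.ε / (2 * P.D ^ 2) ≤ P.m) :
    tlog P.innerRatio ≤ 3 * tlog P.outerRatio := by
  have hL := hP.L_pos
  have hD := hP.D_pos
  have hε := hP.ε_pos
  have h1 : P.innerRatio ≤ 2 * P.outerRatio ^ 2 := by
    calc P.innerRatio ≤ P.L ^ 2 * P.D ^ 2 / (P.ε / (2 * P.D ^ 2) * P.ε) := by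
          rw [innerRatio]; gcongr
      _ = _ := by rw [outerRatio]; field_simp
  have h2 := Real.log_le_log hP.innerRatio_pos h1
  rw [Real.log_mul (by norm_num) (pow_pos hP.outerRatio_pos 2).ne', Real.log_pow] at h2
  have h3 := Real.log_two_lt_d9
  have h4 : Real.log P.outerRatio ≤ tlog P.outerRatio := le_max_right _ _
  have h5 := one_le_tlog P.outerRatio
  push_cast at h2
  exact max_le (by linarith) (by linarith)

theorem rate_le_of_le {x y : ℝ} (h : P.ε / (2 * P.D ^ 2) ≤ P.m)
    (hx : P.L / √(P.μbar * P.νbar) ≤ 4 * x)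
    (hy : P.L / P.m * min 1 √(P.δ / (P.μbar + P.νbar)) ≤ 4 * y) :
    P.rate ≤ 12 * ((x + y) * tlog P.outerRatio ^ 2) := by
  have hL := hP.L_pos
  have hm := hP.m_pos
  have h1 := tlog_pos P.outerRatio
  have h2 := hP.tlog_innerRatio_le h
  have hxy : 0 ≤ 4 * (x + y) := by
    have : 0 ≤ P.L / √(P.μbar * P.νbar) := by positivity
    have : 0 ≤ P.L / P.m * min 1 √(P.δ / (P.μbar + P.νbar)) := by positivity
    linarith
  change (P.L / √(P.μbar * P.νbar) + P.L / P.m * min 1 √(P.δ / (P.μbar + P.νbar)))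
        * tlog P.innerRatio * tlog P.outerRatio ≤ _
  calc _ ≤ 4 * (x + y) * (3 * tlog P.outerRatio) * tlog P.outerRatio := by
        gcongr
        · exact (tlog_pos _).le
        · linarith
    _ = _ := by ring

theorem νbar_eq (hν : P.ν = 0) (hε : P.ε ≤ 2 * P.L * P.DY ^ 2) : P.νbar = P.ε / (2 * P.DY ^ 2) := by
  have h1 := hP.DY_pos
  rw [νbar, hν, zero_add, min_eq_left]
  rw [div_le_iff₀ (by positivity)]
  linarith

theorem μbar_eq (hμ : P.μ = 0) (hε : P.ε ≤ 2 * P.L * P.DX ^ 2) : P.μbar = P.ε / (2 * P.DX ^ 2) := by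
  have h1 := hP.DX_pos
  rw [μbar, hμ, zero_add, min_eq_left]
  rw [div_le_iff₀ (by positivity)]
  linarith

theorem rate_le_rateA (hμ : 0 < P.μ) (hν : P.ν = 0) (hε : P.ε ≤ 2 * P.L * P.DY ^ 2)
    (hle : P.νbar ≤ P.μbar) : P.rate ≤ 12 * P.rateA := by
  have hL := hP.L_pos
  have hDY := hP.DY_pos
  have hε0 := hP.ε_pos
  have hνb := hP.νbar_eq hν hε
  have hμb : P.μ ≤ P.μbar := by
    rw [← P.μ_add_two_mul_a]; linarith [hP.a_pos]
  have hm : P.m = P.ε / (2 * P.DY ^ 2) := by rw [m, min_eq_right hle, hνb]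
  have hδ := hP.δ_mem.1
  have hνp := hP.νbar_pos
  refine hP.rate_le_of_le ?_ ?_ ?_
  · rw [hm]
    have := P.DY_le_D
    gcongr
  · have h1 : √(P.μ * P.ε) / (2 * P.DY) ≤ √(P.μbar * P.νbar) := by
      apply Real.le_sqrt_of_sq_le
      rw [div_pow, Real.sq_sqrt (by positivity), hνb]
      have hμp := hP.μbar_pos
      calc P.μ * P.ε / (2 * P.DY) ^ 2 = P.μ * (P.ε / (2 * P.DY ^ 2)) * (1 / 2) := by
            field_simp
        _ ≤ P.μbar * (P.ε / (2 * P.DY ^ 2)) * 1 := by gcongr; norm_num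
        _ = _ := mul_one _
    calc P.L / √(P.μbar * P.νbar) ≤ P.L / (√(P.μ * P.ε) / (2 * P.DY)) := by gcongr
      _ = 2 * (P.L * P.DY / √(P.μ * P.ε)) := by field_simp
      _ ≤ 4 * (P.L * P.DY / √(P.μ * P.ε)) := by gcongr; norm_num
  · have h1 : min 1 √(P.δ / (P.μbar + P.νbar)) ≤ min 1 √(P.δ / P.μ) := by
      refine min_le_min_left _ (Real.sqrt_le_sqrt ?_)
      gcongr
      linarith
    calc P.L / P.m * min 1 √(P.δ / (P.μbar + P.νbar)) ≤ P.L / P.m * min 1 √(P.δ / P.μ) := by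
          rw [hm]; gcongr
      _ = 2 * (P.L * P.DY ^ 2 / P.ε * min 1 √(P.δ / P.μ)) := by rw [hm]; field_simp
      _ ≤ 4 * (P.L * P.DY ^ 2 / P.ε * min 1 √(P.δ / P.μ)) := by gcongr; norm_num

theorem rate_le_rateB (hμ : P.μ = 0) (hν : 0 < P.ν) (hε : P.ε ≤ 2 * P.L * P.DX ^ 2)
    (hle : P.μbar ≤ P.νbar) : P.rate ≤ 12 * P.rateB := by
  have hL := hP.L_pos
  have hDX := hP.DX_pos
  have hε0 := hP.ε_pos
  have hμb := hP.μbar_eq hμ hε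
  have hνb : P.ν ≤ P.νbar := by
    rw [← P.ν_add_two_mul_b]; linarith [hP.b_pos]
  have hm : P.m = P.ε / (2 * P.DX ^ 2) := by rw [m, min_eq_left hle, hμb]
  have hδ := hP.δ_mem.1
  have hμp := hP.μbar_pos
  refine hP.rate_le_of_le ?_ ?_ ?_
  · rw [hm]
    have := P.DX_le_D
    gcongr
  · have h1 : √(P.ν * P.ε) / (2 * P.DX) ≤ √(P.μbar * P.νbar) := by
      apply Real.le_sqrt_of_sq_le
      rw [div_pow, Real.sq_sqrt (by positivity), hμb]
      have hνp := hP.νbar_pos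
      calc P.ν * P.ε / (2 * P.DX) ^ 2 = P.ε / (2 * P.DX ^ 2) * P.ν * (1 / 2) := by
            field_simp
        _ ≤ P.ε / (2 * P.DX ^ 2) * P.νbar * 1 := by gcongr; norm_num
        _ = _ := mul_one _
    calc P.L / √(P.μbar * P.νbar) ≤ P.L / (√(P.ν * P.ε) / (2 * P.DX)) := by gcongr
      _ = 2 * (P.L * P.DX / √(P.ν * P.ε)) := by field_simp
      _ ≤ 4 * (P.L * P.DX / √(P.ν * P.ε)) := by gcongr; norm_num
  · have h1 : min 1 √(P.δ / (P.μbar + P.νbar)) ≤ min 1 √(P.δ / P.ν) := by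
      refine min_le_min_left _ (Real.sqrt_le_sqrt ?_)
      gcongr
      linarith
    calc P.L / P.m * min 1 √(P.δ / (P.μbar + P.νbar)) ≤ P.L / P.m * min 1 √(P.δ / P.ν) := by
          rw [hm]; gcongr
      _ = 2 * (P.L * P.DX ^ 2 / P.ε * min 1 √(P.δ / P.ν)) := by rw [hm]; field_simp
      _ ≤ 4 * (P.L * P.DX ^ 2 / P.ε * min 1 √(P.δ / P.ν)) := by gcongr; norm_num

theorem rate_le_rateC (hμ : P.μ = 0) (hν : P.ν = 0) (hεX : P.ε ≤ 2 * P.L * P.DX ^ 2)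
    (hεY : P.ε ≤ 2 * P.L * P.DY ^ 2) : P.rate ≤ 12 * P.rateC := by
  have hL := hP.L_pos
  have hDX := hP.DX_pos
  have hDY := hP.DY_pos
  have hD := hP.D_pos
  have hε0 := hP.ε_pos
  have hμb := hP.μbar_eq hμ hεX
  have hνb := hP.νbar_eq hν hεY
  have hm : P.ε / (2 * P.D ^ 2) ≤ P.m := by
    have h1 := P.DX_le_D
    have h2 := P.DY_le_D
    apply le_min
    · rw [hμb]; gcongr
    · rw [hνb]; gcongr
  have hδ := hP.δ_mem.1
  refine hP.rate_le_of_le hm ?_ ?_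
  · have h1 : √(P.μbar * P.νbar) = P.ε / (2 * (P.DX * P.DY)) := by
      rw [hμb, hνb, show P.ε / (2 * P.DX ^ 2) * (P.ε / (2 * P.DY ^ 2))
        = (P.ε / (2 * (P.DX * P.DY))) ^ 2 by field_simp,
        Real.sqrt_sq (by positivity)]
    calc P.L / √(P.μbar * P.νbar) = 2 * (P.L * P.DX * P.DY / P.ε) := by rw [h1]; field_simp
      _ ≤ 4 * (P.L * P.DX * P.DY / P.ε) := by gcongr; norm_num
  · set k := P.δ / (P.ε / P.DX ^ 2 + P.ε / P.DY ^ 2) with hk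
    have hk0 : 0 ≤ k := by positivity
    have e : P.δ / (P.μbar + P.νbar) = 2 * k := by
      rw [hμb, hνb, hk, show P.ε / (2 * P.DX ^ 2) + P.ε / (2 * P.DY ^ 2)
        = (P.ε / P.DX ^ 2 + P.ε / P.DY ^ 2) / 2 by field_simp]
      field_simp
    have h1 : √(2 * k) ≤ 2 * √k := by
      rw [Real.sqrt_le_left (by positivity), mul_pow, Real.sq_sqrt hk0]
      linarith
    -- The factor 2 here and the one in D² ≥ ε/(2m) make up the 4 that `rate_le_of_le` allows.
    have h2 : min 1 √(P.δ / (P.μbar + P.νbar)) ≤ 2 * min 1 √k := by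
      rw [e, mul_min_of_nonneg _ _ zero_le_two]
      exact min_le_min (by norm_num) h1
    have hm0 := hP.m_pos
    calc P.L / P.m * min 1 √(P.δ / (P.μbar + P.νbar))
        ≤ P.L / (P.ε / (2 * P.D ^ 2)) * (2 * min 1 √k) := by gcongr
      _ = 4 * (P.L * P.D ^ 2 / P.ε * min 1 √k) := by field_simp; ring

end Admissible

end Params

/-! ### ICL with the saddle point method for its subproblems -/

section Solver

variable {E F : Type*} [NormedAddCommGroup E] [InnerProductSpace ℝ E]
  [NormedAddCommGroup F] [InnerProductSpace ℝ F]
  {X : Set E} {Y : Set F} {P : Params} {z₀ : PairSpace E F}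

theorem run_iclMethod (Γ : Game E F)
    (solver : PairSpace E F → PairSpace E F → GradientMethod E F) (T : ℕ) (z : PairSpace E F) :
    (iclMethod solver T z).run Γ.oracle
      = (fun w => (solver w (Γ.gradg w)).run Γ.oracle)^[T] z := by
  induction T generalizing z with
  | zero => rfl
  | succ T ih =>
    rw [Function.iterate_succ_apply, ← ih]
    exact QueryMethod.run_bind _ _ _

theorem numQueries_iclMethod_le (Γ : Game E F)
    (solver : PairSpace E F → PairSpace E F → GradientMethod E F) {q : ℝ}
    (hq : ∀ w, ((solver w (Γ.gradg w)).numQueries Γ.oracle : ℝ) ≤ q) (T : ℕ) (z : PairSpace E F) :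
    ((iclMethod solver T z).numQueries Γ.oracle : ℝ) ≤ T * (q + 1) := by
  induction T generalizing z with
  | zero => simp [iclMethod, QueryMethod.numQueries]
  | succ T ih =>
    have e : (iclMethod solver (T + 1) z).numQueries Γ.oracle
        = (solver z (Γ.gradg z)).numQueries Γ.oracle
          + (iclMethod solver T ((solver z (Γ.gradg z)).run Γ.oracle)).numQueries Γ.oracle + 1 :=
      congrArg (· + 1) (QueryMethod.numQueries_bind _ _ _)
    rw [e]
    push_cast
    linarith [hq z, ih ((solver z (Γ.gradg z)).run Γ.oracle)]

theorem run_reducedMethod (Γ : Game E F)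
    (solver : PairSpace E F → PairSpace E F → GradientMethod E F) :
    (reducedMethod P X Y solver z₀).run Γ.oracle
      = extragradientStep X Y P.γ
        ((fun w => (solver w (Γ.gradg w)).run Γ.oracle)^[⌈P.iterationBound⌉₊] z₀)
        ((Γ.reduced P z₀).grad₁
          ((fun w => (solver w (Γ.gradg w)).run Γ.oracle)^[⌈P.iterationBound⌉₊] z₀))
        ((Γ.reduced P z₀).grad₂
          ((fun w => (solver w (Γ.gradg w)).run Γ.oracle)^[⌈P.iterationBound⌉₊] z₀)) := by
  rw [reducedMethod, QueryMethod.run_bind, run_iclMethod]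
  rfl

theorem numQueries_reducedMethod_le (Γ : Game E F)
    (solver : PairSpace E F → PairSpace E F → GradientMethod E F) {q : ℝ}
    (hq : ∀ w, ((solver w (Γ.gradg w)).numQueries Γ.oracle : ℝ) ≤ q) :
    ((reducedMethod P X Y solver z₀).numQueries Γ.oracle : ℝ)
      ≤ ⌈P.iterationBound⌉₊ * (q + 1) + 1 := by
  have h := numQueries_iclMethod_le Γ solver hq ⌈P.iterationBound⌉₊ z₀
  rw [reducedMethod, QueryMethod.numQueries_bind]
  push_cast
  exact add_le_add h (by simp [QueryMethod.numQueries])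

/-- The field of the subproblem at `w`, computed from `g = ∇g(w)` and the answer `a` of the
gradient oracle at `z`. -/
def subproblemAnswer (P : Params) (z₀ w g z : PairSpace E F)
    (a : PairSpace E F × PairSpace E F) : PairSpace E F :=
  flipSnd ((1 / 2 : ℝ) • (-a.1 + a.2) - regGrad P.a P.b z₀ z) + P.η⁻¹ • (z - w) + g

theorem subproblemAnswer_oracle (Γ : Game E F) (P : Params) (z₀ w : PairSpace E F) :
    (fun z => subproblemAnswer P z₀ w (Γ.gradg w) z (Γ.oracle z))
      = fun z => flipSnd (subproblemGrad (Γ.reduced P z₀) P.η w z) := by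
  funext z
  rw [flipSnd_subproblemGrad, Game.saddleField, gradh_reduced]
  rfl

theorem exists_subproblem_solver (hP : P.Admissible) (hX : IsCompact X) (hXc : Convex ℝ X)
    (hY : IsCompact Y) (hYc : Convex ℝ Y) (hDX : Metric.diam X ≤ P.DX)
    (hDY : Metric.diam Y ≤ P.DY) (hz₀ : z₀ ∈ strategies X Y) :
    ∃ solver : PairSpace E F → PairSpace E F → GradientMethod E F,
      ∀ Γ : Game E F, IsMonotoneNearZeroSum X Y P.L P.δ P.μ P.ν Γ → ∀ w,
        IsInexactSolution X Y (Γ.reduced P z₀) P.η P.innerAccuracy w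
          ((solver w (Γ.gradg w)).run Γ.oracle) ∧
        ((solver w (Γ.gradg w)).numQueries Γ.oracle : ℝ) ≤ 1033 *
          (4 * P.L / √((P.μbar + P.η⁻¹) * (P.νbar + P.η⁻¹)))
            * (40 * Params.tlog P.innerRatio) := by
  have hη := hP.inv_η_pos
  obtain ⟨M, hM⟩ := hasSaddleSolver hX hXc hY hYc ⟨z₀, hz₀⟩ (m := P.μbar + P.η⁻¹)
    (n := P.νbar + P.η⁻¹) (K := 4 * P.L) (l := 40 * Params.tlog P.innerRatio)
    (add_pos hP.μbar_pos hη) (add_pos hP.νbar_pos hη)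
    (by linarith [hP.μbar_le, hP.inv_η_le]) (by linarith [hP.νbar_le, hP.inv_η_le])
    (fun u hu v hv => norm_sub_le_D hX hY hDX hDY hu hv) hP.innerAccuracy_pos
    (by linarith [Params.one_le_tlog P.innerRatio]) hP.inner_exp_bound
  -- The frozen gradient is an argument of the solver, so each evaluation of the subproblem field
  -- costs exactly one query to the original game and the method depends on the game only through
  -- answers.
  refine ⟨fun w g => M.translate id (subproblemAnswer P z₀ w g) id, fun Γ hΓ w => ?_⟩
  have h := hM _ _ (isSaddleField_subproblem hP hΓ hXc hYc z₀ w)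
  rw [← subproblemAnswer_oracle] at h
  rw [QueryMethod.run_translate, QueryMethod.numQueries_translate, isInexactSolution_iff]
  exact ⟨⟨h.1.1, fun s hs => h.1.2 s hs⟩, h.2⟩

end Solver

end

/-! ### The main theorem -/

theorem mainTheorem3 :
    ∃ C : ℝ, 0 < C ∧
      ∀ (E : Type*) [NormedAddCommGroup E] [InnerProductSpace ℝ E] [FiniteDimensional ℝ E]
        (F : Type*) [NormedAddCommGroup F] [InnerProductSpace ℝ F] [FiniteDimensional ℝ F]
        (X : Set E) (Y : Set F) (P : Params) (z₀ : PairSpace E F),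
        IsCompact X → Convex ℝ X → IsCompact Y → Convex ℝ Y → z₀ ∈ strategies X Y →
        0 < P.L → P.δ ∈ Set.Icc 0 P.L → P.μ ∈ Set.Icc 0 P.L → P.ν ∈ Set.Icc 0 P.L →
        (P.μ = 0 ∨ P.ν = 0) →
        0 < P.DX → Metric.diam X ≤ P.DX → 0 < P.DY → Metric.diam Y ≤ P.DY → 0 < P.ε →
        -- any run of ICL on the regularized game, followed by an extragradient step
        (∀ Γ : Game E F, IsMonotoneNearZeroSum X Y P.L P.δ P.μ P.ν Γ →
          ∀ (T : ℕ) (z : ℕ → PairSpace E F), z 0 = z₀ → P.iterationBound ≤ T →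
            IsICLRun X Y (Γ.reduced P z₀) P.η P.innerAccuracy T z →
            IsApproxNash X Y Γ P.ε
              (extragradientStep X Y P.γ (z T)
                ((Γ.reduced P z₀).grad₁ (z T)) ((Γ.reduced P z₀).grad₂ (z T)))) ∧
        -- the number of gradient queries, with a suitable method for the subproblems
        ∃ solver : PairSpace E F → PairSpace E F → GradientMethod E F,
          ∀ Γ : Game E F, IsMonotoneNearZeroSum X Y P.L P.δ P.μ P.ν Γ →
            (∀ w ∈ strategies X Y,
              IsInexactSolution X Y (Γ.reduced P z₀) P.η P.innerAccuracy w
                ((solver w (Γ.gradg w)).run Γ.oracle)) ∧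
            IsApproxNash X Y Γ P.ε ((reducedMethod P X Y solver z₀).run Γ.oracle) ∧
            ((reducedMethod P X Y solver z₀).numQueries Γ.oracle : ℝ) ≤ C * P.rate ∧
            (0 < P.μ → P.ν = 0 → P.ε ≤ 2 * P.L * P.DY ^ 2 → P.νbar ≤ P.μbar →
              ((reducedMethod P X Y solver z₀).numQueries Γ.oracle : ℝ) ≤ C * P.rateA) ∧
            (P.μ = 0 → 0 < P.ν → P.ε ≤ 2 * P.L * P.DX ^ 2 → P.μbar ≤ P.νbar →
              ((reducedMethod P X Y solver z₀).numQueries Γ.oracle : ℝ) ≤ C * P.rateB) ∧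
            (P.μ = 0 → P.ν = 0 → P.ε ≤ 2 * P.L * P.DX ^ 2 → P.ε ≤ 2 * P.L * P.DY ^ 2 →
              ((reducedMethod P X Y solver z₀).numQueries Γ.oracle : ℝ) ≤ C * P.rateC) := by
  -- The factor 2975120 comes from `total_le`, and 12 from passing to the explicit rates.
  refine ⟨12 * 2975120, by norm_num, ?_⟩
  intro E _ _ _ F _ _ _ X Y P z₀ hX hXc hY hYc hz₀ hL hδ hμ hν _ hDX0 hDX hDY0 hDY hε
  have hP : P.Admissible := ⟨hL, hδ, hμ, hν, hDX0, hDY0, hε⟩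
  refine ⟨fun Γ hΓ T z hz0 hT hz =>
    isApproxNash_of_isICLRun hP hΓ hX hXc hY hYc hDX hDY hz₀ hz0 hT hz, ?_⟩
  obtain ⟨solver, hsolver⟩ := exists_subproblem_solver hP hX hXc hY hYc hDX hDY hz₀
  refine ⟨solver, fun Γ hΓ => ?_⟩
  have hcount := (numQueries_reducedMethod_le (P := P) (X := X) (Y := Y) (z₀ := z₀) Γ solver
    fun w => (hsolver Γ hΓ w).2).trans (hP.total_le le_rfl)
  refine ⟨fun w _ => (hsolver Γ hΓ w).1, ?_, ?_, fun h1 h2 h3 h4 => ?_, fun h1 h2 h3 h4 => ?_,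
    fun h1 h2 h3 h4 => ?_⟩
  · rw [run_reducedMethod]
    -- The method itself produces an ICL run, so the first part applies. A negative iteration bound
    -- has ceiling 0 in ℕ, and the run is then empty.
    refine isApproxNash_of_isICLRun hP hΓ hX hXc hY hYc hDX hDY hz₀
      (z := fun t => (fun w => (solver w (Γ.gradg w)).run Γ.oracle)^[t] z₀) rfl (Nat.le_ceil _)
      fun t _ => ?_
    beta_reduce
    rw [Function.iterate_succ_apply']
    exact (hsolver Γ hΓ _).1
  · linarith
  · linarith [hP.rate_le_rateA h1 h2 h3 h4]
  · linarith [hP.rate_le_rateB h1 h2 h3 h4]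
  · linarith [hP.rate_le_rateC h1 h2 h3 h4]
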